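/- **Language.** Types are $\tau ::= \mathsf{com}\mid \mathsf{val}\to\tau\mid\tau\to\tau$; expressions over stack variables $i$ are $E ::= i\mid 0\mid 1\mid -1\mid E+E\mid E-E$; terms over stack variables and typed identifiers $x$ are $$M ::= x\mid\lambda i.M\mid M\,E\mid\lambda x{:}\tau.M\mid M\,M\mid\mathsf{fix}\,M\mid\mathsf{if}\,(E{=}E)\,\mathsf{then}\,M\,\mathsf{else}\,M\mid M;M\mid\mathsf{let}\,i{=}\mathsf{new}\,\mathsf{in}\,M\mid\mathsf{free}(E)\mid\mathsf{let}\,i{=}E.f\,\mathsf{in}\,M\mid E.f{:=}E\quad(f\in\{0,1\}),$$ with the usual simple typing $\Delta\mid\Gamma\vdash M:\tau$ ($\mathsf{fix}\,M:\tau$ for $M:\tau\to\tau$; conditionals, sequencing and heap operations have type $\mathsf{com}$). Assertions are $P ::= E=E\mid E\le E\mid E\mapsto E,E\mid\mathsf{emp}\mid P*P\mid P\wedge P\mid\neg P\mid\exists i.P$; here $E\mapsto\text{-}$ and $E\mapsto\text{-},E_1$ abbreviate existential quantification of the omitted contents. Specifications are $$\varphi ::= \{P\}M\{Q\}\mid\varphi\otimes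 P\mid E=E\mid M=M\mid\varphi\wedge\varphi\mid\varphi\vee\varphi\mid\varphi\Rightarrow\varphi\mid\forall x{:}\tau.\varphi\mid\exists x{:}\tau.\varphi\mid\forall i.\varphi\mid\exists i.\varphi .$$ **Semantics of programs.** Let $\mathit{Loc}$ be a countably infinite set and $\mathsf{perm}$ the group of its finitely supported bijections. An FM-cpo is a poset with a monotone $\mathsf{perm}$-action in which every element has a finite support and every chain whose elements have a common finite support has a least upper bound; the exponential $A\to B$ consists of the finitely supported functions that preserve least upper bounds of finitely supported chains, with pointwise order and conjugation action. Put $\mathit{Val}=\mathit{Loc}+\mathbb Z+\{\mathit{default}\}$, $O=\{\mathit{normal},\mathit{err}\}_\bot$, $\mathit{Heap}=\mathit{Loc}\rightharpoonup_{\mathrm{fin}}\mathit{Val}\times\mathit{Val}$, $\mathit{Cont}=\mathit{Heap}\to O$, and $[\![\mathsf{com}]\!]=\mathit{Heap}\times\mathit{Cont}\to O$, $[\![\mathsf{val}\to\tau]\!]=\mathit{Val}\to[\![\tau]\!]$, $[\![\tau\to\tau']\!]=[\![\tau]\!]\to[\![\tau']\!]$. A term denotes an equivariant continuous map $[\![\Delta]\!]\times[\![\Gamma]\!]\to[\![\tau]\!]$: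 $\lambda$ and application are the usual ones, $\mathsf{fix}$ is the least fixed point, $[\![M;N]\!](h,k)=[\![M]\!](h,\lambda h'.[\![N]\!](h',k))$, $[\![\mathsf{let}\,i{=}\mathsf{new}\,\mathsf{in}\,M]\!]_{\rho,\eta}(h,k)=[\![M]\!]_{\rho[i\mapsto l],\eta}(h\bullet[l\mapsto 0,0],k)$ for any $l\notin\mathsf{supp}(h,\rho,\eta,k)$, and $\mathsf{free}(E)$, lookup and update act on the cell $[\![E]\!]_\rho$ of $h$, with result $\mathit{err}$ if there is no such cell. Arithmetic on non-integers gives $\mathit{default}$. Assertions denote sets of heaps in the standard way ($E\le F$ holds only between integers). **Semantics of specifications.** Let $\mathcal R$ be the set of finitely supported binary relations on $\mathit{Heap}$; $h_0[r*s]h_1$ iff there are splittings $h_j=n_j\bullet m_j$ into disjoint heaps with $n_0[r]n_1$ and $m_0[s]m_1$; $\mathsf{eq}(D)$ is the identity relation restricted to $D$; $G=\{\mathit{normal},\bot\}$. For $c_0,c_1\in[\![\mathsf{com}]\!]$ and $r,s\in\mathcal R$, the quadruple $\{r\}\,c_0,c_1\,\{s\}$ holds iff for all $r'\in\mathcal R$,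 heaps $h_0,h_1$ and continuations $k_0,k_1$: if $h_0[r*r']h_1$ and $k_0,k_1$ map $s*r'$-related heaps to $\mathsf{eq}(G)$-related observations, then $c_0(h_0,k_0)\,[\mathsf{eq}(G)]\,c_1(h_1,k_1)$. For $\rho\in[\![\Delta]\!]$, $\eta_0,\eta_1\in[\![\Gamma]\!]$, $r\in\mathcal R$, satisfaction $(\rho,\eta_0,\eta_1,r)\models\varphi$ is defined by: - $\{P\}M\{Q\}$: the quadruple $\{\mathsf{eq}([\![P]\!]_\rho)*r\}\;[\![M]\!]_{\rho,\eta_0},[\![M]\!]_{\rho,\eta_1}\;\{\mathsf{eq}([\![Q]\!]_\rho)*r\}$ holds; - $\varphi\otimes P$: $(\rho,\eta_0,\eta_1,r*\mathsf{eq}([\![P]\!]_\rho))\models\varphi$; - $E=F$: $[\![E]\!]_\rho=[\![F]\!]_\rho$; $\;M=N$: $[\![M]\!]_{\rho,\eta_j}=[\![N]\!]_{\rho,\eta_j}$ for $j=0,1$; - $\varphi\Rightarrow\psi$: for all $s\in\mathcal R$, $(\rho,\eta_0,\eta_1,r*s)\models\varphi$ implies $(\rho,\eta_0,\eta_1,r*s)\models\psi$;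 $\wedge,\vee$ pointwise; - $\forall i,\exists i$ range over one value $v\in\mathit{Val}$; $\forall x{:}\tau,\exists x{:}\tau$ range over two values $m,n\in[\![\tau]\!]$, used in $\eta_0$ and $\eta_1$ respectively. A judgment $\Delta\mid\Gamma;\Phi\vdash\varphi$ (with $\Phi$ a finite list of specifications) is *valid* iff every $(\rho,\eta_0,\eta_1,r)$ that satisfies all of $\Phi$ satisfies $\varphi$; for empty $\Phi$ this is validity of $\varphi$. **Theorem.** Each of the following proof rules is sound: whenever all its premises are valid, its conclusion is valid (axioms are valid, under any list of assumptions). 1. *Intuitionistic first-order logic with equality*, in natural deduction: assumption; introduction and elimination rules for $\wedge$, $\vee$, $\Rightarrow$, and for $\forall,\exists$ over stack variables (instantiated by expressions) and over identifiers (instantiated by terms of the same type); ex falso, with $0=1$ in the role of falsity; reflexivity of $=$ and replacement of equals by equals in specifications, both for expressions and for terms. 2. *Hoare triples*: - $(\forall i.\{P\}M\{Q\})\Rightarrow\{\exists i.P\}M\{\exists i.Q\}$ if $i\notin\mathsf{fv}(M)$; - $\{P\}M\{Q\}\wedge\{P'\}M\{Q'\}\Rightarrow\{P\vee P'\}M\{Q\vee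 Q'\}$; - $\{P\wedge E{=}F\}M\{Q\}\wedge\{P\wedge E{\ne}F\}N\{Q\}\Rightarrow\{P\}\,\mathsf{if}\,(E{=}F)\,\mathsf{then}\,M\,\mathsf{else}\,N\,\{Q\}$; - $\{P\}M\{P_0\}\wedge\{P_0\}N\{Q\}\Rightarrow\{P\}M;N\{Q\}$; - $(\forall i.\{P*i\mapsto 0,0\}M\{Q\})\Rightarrow\{P\}\,\mathsf{let}\,i{=}\mathsf{new}\,\mathsf{in}\,M\,\{Q\}$ if $i\notin\mathsf{fv}(P,Q)$; - $(\forall i.\{P*E\mapsto i,E_1\}M\{Q\})\Rightarrow\{\exists i.P*E\mapsto i,E_1\}\,\mathsf{let}\,i{=}E.0\,\mathsf{in}\,M\,\{Q\}$ if $i\notin\mathsf{fv}(E,Q)$, and symmetrically for field $1$; - $\{E\mapsto\text{-}\}\,\mathsf{free}(E)\,\{\mathsf{emp}\}$; - $\{E\mapsto\text{-},E_1\}\,E.0:=F\,\{E\mapsto F,E_1\}$, and symmetrically for field $1$; - $\{P'\}M\{Q'\}\Rightarrow\{P\}M\{Q\}$ if $[\![P]\!]_\rho\subseteq[\![P']\!]_\rho$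 and $[\![Q']\!]_\rho\subseteq[\![Q]\!]_\rho$ for all $\rho\in[\![\Delta]\!]$. 3. *Invariant extension*: $\varphi\Rightarrow\varphi\otimes P$; $\{P\}M\{P'\}\otimes Q\Leftrightarrow\{P*Q\}M\{P'*Q\}$; $(E=F)\otimes Q\Leftrightarrow E=F$; $(M=N)\otimes Q\Leftrightarrow M=N$; $(\varphi\otimes P)\otimes Q\Leftrightarrow\varphi\otimes(P*Q)$; $(\varphi\oplus\psi)\otimes P\Leftrightarrow(\varphi\otimes P)\oplus(\psi\otimes P)$ for $\oplus\in\{\Rightarrow,\wedge,\vee\}$; $(\kappa x{:}\tau.\varphi)\otimes P\Leftrightarrow\kappa x{:}\tau.(\varphi\otimes P)$, and $(\kappa i.\varphi)\otimes P\Leftrightarrow\kappa i.(\varphi\otimes P)$ if $i\notin\mathsf{fv}(P)$, for $\kappa\in\{\forall,\exists\}$. 4. *Fixed-point induction*: $(\forall x{:}\sigma.\,\gamma(x)\Rightarrow\gamma(M\,x))\Rightarrow\gamma(\mathsf{fix}\,M)$ for $M:\sigma\to\sigma$ and $x$ not free in $\gamma$, $M$, where $\gamma ::= \{P\}C\{Q\}\mid\gamma\wedge\gamma\mid\forall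 x{:}\tau.\gamma\mid\forall i.\gamma$ with $C ::= [\,]\mid\lambda i.C\mid C\,E\mid\lambda x{:}\tau.C\mid C\,M\mid\mathsf{fix}\,C\mid C;M$, and $\gamma(N)$ is the capture-avoiding insertion of $N$ into the holes. -/

import Mathlib

noncomputable section

namespace RelSep

/-! ### FM domain theory -/

/-- Locations. -/
abbrev Loc : Type := ℕ

/-- The group of bijections of `Loc` that move only finitely many locations. -/
def perm : Subgroup (Equiv.Perm Loc) where
  carrier := {π | {l | π l ≠ l}.Finite}
  one_mem' := by simp
  mul_mem' := by
    intro a b ha hb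
    refine (Set.Finite.union ha hb).subset ?_
    intro l hl
    by_contra hc
    simp only [Set.mem_union, Set.mem_ofPred_eq, not_or, not_not] at hc
    exact hl (by simp [hc.1, hc.2])
  inv_mem' := by
    intro a ha
    refine Set.Finite.subset ha ?_
    intro l hl hc
    exact hl (by rw [Equiv.Perm.inv_eq_iff_eq]; exact hc.symm)

abbrev Perm : Type := ↥perm

/-- An `ω`-chain is finitely supported if one finite set supports all its elements. -/
def FSChain {A : Type} [Preorder A] [MulAction Perm A] (c : ℕ →o A) : Prop :=
  ∃ L : Finset Loc, ∀ n, MulAction.Supports Perm (L : Set Loc) (c n)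

/-- FM-cpos: partially ordered sets with a monotone action of `Perm` such that every element has a
finite support and every finitely supported chain has a least upper bound. -/
class FMCpo (A : Type) extends PartialOrder A, MulAction Perm A where
  exists_support : ∀ a : A, ∃ L : Finset Loc, MulAction.Supports Perm (L : Set Loc) a
  smul_le : ∀ (π : Perm) (a b : A), a ≤ b → π • a ≤ π • b
  exists_lub : ∀ c : ℕ →o A, FSChain c → ∃ a, IsLUB (Set.range c) a

/-- Pointed FM-cpos. -/
class PFMCpo (A : Type) extends FMCpo A, OrderBot A

/-- The smallest set of locations that supports `a`: the intersection of its finite supports. -/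
def supp {A : Type} [FMCpo A] (a : A) : Set Loc :=
  {l | ∀ L : Finset Loc, MulAction.Supports Perm (L : Set Loc) a → l ∈ L}

/-- Preservation of the least upper bounds of finitely supported chains. -/
def FMContinuous {A B : Type} [FMCpo A] [FMCpo B] (f : A → B) : Prop :=
  ∀ c : ℕ →o A, FSChain c → ∀ a, IsLUB (Set.range c) a →
    IsLUB (Set.range fun n => f (c n)) (f a)

/-- A function is finitely supported (for the conjugation action). -/
def FinSuppFun {A B : Type} [FMCpo A] [FMCpo B] (f : A → B) : Prop :=
  ∃ L : Finset Loc, ∀ π : Perm, (∀ l ∈ L, π • l = l) → ∀ a, f (π • a) = π • f a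

section Basic

variable {A B C : Type} [FMCpo A] [FMCpo B] [FMCpo C]

theorem exists_not_mem_supp (a : A) : ∃ l : Loc, l ∉ supp a := by
  obtain ⟨L, hL⟩ := FMCpo.exists_support a
  obtain ⟨l, hl⟩ := Infinite.exists_notMem_finset L
  exact ⟨l, fun h => hl (h L hL)⟩

theorem supports_smul {L : Finset Loc} {a : A} (h : MulAction.Supports Perm (L : Set Loc) a)
    (π : Perm) : MulAction.Supports Perm ((L.image fun l => π • l : Finset Loc) : Set Loc) (π • a) := by
  intro g hg
  have : (π⁻¹ * g * π) • a = a := h _ (by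
    intro l hl
    have := hg (a := π • l) (by simpa using hl)
    rw [mul_smul, mul_smul, this, inv_smul_smul])
  rw [mul_smul, mul_smul, inv_smul_eq_iff] at this
  exact this

theorem smul_le_iff (π : Perm) {a b : A} : π • a ≤ π • b ↔ a ≤ b :=
  ⟨fun h => by simpa using FMCpo.smul_le π⁻¹ _ _ h, FMCpo.smul_le π a b⟩

theorem isLUB_smul (π : Perm) {ι : Type} {c : ι → A} {a : A} (h : IsLUB (Set.range c) a) :
    IsLUB (Set.range fun n => π • c n) (π • a) := by
  constructor
  · rintro _ ⟨n, rfl⟩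
    exact FMCpo.smul_le _ _ _ (h.1 ⟨n, rfl⟩)
  · intro b hb
    rw [← smul_inv_smul π b, smul_le_iff]
    refine h.2 ?_
    rintro _ ⟨n, rfl⟩
    rw [← smul_le_iff π, smul_inv_smul]
    exact hb ⟨n, rfl⟩

theorem FMContinuous.monotone {f : A → B} (hf : FMContinuous f) : Monotone f := by
  intro a b hab
  let c : ℕ →o A := ⟨fun n => if n = 0 then a else b, by
    intro m n hmn
    by_cases hm : m = 0
    · by_cases hn : n = 0 <;> simp [hm, hn, hab]
    · have hn : n ≠ 0 := by omega
      simp [hm, hn]⟩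
  have hc : FSChain c := by
    obtain ⟨L, hL⟩ := FMCpo.exists_support a
    obtain ⟨L', hL'⟩ := FMCpo.exists_support b
    refine ⟨L ∪ L', fun n => ?_⟩
    show MulAction.Supports Perm _ (if n = 0 then a else b)
    split_ifs
    · exact hL.mono (by simp)
    · exact hL'.mono (by simp)
  have hl : IsLUB (Set.range c) b := by
    constructor
    · rintro _ ⟨n, rfl⟩
      show (if n = 0 then a else b) ≤ b
      split_ifs
      · exact hab
      · exact le_rfl
    · intro x hx
      exact hx ⟨1, rfl⟩
  exact (hf c hc b hl).1 ⟨0, rfl⟩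

theorem FSChain.map {f : A → B} (hf : FinSuppFun f) (hm : Monotone f) {c : ℕ →o A}
    (hc : FSChain c) : FSChain (⟨fun n => f (c n), hm.comp c.monotone⟩ : ℕ →o B) := by
  obtain ⟨L, hL⟩ := hf
  obtain ⟨L', hL'⟩ := hc
  refine ⟨L ∪ L', fun n π hπ => ?_⟩
  show π • f (c n) = f (c n)
  rw [← hL π (fun l hl => hπ (by simp [hl])), hL' n π (fun l hl => hπ (by simp at hl; simp [hl]))]

theorem FMContinuous.comp {g : B → C} {f : A → B} (hg : FMContinuous g) (hf : FMContinuous f)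
    (hs : FinSuppFun f) : FMContinuous (fun a => g (f a)) := fun c hc a ha =>
  hg ⟨fun n => f (c n), hf.monotone.comp c.monotone⟩ (hc.map hs hf.monotone) (f a) (hf c hc a ha)

/-- Continuity can be checked on the principal lower sets. -/
theorem FMContinuous.of_local {f : A → B}
    (h : ∀ a₀ : A, ∃ g : A → B, FMContinuous g ∧ ∀ a, a ≤ a₀ → f a = g a) : FMContinuous f := by
  intro c hc a ha
  obtain ⟨g, hg, he⟩ := h a
  have h1 : (fun n => f (c n)) = fun n => g (c n) := funext fun n => he _ (ha.1 ⟨n, rfl⟩)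
  rw [h1, he a le_rfl]
  exact hg c hc a ha

theorem FMContinuous.const (b : B) : FMContinuous (fun _ : A => b) := by
  intro c _ a _
  simp [Set.range_const]

end Basic

/-! ### Products -/

instance : PFMCpo Unit where
  smul _ _ := ()
  one_smul _ := rfl
  mul_smul _ _ _ := rfl
  exists_support _ := ⟨∅, fun _ _ => rfl⟩
  smul_le _ _ _ _ := le_rfl
  exists_lub _ _ := ⟨(), ⟨fun _ _ => trivial, fun _ _ => trivial⟩⟩

section Prod

variable {A B : Type} [FMCpo A] [FMCpo B]

theorem isLUB_range_prod {ι : Type} {c : ι → A × B} {p : A × B} :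
    IsLUB (Set.range c) p ↔
      IsLUB (Set.range fun n => (c n).1) p.1 ∧ IsLUB (Set.range fun n => (c n).2) p.2 := by
  rw [isLUB_prod, ← Set.range_comp, ← Set.range_comp]
  rfl

/-- The product FM-cpo: componentwise order and action. -/
instance : FMCpo (A × B) where
  exists_support p := by
    obtain ⟨L, hL⟩ := FMCpo.exists_support p.1
    obtain ⟨L', hL'⟩ := FMCpo.exists_support p.2
    exact ⟨L ∪ L', fun π hπ => Prod.ext (hL π fun l hl => hπ (by simp at hl; simp [hl]))
      (hL' π fun l hl => hπ (by simp at hl; simp [hl]))⟩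
  smul_le π a b h := ⟨FMCpo.smul_le π _ _ h.1, FMCpo.smul_le π _ _ h.2⟩
  exists_lub c := by
    rintro ⟨L, hL⟩
    obtain ⟨a, ha⟩ := FMCpo.exists_lub (⟨fun n => (c n).1, fun _ _ h => (c.monotone h).1⟩ : ℕ →o A)
      ⟨L, fun n π hπ => congrArg Prod.fst (hL n π hπ)⟩
    obtain ⟨b, hb⟩ := FMCpo.exists_lub (⟨fun n => (c n).2, fun _ _ h => (c.monotone h).2⟩ : ℕ →o B)
      ⟨L, fun n π hπ => congrArg Prod.snd (hL n π hπ)⟩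
    exact ⟨(a, b), isLUB_range_prod.2 ⟨ha, hb⟩⟩

end Prod

/-- Finite powers: componentwise order and action. -/
instance {A : Type} [FMCpo A] (n : ℕ) : FMCpo (Fin n → A) where
  exists_support p := by
    choose L hL using fun i => FMCpo.exists_support (p i)
    refine ⟨Finset.univ.biUnion L, fun π hπ => funext fun i => hL i π fun l hl => hπ ?_⟩
    simp only [Finset.coe_biUnion, Set.mem_iUnion]
    exact ⟨i, by simp, hl⟩
  smul_le π a b h i := FMCpo.smul_le π _ _ (h i)
  exists_lub c := by
    rintro ⟨L, hL⟩
    choose a ha using fun i => FMCpo.exists_lub (⟨fun n => c n i, fun _ _ h => c.monotone h i⟩ : ℕ →o A)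
      ⟨L, fun n π hπ => congrFun (hL n π hπ) i⟩
    refine ⟨a, isLUB_pi.2 fun i => ?_⟩
    rw [← Set.range_comp]
    exact ha i

/-! ### Exponentials -/

/-- The exponential of FM-cpos: finitely supported continuous functions. -/
@[ext]
structure FMFun (A B : Type) [FMCpo A] [FMCpo B] where
  toFun : A → B
  cont : FMContinuous toFun
  finSupp : FinSuppFun toFun

namespace FMFun

variable {A B : Type} [FMCpo A] [FMCpo B]

instance : CoeFun (FMFun A B) fun _ => A → B := ⟨toFun⟩

instance : PartialOrder (FMFun A B) where
  le f g := ∀ a, f a ≤ g a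
  le_refl _ _ := le_rfl
  le_trans _ _ _ h h' a := (h a).trans (h' a)
  le_antisymm _ _ h h' := FMFun.ext (funext fun a => (h a).antisymm (h' a))

theorem finSuppFun_conj {f : A → B} (hf : FinSuppFun f) (π : Perm) :
    FinSuppFun fun a => π • f (π⁻¹ • a) := by
  obtain ⟨L, hL⟩ := hf
  refine ⟨L.image fun l => π • l, fun g hg a => ?_⟩
  have := hL (π⁻¹ * g * π) (by
    intro l hl
    rw [mul_smul, mul_smul, hg (π • l) (Finset.mem_image_of_mem _ hl), inv_smul_smul]) (π⁻¹ • a)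
  rw [mul_smul, mul_smul, smul_inv_smul] at this
  show π • f (π⁻¹ • g • a) = g • π • f (π⁻¹ • a)
  rw [this, mul_smul, mul_smul, smul_inv_smul]

theorem finSuppFun_smul (π : Perm) : FinSuppFun fun a : A => π • a := by
  have hfin : {l | (π : Equiv.Perm Loc) l ≠ l}.Finite := π.2
  refine ⟨hfin.toFinset, fun g hg a => ?_⟩
  have hc : π * g = g * π := by
    ext l
    show (π : Equiv.Perm Loc) ((g : Equiv.Perm Loc) l) = (g : Equiv.Perm Loc) ((π : Equiv.Perm Loc) l)
    have hg' : ∀ l, (π : Equiv.Perm Loc) l ≠ l → (g : Equiv.Perm Loc) l = l := fun l hl =>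
      hg l (hfin.mem_toFinset.2 hl)
    by_cases h : (π : Equiv.Perm Loc) l = l
    · rw [h]
      by_contra h2
      have h3 := hg' _ h2
      exact h2 (by rw [(g : Equiv.Perm Loc).injective h3, h])
    · rw [hg' l h, hg' ((π : Equiv.Perm Loc) l) (fun h2 => h ((π : Equiv.Perm Loc).injective h2))]
  show π • g • a = g • π • a
  rw [← mul_smul, ← mul_smul, hc]

theorem cont_smul (π : Perm) : FMContinuous fun a : A => π • a := fun _ _ _ h => isLUB_smul π h

/-- The conjugation action. -/
instance : SMul Perm (FMFun A B) where
  smul π f :=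
    { toFun := fun a => π • f (π⁻¹ • a)
      cont := by
        intro c hc a ha
        exact isLUB_smul π
          ((f.cont.comp (cont_smul π⁻¹) (finSuppFun_smul π⁻¹)) c hc a ha)
      finSupp := finSuppFun_conj f.finSupp π }

theorem smul_apply (π : Perm) (f : FMFun A B) (a : A) : (π • f) a = π • f (π⁻¹ • a) := rfl

instance : MulAction Perm (FMFun A B) where
  one_smul f := FMFun.ext (funext fun a => by simp [smul_apply])
  mul_smul π π' f := FMFun.ext (funext fun a => by simp [smul_apply, mul_smul])

theorem smul_eq_iff {π : Perm} {f : FMFun A B} : π • f = f ↔ ∀ a, f (π • a) = π • f a := by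
  constructor
  · intro h a
    conv_lhs => rw [← h]
    rw [smul_apply, inv_smul_smul]
  · intro h
    refine FMFun.ext (funext fun a => ?_)
    show π • f (π⁻¹ • a) = f a
    rw [← h, smul_inv_smul]

/-- Pointwise least upper bounds of finitely supported chains of functions. -/
theorem exists_pointwise_lub (c : ℕ →o FMFun A B) (hc : FSChain c) :
    ∃ f : FMFun A B, ∀ a, IsLUB (Set.range fun n => c n a) (f a) := by
  obtain ⟨L, hL⟩ := hc
  have key : ∀ a, ∃ b, IsLUB (Set.range fun n => c n a) b := by
    intro a
    obtain ⟨L', hL'⟩ := FMCpo.exists_support a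
    refine FMCpo.exists_lub (⟨fun n => c n a, fun _ _ h => c.monotone h a⟩ : ℕ →o B)
      ⟨L ∪ L', fun n π hπ => ?_⟩
    have h1 := smul_eq_iff.1 (hL n π fun l hl => hπ (by simp at hl; simp [hl])) a
    rw [hL' π fun l hl => hπ (by simp at hl; simp [hl])] at h1
    exact h1.symm
  choose f hf using key
  refine ⟨⟨f, ?_, ?_⟩, hf⟩
  · intro d hd a ha
    constructor
    · rintro _ ⟨m, rfl⟩
      refine (hf (d m)).2 ?_
      rintro _ ⟨n, rfl⟩
      exact ((c n).cont.monotone (ha.1 ⟨m, rfl⟩)).trans ((hf a).1 ⟨n, rfl⟩)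
    · intro b hb
      refine (hf a).2 ?_
      rintro _ ⟨n, rfl⟩
      refine ((c n).cont d hd a ha).2 ?_
      rintro _ ⟨m, rfl⟩
      exact ((hf (d m)).1 ⟨n, rfl⟩).trans (hb ⟨m, rfl⟩)
  · refine ⟨L, fun π hπ a => ?_⟩
    refine (hf (π • a)).unique ?_
    have := isLUB_smul π (hf a)
    have h2 : (fun n => π • c n a) = fun n => c n (π • a) := funext fun n =>
      (smul_eq_iff.1 (hL n π fun l hl => hπ l hl) a).symm
    rwa [h2] at this

theorem isLUB_of_pointwise {c : ℕ → FMFun A B} {f : FMFun A B}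
    (h : ∀ a, IsLUB (Set.range fun n => c n a) (f a)) : IsLUB (Set.range c) f := by
  constructor
  · rintro _ ⟨n, rfl⟩ a
    exact (h a).1 ⟨n, rfl⟩
  · intro g hg a
    refine (h a).2 ?_
    rintro _ ⟨n, rfl⟩
    exact hg ⟨n, rfl⟩ a

theorem pointwise_of_isLUB {c : ℕ →o FMFun A B} (hc : FSChain c) {f : FMFun A B}
    (h : IsLUB (Set.range c) f) (a : A) : IsLUB (Set.range fun n => c n a) (f a) := by
  obtain ⟨g, hg⟩ := exists_pointwise_lub c hc
  rw [h.unique (isLUB_of_pointwise hg)]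
  exact hg a

instance : FMCpo (FMFun A B) where
  exists_support f := by
    obtain ⟨L, hL⟩ := f.finSupp
    exact ⟨L, fun π hπ => smul_eq_iff.2 (hL π fun l hl => hπ hl)⟩
  smul_le π f g h a := FMCpo.smul_le π _ _ (h (π⁻¹ • a))
  exists_lub c hc := by
    obtain ⟨g, hg⟩ := exists_pointwise_lub c hc
    exact ⟨g, isLUB_of_pointwise hg⟩

theorem smul_bot {B : Type} [PFMCpo B] (π : Perm) : π • (⊥ : B) = ⊥ := by
  refine le_antisymm ?_ bot_le
  have := FMCpo.smul_le π _ _ (bot_le : (⊥ : B) ≤ π⁻¹ • ⊥)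
  rwa [smul_inv_smul] at this

instance {B : Type} [PFMCpo B] : PFMCpo (FMFun A B) where
  bot := ⟨fun _ => ⊥, FMContinuous.const _, ⟨∅, fun π _ _ => (smul_bot π).symm⟩⟩
  bot_le _ _ := bot_le

end FMFun

/-! ### Morphisms -/

/-- The morphisms of the category of FM-cpos: equivariant continuous functions. -/
structure FMHom (A B : Type) [FMCpo A] [FMCpo B] where
  toFun : A → B
  cont : FMContinuous toFun
  equivariant : ∀ (π : Perm) (a : A), toFun (π • a) = π • toFun a

namespace FMHom

variable {A B C X : Type} [FMCpo A] [FMCpo B] [FMCpo C] [FMCpo X]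

instance : CoeFun (FMHom A B) fun _ => A → B := ⟨toFun⟩

theorem finSupp (f : FMHom A B) : FinSuppFun f := ⟨∅, fun π _ a => f.equivariant π a⟩

def comp (g : FMHom B C) (f : FMHom A B) : FMHom A C where
  toFun a := g (f a)
  cont := g.cont.comp f.cont f.finSupp
  equivariant π a := by rw [f.equivariant, g.equivariant]

def fst : FMHom (A × B) A where
  toFun p := p.1
  cont _ _ _ h := (isLUB_range_prod.1 h).1
  equivariant _ _ := rfl

def snd : FMHom (A × B) B where
  toFun p := p.2
  cont _ _ _ h := (isLUB_range_prod.1 h).2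
  equivariant _ _ := rfl

def pair (f : FMHom X A) (g : FMHom X B) : FMHom X (A × B) where
  toFun x := (f x, g x)
  cont c hc a ha := isLUB_range_prod.2 ⟨f.cont c hc a ha, g.cont c hc a ha⟩
  equivariant π x := Prod.ext (f.equivariant π x) (g.equivariant π x)

def eval : FMHom (FMFun A B × A) B where
  toFun p := p.1 p.2
  cont := by
    rintro c ⟨L, hL⟩ ⟨f, a⟩ h
    have hf := (isLUB_range_prod.1 h).1
    have ha := (isLUB_range_prod.1 h).2
    let c₁ : ℕ →o FMFun A B := ⟨fun n => (c n).1, fun _ _ h => (c.monotone h).1⟩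
    let c₂ : ℕ →o A := ⟨fun n => (c n).2, fun _ _ h => (c.monotone h).2⟩
    have h₁ : FSChain c₁ := ⟨L, fun n π hπ => congrArg Prod.fst (hL n π hπ)⟩
    have h₂ : FSChain c₂ := ⟨L, fun n π hπ => congrArg Prod.snd (hL n π hπ)⟩
    constructor
    · rintro _ ⟨n, rfl⟩
      exact ((c n).1.cont.monotone (ha.1 ⟨n, rfl⟩)).trans (hf.1 ⟨n, rfl⟩ a)
    · intro b hb
      refine (FMFun.pointwise_of_isLUB h₁ hf a).2 ?_
      rintro _ ⟨n, rfl⟩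
      refine ((c₁ n).cont c₂ h₂ a ha).2 ?_
      rintro _ ⟨m, rfl⟩
      refine le_trans ?_ (hb ⟨max n m, rfl⟩)
      exact (c₁.monotone (le_max_left n m) _).trans
        ((c₁ (max n m)).cont.monotone (c₂.monotone (le_max_right n m)))
  equivariant π p := by
    show π • p.1 (π⁻¹ • π • p.2) = π • p.1 p.2
    rw [inv_smul_smul]

theorem cont_mk_left (a : A) : FMContinuous fun b : B => (a, b) := fun _ _ _ h =>
  isLUB_range_prod.2 ⟨by simp [Set.range_const], h⟩

theorem cont_mk_right (b : B) : FMContinuous fun a : A => (a, b) := fun _ _ _ h =>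
  isLUB_range_prod.2 ⟨h, by simp [Set.range_const]⟩

theorem finSupp_mk_left (a : A) : FinSuppFun fun b : B => (a, b) := by
  obtain ⟨L, hL⟩ := FMCpo.exists_support a
  exact ⟨L, fun π hπ b => Prod.ext (hL π fun l hl => hπ l hl).symm rfl⟩

theorem finSupp_mk_right (b : B) : FinSuppFun fun a : A => (a, b) := by
  obtain ⟨L, hL⟩ := FMCpo.exists_support b
  exact ⟨L, fun π hπ a => Prod.ext rfl (hL π fun l hl => hπ l hl).symm⟩

def curry (f : FMHom (X × A) B) : FMHom X (FMFun A B) where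
  toFun x :=
    { toFun := fun a => f (x, a)
      cont := f.cont.comp (cont_mk_left x) (finSupp_mk_left x)
      finSupp := by
        obtain ⟨L, hL⟩ := finSupp_mk_left (B := A) x
        exact ⟨L, fun π hπ a => (congrArg f.toFun (hL π hπ a)).trans (f.equivariant π (x, a))⟩ }
  cont c hc x hx := FMFun.isLUB_of_pointwise fun a =>
    f.cont.comp (cont_mk_right a) (finSupp_mk_right a) c hc x hx
  equivariant π x := FMFun.ext (funext fun a => by
    show f (π • x, a) = π • f (x, π⁻¹ • a)
    rw [← f.equivariant, Prod.smul_mk, smul_inv_smul])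

end FMHom

/-! ### Least fixed points -/

section Fix

variable {A : Type} [PFMCpo A]

/-- The chain `⊥ ≤ f ⊥ ≤ f (f ⊥) ≤ …`. -/
def fixChain (f : FMFun A A) : ℕ →o A where
  toFun n := f.toFun^[n] ⊥
  monotone' := f.cont.monotone.monotone_iterate_of_le_map bot_le

theorem fixChain_fs (f : FMFun A A) : FSChain (fixChain f) := by
  obtain ⟨L, hL⟩ := f.finSupp
  refine ⟨L, fun n π hπ => ?_⟩
  show π • (f.toFun^[n] ⊥) = f.toFun^[n] ⊥
  induction n with
  | zero => exact FMFun.smul_bot π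
  | succ n ih =>
    rw [Function.iterate_succ_apply', ← hL π fun l hl => hπ hl, ih]

/-- The least fixed point: the least upper bound of `fixChain f`. -/
def leastFix (f : FMFun A A) : A :=
  Classical.choose (FMCpo.exists_lub (fixChain f) (fixChain_fs f))

theorem leastFix_isLUB (f : FMFun A A) : IsLUB (Set.range (fixChain f)) (leastFix f) :=
  Classical.choose_spec (FMCpo.exists_lub (fixChain f) (fixChain_fs f))

theorem leastFix_le {f : FMFun A A} {a : A} (h : f a ≤ a) : leastFix f ≤ a := by
  refine (leastFix_isLUB f).2 ?_
  rintro _ ⟨n, rfl⟩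
  show f.toFun^[n] ⊥ ≤ a
  induction n with
  | zero => exact bot_le
  | succ n ih =>
    rw [Function.iterate_succ_apply']
    exact (f.cont.monotone ih).trans h

theorem map_leastFix_le (f : FMFun A A) : f (leastFix f) ≤ leastFix f := by
  refine (f.cont _ (fixChain_fs f) _ (leastFix_isLUB f)).2 ?_
  rintro _ ⟨n, rfl⟩
  refine (leastFix_isLUB f).1 ⟨n + 1, ?_⟩
  exact Function.iterate_succ_apply' _ _ _

theorem leastFix_mono : Monotone (leastFix : FMFun A A → A) := fun _ g h =>
  leastFix_le ((h _).trans (map_leastFix_le g))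

theorem leastFix_equivariant (π : Perm) (f : FMFun A A) :
    leastFix (π • f) = π • leastFix f := by
  have key : ∀ (π : Perm) (f : FMFun A A), leastFix (π • f) ≤ π • leastFix f := by
    intro π f
    refine leastFix_le ?_
    rw [FMFun.smul_apply, inv_smul_smul]
    exact FMCpo.smul_le _ _ _ (map_leastFix_le f)
  refine le_antisymm (key π f) ?_
  have := FMCpo.smul_le π _ _ (key π⁻¹ (π • f))
  rwa [inv_smul_smul, smul_inv_smul] at this

def FMHom.fix : FMHom (FMFun A A) A where
  toFun := leastFix
  equivariant := leastFix_equivariant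
  cont := by
    intro c hc f hf
    have hm : Monotone fun n => leastFix (c n) := leastFix_mono.comp c.monotone
    have hs : FSChain (⟨fun n => leastFix (c n), hm⟩ : ℕ →o A) :=
      hc.map ⟨∅, fun π _ => leastFix_equivariant π⟩ leastFix_mono
    obtain ⟨a, ha⟩ := FMCpo.exists_lub _ hs
    have hle : leastFix f ≤ a := by
      refine leastFix_le ((FMFun.pointwise_of_isLUB hc hf a).2 ?_)
      rintro _ ⟨n, rfl⟩
      refine ((c n).cont _ hs a ha).2 ?_
      rintro _ ⟨m, rfl⟩
      refine le_trans ?_ (ha.1 ⟨max n m, rfl⟩)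
      refine le_trans ?_ (map_leastFix_le (c (max n m)))
      exact (c.monotone (le_max_left n m) _).trans
        ((c (max n m)).cont.monotone (hm (le_max_right n m)))
    constructor
    · rintro _ ⟨n, rfl⟩
      exact leastFix_mono (hf.1 ⟨n, rfl⟩)
    · intro b hb
      exact hle.trans (ha.2 hb)

end Fix

/-! ### Values, observations, heaps -/

inductive Val : Type
  | loc (l : Loc)
  | int (z : ℤ)
  | dflt
  deriving DecidableEq

namespace Val

/-- `Val` is ordered discretely. -/
instance : PartialOrder Val where
  le v w := v = w
  le_refl _ := rfl
  le_trans _ _ _ := Eq.trans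
  le_antisymm _ _ h _ := h

instance : MulAction Perm Val where
  smul π v := match v with
    | loc l => loc (π • l)
    | int z => int z
    | dflt => dflt
  one_smul v := by cases v <;> rfl
  mul_smul π π' v := by cases v <;> rfl

instance : FMCpo Val where
  exists_support v := by
    cases v with
    | loc l => exact ⟨{l}, fun π hπ => congrArg loc (hπ (by simp))⟩
    | int z => exact ⟨∅, fun _ _ => rfl⟩
    | dflt => exact ⟨∅, fun _ _ => rfl⟩
  smul_le π _ _ h := congrArg (π • ·) h
  exists_lub c _ := ⟨c 0, by
    rintro _ ⟨n, rfl⟩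
    exact (c.monotone (Nat.zero_le n) : c 0 = c n).symm, fun b hb => hb ⟨0, rfl⟩⟩

end Val

/-- The flat cpo `{normal, err}_⊥` of observations. -/
inductive Obs : Type
  | bot
  | normal
  | err

namespace Obs

instance : PartialOrder Obs where
  le a b := a = bot ∨ a = b
  le_refl _ := Or.inr rfl
  le_trans := by rintro a b c (rfl | rfl) h <;> simp_all
  le_antisymm := by rintro a b (rfl | rfl) (h | h) <;> simp_all

instance : MulAction Perm Obs where
  smul _ o := o
  one_smul _ := rfl
  mul_smul _ _ _ := rfl

instance : PFMCpo Obs where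
  exists_support _ := ⟨∅, fun _ _ => rfl⟩
  smul_le _ _ _ h := h
  exists_lub c _ := by
    by_cases h : ∃ n, c n ≠ bot
    · obtain ⟨n, hn⟩ := h
      refine ⟨c n, ?_, fun b hb => hb ⟨n, rfl⟩⟩
      rintro _ ⟨m, rfl⟩
      rcases le_total m n with hmn | hmn
      · exact c.monotone hmn
      · rcases c.monotone hmn with h | h
        · exact absurd h hn
        · exact Or.inr h.symm
    · refine ⟨bot, ?_, fun b _ => Or.inl rfl⟩
      rintro _ ⟨m, rfl⟩
      exact Or.inl (not_not.1 fun hm => h ⟨m, hm⟩)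
  bot := bot
  bot_le _ := Or.inl rfl

end Obs

/-- Heaps: finite partial functions from locations to pairs of values. -/
@[ext]
structure Heap : Type where
  cell : Loc → Option (Val × Val)
  finite : {l | cell l ≠ none}.Finite

namespace Heap

/-- `Heap` is ordered discretely, since `Val × Val` is. -/
instance : PartialOrder Heap where
  le h h' := h = h'
  le_refl _ := rfl
  le_trans _ _ _ := Eq.trans
  le_antisymm _ _ h _ := h

/-- `π • h` maps `π • l` to `π • h(l)`. -/
instance : SMul Perm Heap where
  smul π h :=
    { cell := fun l => (h.cell (π⁻¹ • l)).map (π • ·)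
      finite := by
        refine (h.finite.image fun l => π • l).subset ?_
        intro l hl
        refine ⟨π⁻¹ • l, fun hc => hl (by simp [hc]), smul_inv_smul π l⟩ }

theorem smul_cell (π : Perm) (h : Heap) (l : Loc) :
    (π • h).cell l = (h.cell (π⁻¹ • l)).map (π • ·) := rfl

instance : MulAction Perm Heap where
  one_smul h := by
    ext1; funext l
    simp [smul_cell]
  mul_smul π π' h := by
    ext1; funext l
    simp only [smul_cell, mul_inv_rev, mul_smul, Option.map_map]
    rfl

instance : FMCpo Heap where
  exists_support h := by
    choose S hS using fun v : Val × Val => FMCpo.exists_support v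
    refine ⟨h.finite.toFinset ∪ h.finite.toFinset.biUnion
      fun l => S ((h.cell l).getD (Val.dflt, Val.dflt)), fun π hπ => ?_⟩
    have hd : ∀ l, h.cell l ≠ none → π • l = l := fun l hl => hπ (by
      simp only [Finset.coe_union, Set.mem_union, Finset.mem_coe]
      exact Or.inl (h.finite.mem_toFinset.2 hl))
    ext1; funext l
    rw [smul_cell]
    by_cases hl : h.cell l = none
    · have : h.cell (π⁻¹ • l) = none := by
        by_contra hc
        have h1 := hd _ hc
        rw [smul_inv_smul] at h1
        rw [← h1] at hc
        exact hc hl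
      rw [this, hl]; rfl
    · have h1 : π⁻¹ • l = l := by rw [inv_smul_eq_iff, hd l hl]
      rw [h1]
      obtain ⟨v, hv⟩ := Option.ne_none_iff_exists'.1 hl
      rw [hv]
      refine congrArg some (hS v π fun x hx => hπ ?_)
      simp only [Finset.coe_union, Set.mem_union, Finset.mem_coe, Finset.mem_biUnion]
      exact Or.inr ⟨l, h.finite.mem_toFinset.2 hl, by simpa [hv] using hx⟩
  smul_le π _ _ h := congrArg (π • ·) h
  exists_lub c _ := ⟨c 0, by
    rintro _ ⟨n, rfl⟩
    exact (c.monotone (Nat.zero_le n) : c 0 = c n).symm, fun b hb => hb ⟨0, rfl⟩⟩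

def empty : Heap := ⟨fun _ => none, by simp⟩

/-- The heap `h[l ↦ v]`. -/
def set (h : Heap) (l : Loc) (v : Val × Val) : Heap where
  cell := Function.update h.cell l (some v)
  finite := by
    refine (h.finite.insert l).subset ?_
    intro x hx
    by_cases hxl : x = l
    · exact Or.inl hxl
    · exact Or.inr (by simpa [Function.update_of_ne hxl] using hx)

/-- The one-cell heap `[l ↦ v]`. -/
def single (l : Loc) (v : Val × Val) : Heap := empty.set l v

/-- The heap `h` without the cell `l`. -/
def erase (h : Heap) (l : Loc) : Heap where
  cell := Function.update h.cell l none
  finite := by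
    refine h.finite.subset ?_
    intro x hx
    by_cases hxl : x = l
    · subst hxl; simp at hx
    · simpa [Function.update_of_ne hxl] using hx

/-- Disjointness of domains. -/
def Disj (h g : Heap) : Prop := ∀ l, h.cell l = none ∨ g.cell l = none

/-- The union of heaps; only used for disjoint ones. -/
def union (h g : Heap) : Heap where
  cell l := (h.cell l).or (g.cell l)
  finite := by
    refine (h.finite.union g.finite).subset ?_
    intro l hl
    by_contra hc
    simp only [Set.mem_union, Set.mem_ofPred_eq, not_or, not_not] at hc
    exact hl (by simp [hc.1, hc.2])

/-- `Split h n m` says that `n` and `m` are disjoint and their union is `h`. -/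
def Split (h n m : Heap) : Prop := Disj n m ∧ n.union m = h

theorem smul_set (π : Perm) (h : Heap) (l : Loc) (v : Val × Val) :
    π • h.set l v = (π • h).set (π • l) (π • v) := by
  ext1; funext x
  by_cases hx : x = π • l
  · subst hx
    rw [smul_cell]
    simp [set]
  · have hx' : π⁻¹ • x ≠ l := fun hc => hx (by rw [← hc, smul_inv_smul])
    rw [smul_cell]
    simp only [set, Function.update_of_ne hx, Function.update_of_ne hx', smul_cell]

theorem smul_erase (π : Perm) (h : Heap) (l : Loc) :
    π • h.erase l = (π • h).erase (π • l) := by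
  ext1; funext x
  by_cases hx : x = π • l
  · subst hx
    rw [smul_cell]
    simp [erase]
  · have hx' : π⁻¹ • x ≠ l := fun hc => hx (by rw [← hc, smul_inv_smul])
    rw [smul_cell]
    simp only [erase, Function.update_of_ne hx, Function.update_of_ne hx', smul_cell]

theorem smul_empty (π : Perm) : π • empty = empty := rfl

theorem smul_single (π : Perm) (l : Loc) (v : Val × Val) :
    π • single l v = single (π • l) (π • v) := smul_set π empty l v

theorem smul_union (π : Perm) (h g : Heap) : π • h.union g = (π • h).union (π • g) := by
  ext1; funext x
  simp only [smul_cell, union]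
  cases h.cell (π⁻¹ • x) <;> rfl

theorem Disj.smul (π : Perm) {h g : Heap} (hd : Disj h g) : Disj (π • h) (π • g) := by
  intro l
  rcases hd (π⁻¹ • l) with h1 | h1
  · exact Or.inl (by rw [smul_cell, h1]; rfl)
  · exact Or.inr (by rw [smul_cell, h1]; rfl)

theorem Split.smul (π : Perm) {h n m : Heap} (hs : Split h n m) :
    Split (π • h) (π • n) (π • m) :=
  ⟨hs.1.smul π, by rw [← smul_union, hs.2]⟩

theorem smul_cell_smul (π : Perm) (h : Heap) (l : Loc) :
    (π • h).cell (π • l) = (h.cell l).map (π • ·) := by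
  rw [smul_cell, inv_smul_smul]

end Heap

/-! ### Types and their interpretation -/

inductive Ty : Type
  | com
  | fnVal (τ : Ty)
  | fn (σ τ : Ty)

/-- Continuations. -/
abbrev Cont : Type := FMFun Heap Obs

/-- Continuation-passing commands. -/
abbrev Com : Type := FMFun (Heap × Cont) Obs

/-- Bundled pointed FM-cpos. -/
structure Dom where
  carrier : Type
  [inst : PFMCpo carrier]

attribute [instance] Dom.inst

def Ty.dom : Ty → Dom
  | com => ⟨Com⟩
  | fnVal τ => ⟨FMFun Val τ.dom.carrier⟩
  | fn σ τ => ⟨FMFun σ.dom.carrier τ.dom.carrier⟩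

/-- The interpretation of a type. -/
abbrev Ty.El (τ : Ty) : Type := τ.dom.carrier

/-- Environments for a context of stack variables. -/
abbrev StackEnv (n : ℕ) : Type := Fin n → Val

/-- The environment `ρ[i ↦ v]`, where `i` is the new variable `0`. -/
def StackEnv.ext {n : ℕ} (ρ : StackEnv n) (v : Val) : StackEnv (n + 1) :=
  Fin.cons (α := fun _ => Val) v ρ

/-- Environments for a context of identifiers. -/
def IdEnv : List Ty → Type
  | [] => Unit
  | τ :: Γ => τ.El × IdEnv Γ

instance IdEnv.instFMCpo : (Γ : List Ty) → FMCpo (IdEnv Γ)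
  | [] => inferInstanceAs (FMCpo Unit)
  | τ :: Γ =>
    letI := IdEnv.instFMCpo Γ
    inferInstanceAs (FMCpo (τ.El × IdEnv Γ))

/-- The environment `η[x ↦ m]`, where `x` is the new identifier. -/
def IdEnv.ext {τ : Ty} {Γ : List Ty} (η : IdEnv Γ) (m : τ.El) : IdEnv (τ :: Γ) := (m, η)

abbrev Env (n : ℕ) (Γ : List Ty) : Type := StackEnv n × IdEnv Γ

/-! ### Expressions -/

/-- Expressions over `n` stack variables. -/
inductive Exp (n : ℕ) : Type
  | var (i : Fin n)
  | zero
  | one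
  | negOne
  | add (E F : Exp n)
  | sub (E F : Exp n)

def Val.add : Val → Val → Val
  | .int a, .int b => .int (a + b)
  | _, _ => .dflt

def Val.sub : Val → Val → Val
  | .int a, .int b => .int (a - b)
  | _, _ => .dflt

namespace Exp

def eval {n : ℕ} (ρ : StackEnv n) : Exp n → Val
  | var i => ρ i
  | zero => .int 0
  | one => .int 1
  | negOne => .int (-1)
  | add E F => (E.eval ρ).add (F.eval ρ)
  | sub E F => (E.eval ρ).sub (F.eval ρ)

/-- Simultaneous substitution. -/
def subst {n m : ℕ} (s : Fin n → Exp m) : Exp n → Exp m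
  | var i => s i
  | zero => zero
  | one => one
  | negOne => negOne
  | add E F => add (E.subst s) (F.subst s)
  | sub E F => sub (E.subst s) (F.subst s)

/-- The same expression in a context with one more variable. -/
def wk {n : ℕ} (E : Exp n) : Exp (n + 1) := E.subst fun i => var i.succ

/-- Lift a substitution under a binder. -/
def lift {n m : ℕ} (s : Fin n → Exp m) : Fin (n + 1) → Exp (m + 1) :=
  Fin.cons (α := fun _ => Exp (m + 1)) (var 0) fun i => (s i).wk

/-- The substitution of `E` for the variable `0`. -/
def inst {n : ℕ} (E : Exp n) : Fin (n + 1) → Exp n :=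
  Fin.cons (α := fun _ => Exp n) E var

theorem eval_smul {n : ℕ} (π : Perm) (ρ : StackEnv n) (E : Exp n) :
    E.eval (π • ρ) = π • E.eval ρ := by
  induction E with
  | var i => rfl
  | zero => rfl
  | one => rfl
  | negOne => rfl
  | add E F hE hF =>
    show (E.eval _).add (F.eval _) = π • (E.eval ρ).add (F.eval ρ)
    rw [hE, hF]
    cases E.eval ρ <;> cases F.eval ρ <;> rfl
  | sub E F hE hF =>
    show (E.eval _).sub (F.eval _) = π • (E.eval ρ).sub (F.eval ρ)
    rw [hE, hF]
    cases E.eval ρ <;> cases F.eval ρ <;> rfl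

end Exp

theorem StackEnv.smul_ext {n : ℕ} (π : Perm) (ρ : StackEnv n) (v : Val) :
    π • ρ.ext v = (π • ρ).ext (π • v) := by
  funext i
  refine Fin.cases ?_ (fun i => ?_) i <;> rfl

/-! ### Terms -/

/-- Identifiers: positions in a context. -/
inductive Var : List Ty → Ty → Type
  | zero {Γ : List Ty} {τ : Ty} : Var (τ :: Γ) τ
  | succ {Γ : List Ty} {σ τ : Ty} (x : Var Γ τ) : Var (σ :: Γ) τ

/-- Well-typed terms `Δ | Γ ⊢ M : τ` (with de Bruijn indices for both kinds of variables), where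
`Δ` has `n` stack variables. -/
inductive Term : ℕ → List Ty → Ty → Type
  | var {n : ℕ} {Γ : List Ty} {τ : Ty} (x : Var Γ τ) : Term n Γ τ
  | lamVal {n : ℕ} {Γ : List Ty} {τ : Ty} (M : Term (n + 1) Γ τ) : Term n Γ (.fnVal τ)
  | appVal {n : ℕ} {Γ : List Ty} {τ : Ty} (M : Term n Γ (.fnVal τ)) (E : Exp n) : Term n Γ τ
  | lam {n : ℕ} {Γ : List Ty} {σ τ : Ty} (M : Term n (σ :: Γ) τ) : Term n Γ (.fn σ τ)
  | app {n : ℕ} {Γ : List Ty} {σ τ : Ty} (M : Term n Γ (.fn σ τ)) (N : Term n Γ σ) : Term n Γ τ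
  | fix {n : ℕ} {Γ : List Ty} {τ : Ty} (M : Term n Γ (.fn τ τ)) : Term n Γ τ
  | ite {n : ℕ} {Γ : List Ty} (E F : Exp n) (M N : Term n Γ .com) : Term n Γ .com
  | seq {n : ℕ} {Γ : List Ty} (M N : Term n Γ .com) : Term n Γ .com
  | letNew {n : ℕ} {Γ : List Ty} (M : Term (n + 1) Γ .com) : Term n Γ .com
  | free {n : ℕ} {Γ : List Ty} (E : Exp n) : Term n Γ .com
  | letGet {n : ℕ} {Γ : List Ty} (E : Exp n) (f : Fin 2) (M : Term (n + 1) Γ .com) : Term n Γ .com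
  | put {n : ℕ} {Γ : List Ty} (E : Exp n) (f : Fin 2) (F : Exp n) : Term n Γ .com

namespace Term

/-- Lift a renaming of identifiers under a binder. -/
def liftRen {Γ Γ' : List Ty} (g : ∀ τ, Var Γ τ → Var Γ' τ) (σ : Ty) :
    ∀ τ, Var (σ :: Γ) τ → Var (σ :: Γ') τ
  | _, .zero => .zero
  | _, .succ x => .succ (g _ x)

/-- Substitute expressions for stack variables and rename identifiers. -/
def ren : {n : ℕ} → {Γ : List Ty} → {τ : Ty} → Term n Γ τ → {m : ℕ} → {Γ' : List Ty} →
    (Fin n → Exp m) → (∀ τ, Var Γ τ → Var Γ' τ) → Term m Γ' τ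
  | _, _, _, var x, _, _, _, g => var (g _ x)
  | _, _, _, lamVal M, _, _, s, g => lamVal (M.ren (Exp.lift s) g)
  | _, _, _, appVal M E, _, _, s, g => appVal (M.ren s g) (E.subst s)
  | _, _, _, lam M, _, _, s, g => lam (M.ren s (liftRen g _))
  | _, _, _, app M N, _, _, s, g => app (M.ren s g) (N.ren s g)
  | _, _, _, fix M, _, _, s, g => fix (M.ren s g)
  | _, _, _, ite E F M N, _, _, s, g => ite (E.subst s) (F.subst s) (M.ren s g) (N.ren s g)
  | _, _, _, seq M N, _, _, s, g => seq (M.ren s g) (N.ren s g)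
  | _, _, _, letNew M, _, _, s, g => letNew (M.ren (Exp.lift s) g)
  | _, _, _, free E, _, _, s, _ => free (E.subst s)
  | _, _, _, letGet E f M, _, _, s, g => letGet (E.subst s) f (M.ren (Exp.lift s) g)
  | _, _, _, put E f F, _, _, s, _ => put (E.subst s) f (F.subst s)

/-- The same term in a context with one more stack variable. -/
def wkVal {n : ℕ} {Γ : List Ty} {τ : Ty} (M : Term n Γ τ) : Term (n + 1) Γ τ :=
  M.ren (fun i => .var i.succ) fun _ x => x

/-- The same term in a context with one more identifier. -/
def wkId {n : ℕ} {Γ : List Ty} {τ : Ty} (σ : Ty) (M : Term n Γ τ) : Term n (σ :: Γ) τ :=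
  M.ren .var fun _ x => .succ x

/-- Lift a substitution for identifiers under a binder. -/
def lift {n : ℕ} {Γ Γ' : List Ty} (t : ∀ τ, Var Γ τ → Term n Γ' τ) (σ : Ty) :
    ∀ τ, Var (σ :: Γ) τ → Term n (σ :: Γ') τ
  | _, .zero => var .zero
  | _, .succ x => (t _ x).wkId σ

/-- Simultaneous capture-avoiding substitution for stack variables and identifiers. -/
def subst : {n : ℕ} → {Γ : List Ty} → {τ : Ty} → Term n Γ τ → {m : ℕ} → {Γ' : List Ty} →
    (Fin n → Exp m) → (∀ τ, Var Γ τ → Term m Γ' τ) → Term m Γ' τ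
  | _, _, _, var x, _, _, _, t => t _ x
  | _, _, _, lamVal M, _, _, s, t => lamVal (M.subst (Exp.lift s) fun _ x => (t _ x).wkVal)
  | _, _, _, appVal M E, _, _, s, t => appVal (M.subst s t) (E.subst s)
  | _, _, _, lam M, _, _, s, t => lam (M.subst s (lift t _))
  | _, _, _, app M N, _, _, s, t => app (M.subst s t) (N.subst s t)
  | _, _, _, fix M, _, _, s, t => fix (M.subst s t)
  | _, _, _, ite E F M N, _, _, s, t =>
    ite (E.subst s) (F.subst s) (M.subst s t) (N.subst s t)
  | _, _, _, seq M N, _, _, s, t => seq (M.subst s t) (N.subst s t)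
  | _, _, _, letNew M, _, _, s, t => letNew (M.subst (Exp.lift s) fun _ x => (t _ x).wkVal)
  | _, _, _, free E, _, _, s, _ => free (E.subst s)
  | _, _, _, letGet E f M, _, _, s, t =>
    letGet (E.subst s) f (M.subst (Exp.lift s) fun _ x => (t _ x).wkVal)
  | _, _, _, put E f F, _, _, s, _ => put (E.subst s) f (F.subst s)

/-- The substitution of `M` for the most recent identifier. -/
def inst {n : ℕ} {Γ : List Ty} {σ : Ty} (M : Term n Γ σ) : ∀ τ, Var (σ :: Γ) τ → Term n Γ τ
  | _, .zero => M
  | _, .succ x => var x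

end Term

/-! ### Interpretation of terms -/

section Closure

variable {A B C : Type} [FMCpo A] [FMCpo B] [FMCpo C]

theorem FinSuppFun.const (b : B) : FinSuppFun (fun _ : A => b) := by
  obtain ⟨L, hL⟩ := FMCpo.exists_support b
  exact ⟨L, fun π hπ _ => (hL π fun l hl => hπ l hl).symm⟩

theorem FinSuppFun.pair {f : A → B} {g : A → C} (hf : FinSuppFun f) (hg : FinSuppFun g) :
    FinSuppFun fun a => (f a, g a) := by
  obtain ⟨L, hL⟩ := hf
  obtain ⟨L', hL'⟩ := hg
  exact ⟨L ∪ L', fun π hπ a => Prod.ext (hL π (fun l hl => hπ l (by simp [hl])) a)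
    (hL' π (fun l hl => hπ l (by simp [hl])) a)⟩

theorem FMContinuous.pair {f : A → B} {g : A → C} (hf : FMContinuous f) (hg : FMContinuous g) :
    FMContinuous fun a => (f a, g a) := fun c hc a ha =>
  isLUB_range_prod.2 ⟨hf c hc a ha, hg c hc a ha⟩

theorem FinSuppFun.comp {g : B → C} {f : A → B} (hg : FinSuppFun g) (hf : FinSuppFun f) :
    FinSuppFun fun a => g (f a) := by
  obtain ⟨L, hL⟩ := hf
  obtain ⟨L', hL'⟩ := hg
  exact ⟨L ∪ L', fun π hπ a =>
    (congrArg g (hL π (fun l hl => hπ l (by simp [hl])) a)).trans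
      (hL' π (fun l hl => hπ l (by simp [hl])) (f a))⟩

end Closure

namespace Com

variable {n : ℕ} {Γ : List Ty}

/-- The arguments of a command in an environment. -/
abbrev Args (n : ℕ) (Γ : List Ty) : Type := Env n Γ × (Heap × Cont)

theorem args_le {p q : Args n Γ} (h : p ≤ q) : p.1.1 = q.1.1 ∧ p.2.1 = q.2.1 :=
  ⟨funext fun i => h.1.1 i, h.2.1⟩

/-- Running `M` with fixed stack environment and heap is continuous in the other arguments. -/
theorem cont_run {m : ℕ} (M : FMHom (Env m Γ) Com) (ρ : StackEnv m) (h : Heap) :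
    FMContinuous fun p : Args n Γ => M (ρ, p.1.2) (h, p.2.2) := by
  have c1 : FMContinuous fun p : Args n Γ => ((ρ, p.1.2) : Env m Γ) :=
    (FMContinuous.const ρ).pair ((FMHom.snd.comp FMHom.fst).cont)
  have s1 : FinSuppFun fun p : Args n Γ => ((ρ, p.1.2) : Env m Γ) :=
    (FinSuppFun.const ρ).pair ((FMHom.snd.comp FMHom.fst).finSupp)
  have c2 : FMContinuous fun p : Args n Γ => (h, p.2.2) :=
    (FMContinuous.const h).pair ((FMHom.snd.comp FMHom.snd).cont)
  have s2 : FinSuppFun fun p : Args n Γ => (h, p.2.2) :=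
    (FinSuppFun.const h).pair ((FMHom.snd.comp FMHom.snd).finSupp)
  exact FMHom.eval.cont.comp ((M.cont.comp c1 s1).pair c2) ((M.finSupp.comp s1).pair s2)

/-- Calling the continuation with a fixed heap is continuous. -/
theorem cont_call (h : Heap) : FMContinuous fun p : Args n Γ => p.2.2 h :=
  FMHom.eval.cont.comp ((FMHom.snd.comp FMHom.snd).cont.pair (FMContinuous.const h))
    ((FMHom.snd.comp FMHom.snd).finSupp.pair (FinSuppFun.const h))

theorem call_equivariant (π : Perm) (k : Cont) (h : Heap) : (π • k) (π • h) = k h :=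
  FMHom.eval.equivariant π (k, h)

theorem run_equivariant {m : ℕ} (M : FMHom (Env m Γ) Com) (π : Perm) (ρ : StackEnv m)
    (η : IdEnv Γ) (h : Heap) (k : Cont) :
    M (π • ρ, π • η) (π • h, π • k) = M (ρ, η) (h, k) := by
  have h1 : M (π • ρ, π • η) = π • M (ρ, η) := M.equivariant π (ρ, η)
  rw [h1]
  exact FMHom.eval.equivariant π (M (ρ, η), (h, k))

def ite (E F : Exp n) (M N : FMHom (Env n Γ) Com) : FMHom (Env n Γ) Com where
  toFun x := if E.eval x.1 = F.eval x.1 then M x else N x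
  cont := by
    refine FMContinuous.of_local fun x₀ => ?_
    by_cases hx : E.eval x₀.1 = F.eval x₀.1
    · refine ⟨M, M.cont, fun x h => ?_⟩
      have : x.1 = x₀.1 := funext fun i => h.1 i
      simp [this, hx]
    · refine ⟨N, N.cont, fun x h => ?_⟩
      have : x.1 = x₀.1 := funext fun i => h.1 i
      simp [this, hx]
  equivariant π x := by
    show (if E.eval (π • x.1) = F.eval (π • x.1) then M (π • x) else N (π • x)) = _
    rw [Exp.eval_smul, Exp.eval_smul, M.equivariant, N.equivariant]
    by_cases h : E.eval x.1 = F.eval x.1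
    · simp [h]
    · have : π • E.eval x.1 ≠ π • F.eval x.1 := fun hc => h (smul_left_cancel π hc)
      simp [h, this]

/-- The continuation `λ h'. N (h', k)`. -/
def seqCont (N : FMHom (Env n Γ) Com) : FMHom (Args n Γ) Cont :=
  FMHom.curry (FMHom.eval.comp (FMHom.pair (N.comp (FMHom.fst.comp FMHom.fst))
    (FMHom.pair FMHom.snd (FMHom.snd.comp (FMHom.snd.comp FMHom.fst)))))

/-- `(M; N) (h, k) = M (h, λ h'. N (h', k))`. -/
def seq (M N : FMHom (Env n Γ) Com) : FMHom (Env n Γ) Com :=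
  FMHom.curry (FMHom.eval.comp (FMHom.pair (M.comp FMHom.fst)
    (FMHom.pair (FMHom.fst.comp FMHom.snd) (seqCont N))))

theorem seq_apply (M N : FMHom (Env n Γ) Com) (x : Env n Γ) (h : Heap) (k : Cont) :
    seq M N x (h, k) = M x (h, seqCont N (x, (h, k))) ∧
      ∀ h', seqCont N (x, (h, k)) h' = N x (h', k) := ⟨rfl, fun _ => rfl⟩

/-- Running `M` with a new cell at `l`. -/
def newAt (M : FMHom (Env (n + 1) Γ) Com) (l : Loc) (p : Args n Γ) : Obs :=
  M (p.1.1.ext (.loc l), p.1.2) (p.2.1.union (.single l (.int 0, .int 0)), p.2.2)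

theorem cont_newAt (M : FMHom (Env (n + 1) Γ) Com) (l : Loc) : FMContinuous (newAt M l) := by
  refine FMContinuous.of_local fun p₀ => ⟨_, cont_run M (p₀.1.1.ext (.loc l))
    (p₀.2.1.union (.single l (.int 0, .int 0))), fun p h => ?_⟩
  simp only [newAt, (args_le h).1, (args_le h).2]

theorem newAt_smul (M : FMHom (Env (n + 1) Γ) Com) (π : Perm) (l : Loc) (p : Args n Γ) :
    newAt M (π • l) (π • p) = newAt M l p := by
  have := run_equivariant M π (p.1.1.ext (.loc l)) p.1.2
    (p.2.1.union (.single l (.int 0, .int 0))) p.2.2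
  rw [StackEnv.smul_ext, Heap.smul_union, Heap.smul_single] at this
  exact this

theorem newAt_eq_of_supports (M : FMHom (Env (n + 1) Γ) Com) {p : Args n Γ} {L : Finset Loc}
    (hL : MulAction.Supports Perm (L : Set Loc) p) {l l' : Loc} (hl : l ∉ L) (hl' : l' ∉ L) :
    newAt M l p = newAt M l' p := by
  let π : Perm := ⟨Equiv.swap l l', by
    refine (Set.toFinite {l, l'}).subset ?_
    intro x hx
    by_contra hc
    simp only [Set.mem_insert_iff, Set.mem_singleton_iff, not_or] at hc
    exact hx (Equiv.swap_apply_of_ne_of_ne hc.1 hc.2)⟩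
  have h1 : π • p = p := hL π fun x hx =>
    Equiv.swap_apply_of_ne_of_ne (fun h => hl (h ▸ hx)) (fun h => hl' (h ▸ hx))
  have h2 : π • l = l' := Equiv.swap_apply_left l l'
  rw [← newAt_smul M π l p, h1, h2]

/-- The choice of the new location does not matter, as long as it is fresh. -/
theorem newAt_eq (M : FMHom (Env (n + 1) Γ) Com) {p : Args n Γ} {l l' : Loc}
    (hl : l ∉ supp p) (hl' : l' ∉ supp p) : newAt M l p = newAt M l' p := by
  simp only [supp, Set.mem_ofPred_eq, not_forall] at hl hl'
  obtain ⟨L, hL, hl⟩ := hl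
  obtain ⟨L', hL', hl'⟩ := hl'
  obtain ⟨x, hx⟩ := Infinite.exists_notMem_finset (L ∪ L')
  simp only [Finset.mem_union, not_or] at hx
  rw [newAt_eq_of_supports M hL hl hx.1, newAt_eq_of_supports M hL' hl' hx.2]

/-- A location outside `supp (ρ, η, h, k)`. -/
def fresh (p : Args n Γ) : Loc := Classical.choose (exists_not_mem_supp p)

theorem fresh_spec (p : Args n Γ) : fresh p ∉ supp p := Classical.choose_spec (exists_not_mem_supp p)

theorem newAt_fresh (M : FMHom (Env (n + 1) Γ) Com) {p : Args n Γ} {L : Finset Loc}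
    (hL : MulAction.Supports Perm (L : Set Loc) p) {l : Loc} (hl : l ∉ L) :
    newAt M (fresh p) p = newAt M l p :=
  newAt_eq M (fresh_spec p) fun h => hl (h L hL)

def letNew (M : FMHom (Env (n + 1) Γ) Com) : FMHom (Env n Γ) Com :=
  FMHom.curry
    { toFun := fun p => newAt M (fresh p) p
      cont := by
        rintro c ⟨L, hL⟩ a ha
        obtain ⟨L', hL'⟩ := FMCpo.exists_support a
        obtain ⟨l, hl⟩ := Infinite.exists_notMem_finset (L ∪ L')
        simp only [Finset.mem_union, not_or] at hl
        have h1 : (fun n => newAt M (fresh (c n)) (c n)) = fun n => newAt M l (c n) :=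
          funext fun n => newAt_fresh M (hL n) hl.1
        have h2 : newAt M (fresh a) a = newAt M l a := newAt_fresh M hL' hl.2
        show IsLUB (Set.range fun n => newAt M (fresh (c n)) (c n)) (newAt M (fresh a) a)
        rw [h1, h2]
        exact cont_newAt M l c ⟨L, hL⟩ a ha
      equivariant := by
        intro π p
        obtain ⟨L, hL⟩ := FMCpo.exists_support p
        obtain ⟨l, hl⟩ := Infinite.exists_notMem_finset L
        rw [newAt_fresh M hL hl, newAt_fresh M (supports_smul hL π) (l := π • l), newAt_smul]
        · rfl
        · intro hc
          obtain ⟨x, hx, hxl⟩ := Finset.mem_image.1 hc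
          rw [smul_left_cancel π hxl] at hx
          exact hl hx }

/-- Look up the cell at `E`, and run `F` on its contents; `err` if there is no such cell. -/
def withCell (E : Exp n) (F : Args n Γ → Loc → Val × Val → Obs)
    (hc : ∀ p₀ l v, ∃ g, FMContinuous g ∧ ∀ p, p ≤ p₀ → F p l v = g p)
    (he : ∀ (π : Perm) p l v, F (π • p) (π • l) (π • v) = F p l v) : FMHom (Env n Γ) Com :=
  FMHom.curry
    { toFun := fun p => match E.eval p.1.1 with
        | .loc l => match p.2.1.cell l with
          | some v => F p l v
          | none => .err
        | _ => .err
      cont := by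
        refine FMContinuous.of_local fun p₀ => ?_
        cases hE : E.eval p₀.1.1 with
        | loc l =>
          cases hv : p₀.2.1.cell l with
          | none =>
            refine ⟨_, FMContinuous.const .err, fun p hp => ?_⟩
            simp only [(args_le hp).1, (args_le hp).2, hE, hv]
          | some v =>
            obtain ⟨g, hg, hgp⟩ := hc p₀ l v
            refine ⟨g, hg, fun p hp => ?_⟩
            simp only [(args_le hp).1, (args_le hp).2, hE, hv]
            exact hgp p hp
        | int z =>
          refine ⟨_, FMContinuous.const .err, fun p hp => ?_⟩
          simp only [(args_le hp).1, hE]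
        | dflt =>
          refine ⟨_, FMContinuous.const .err, fun p hp => ?_⟩
          simp only [(args_le hp).1, hE]
      equivariant := by
        intro π p
        have h1 : E.eval (π • p).1.1 = π • E.eval p.1.1 := Exp.eval_smul π p.1.1 E
        rw [h1]
        cases hE : E.eval p.1.1 with
        | loc l =>
          have h2 : (π • p).2.1.cell (π • l) = (p.2.1.cell l).map (π • ·) :=
            Heap.smul_cell_smul π p.2.1 l
          show (match (π • p).2.1.cell (π • l) with
            | some v => F (π • p) (π • l) v
            | none => .err) = (match p.2.1.cell l with
            | some v => F p l v
            | none => .err : Obs)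
          rw [h2]
          cases p.2.1.cell l with
          | none => rfl
          | some v => exact he π p l v
        | int z => rfl
        | dflt => rfl }

def free (E : Exp n) : FMHom (Env n Γ) Com :=
  withCell E (fun p l _ => p.2.2 (p.2.1.erase l))
    (fun p₀ l _ => ⟨_, cont_call (p₀.2.1.erase l), fun p hp => by simp only [(args_le hp).2]⟩)
    (fun π p l _ => by
      have := call_equivariant π p.2.2 (p.2.1.erase l)
      rwa [Heap.smul_erase] at this)

/-- The contents of a field. -/
def getField (f : Fin 2) (v : Val × Val) : Val := if f = 0 then v.1 else v.2

/-- Overwrite a field. -/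
def setField (f : Fin 2) (v : Val × Val) (w : Val) : Val × Val :=
  if f = 0 then (w, v.2) else (v.1, w)

def letGet (E : Exp n) (f : Fin 2) (M : FMHom (Env (n + 1) Γ) Com) : FMHom (Env n Γ) Com :=
  withCell E (fun p _ v => M (p.1.1.ext (getField f v), p.1.2) p.2)
    (fun p₀ _ v => ⟨_, cont_run M (p₀.1.1.ext (getField f v)) p₀.2.1, fun p hp => by
      simp only [← (args_le hp).1, ← (args_le hp).2]⟩)
    (fun π p _ v => by
      have := run_equivariant M π (p.1.1.ext (getField f v)) p.1.2 p.2.1 p.2.2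
      rw [StackEnv.smul_ext] at this
      have h2 : π • getField f v = getField f (π • v) := by unfold getField; split_ifs <;> rfl
      rw [h2] at this
      exact this)

def put (E : Exp n) (f : Fin 2) (F : Exp n) : FMHom (Env n Γ) Com :=
  withCell E (fun p l v => p.2.2 (p.2.1.set l (setField f v (F.eval p.1.1))))
    (fun p₀ l v => ⟨_, cont_call (p₀.2.1.set l (setField f v (F.eval p₀.1.1))), fun p hp => by
      simp only [(args_le hp).1, (args_le hp).2]⟩)
    (fun π p l v => by
      have := call_equivariant π p.2.2 (p.2.1.set l (setField f v (F.eval p.1.1)))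
      rw [Heap.smul_set] at this
      have h2 : π • setField f v (F.eval p.1.1) =
          setField f (π • v) (F.eval (π • p).1.1) := by
        have h3 : F.eval (π • p).1.1 = π • F.eval p.1.1 := Exp.eval_smul π p.1.1 F
        rw [h3]
        unfold setField; split_ifs <;> rfl
      rw [h2] at this
      exact this)

end Com

/-- The value of an expression, as a morphism. -/
def Exp.den {n : ℕ} (Γ : List Ty) (E : Exp n) : FMHom (Env n Γ) Val where
  toFun x := E.eval x.1
  cont := by
    refine FMContinuous.of_local fun x₀ => ⟨_, FMContinuous.const (E.eval x₀.1), fun x h => ?_⟩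
    have : x.1 = x₀.1 := funext fun i => h.1 i
    rw [this]
  equivariant π x := Exp.eval_smul π x.1 E

/-- Extension of the stack environment, as a morphism. -/
def StackEnv.extHom (n : ℕ) (Γ : List Ty) : FMHom (Env n Γ × Val) (Env (n + 1) Γ) where
  toFun p := (p.1.1.ext p.2, p.1.2)
  cont := by
    refine FMContinuous.of_local fun p₀ => ⟨fun p => (p₀.1.1.ext p₀.2, p.1.2),
      (FMContinuous.const _).pair (FMHom.snd.comp FMHom.fst).cont, fun p h => ?_⟩
    have h1 : p.1.1 = p₀.1.1 := funext fun i => h.1.1 i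
    have h2 : p.2 = p₀.2 := h.2
    rw [h1, h2]
  equivariant π p := Prod.ext (StackEnv.smul_ext π p.1.1 p.2).symm rfl

/-- Extension of the identifier environment, as a morphism. -/
def IdEnv.extHom (n : ℕ) (Γ : List Ty) (σ : Ty) : FMHom (Env n Γ × σ.El) (Env n (σ :: Γ)) :=
  FMHom.pair (B := σ.El × IdEnv Γ) (FMHom.fst.comp FMHom.fst)
    (FMHom.pair FMHom.snd (FMHom.snd.comp FMHom.fst))

/-- Projection to an identifier. -/
def Var.den : {Γ : List Ty} → {τ : Ty} → Var Γ τ → FMHom (IdEnv Γ) τ.El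
  | _ :: Γ, τ, .zero => (FMHom.fst : FMHom (τ.El × IdEnv Γ) τ.El)
  | σ :: Γ, _, .succ x => x.den.comp (FMHom.snd : FMHom (σ.El × IdEnv Γ) (IdEnv Γ))

/-- The interpretation `⟦Δ | Γ ⊢ M : τ⟧`, an FM-continuous function from `⟦Δ⟧ × ⟦Γ⟧` to `⟦τ⟧`. -/
def Term.den : {n : ℕ} → {Γ : List Ty} → {τ : Ty} → Term n Γ τ → FMHom (Env n Γ) τ.El
  | _, _, _, .var x => x.den.comp FMHom.snd
  | n, Γ, .fnVal τ, .lamVal M => (FMHom.curry (M.den.comp (StackEnv.extHom n Γ)) :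
      FMHom (Env n Γ) (FMFun Val τ.El))
  | n, Γ, τ, .appVal M E =>
    (FMHom.eval : FMHom (FMFun Val τ.El × Val) τ.El).comp
      (FMHom.pair (M.den : FMHom (Env n Γ) (FMFun Val τ.El)) (E.den Γ))
  | n, Γ, .fn σ τ, .lam M => (FMHom.curry (M.den.comp (IdEnv.extHom n Γ σ)) :
      FMHom (Env n Γ) (FMFun σ.El τ.El))
  | n, Γ, τ, .app (σ := σ) M N =>
    (FMHom.eval : FMHom (FMFun σ.El τ.El × σ.El) τ.El).comp
      (FMHom.pair (M.den : FMHom (Env n Γ) (FMFun σ.El τ.El)) N.den)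
  | n, Γ, τ, .fix M =>
    (FMHom.fix : FMHom (FMFun τ.El τ.El) τ.El).comp
      (M.den : FMHom (Env n Γ) (FMFun τ.El τ.El))
  | _, _, _, .ite E F M N => Com.ite E F M.den N.den
  | _, _, _, .seq M N => Com.seq M.den N.den
  | _, _, _, .letNew M => Com.letNew M.den
  | _, _, _, .free E => Com.free E
  | _, _, _, .letGet E f M => Com.letGet E f M.den
  | _, _, _, .put E f F => Com.put E f F

/-! ### Assertions -/

/-- Assertions over `n` stack variables. -/
inductive Assn : ℕ → Type
  | eq {n : ℕ} (E F : Exp n) : Assn n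
  | le {n : ℕ} (E F : Exp n) : Assn n
  | pts {n : ℕ} (E E₀ E₁ : Exp n) : Assn n
  | emp {n : ℕ} : Assn n
  | star {n : ℕ} (P Q : Assn n) : Assn n
  | and {n : ℕ} (P Q : Assn n) : Assn n
  | not {n : ℕ} (P : Assn n) : Assn n
  | ex {n : ℕ} (P : Assn (n + 1)) : Assn n

/-- The order on integers; other values are unrelated. -/
def Val.IntLE : Val → Val → Prop
  | .int a, .int b => a ≤ b
  | _, _ => False

namespace Assn

/-- The set of heaps that satisfy an assertion. -/
def den : {n : ℕ} → Assn n → StackEnv n → Set Heap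
  | _, eq E F, ρ => {_h | E.eval ρ = F.eval ρ}
  | _, le E F, ρ => {_h | (E.eval ρ).IntLE (F.eval ρ)}
  | _, pts E E₀ E₁, ρ => {h | ∃ l, E.eval ρ = .loc l ∧ h = .single l (E₀.eval ρ, E₁.eval ρ)}
  | _, emp, _ => {.empty}
  | _, star P Q, ρ => {h | ∃ n ∈ P.den ρ, ∃ m ∈ Q.den ρ, h.Split n m}
  | _, and P Q, ρ => P.den ρ ∩ Q.den ρ
  | _, not P, ρ => (P.den ρ)ᶜ
  | _, ex P, ρ => {h | ∃ v, h ∈ P.den (ρ.ext v)}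

def or {n : ℕ} (P Q : Assn n) : Assn n := not (and (not P) (not Q))

/-- Simultaneous substitution. -/
def subst : {n : ℕ} → Assn n → {m : ℕ} → (Fin n → Exp m) → Assn m
  | _, eq E F, _, s => eq (E.subst s) (F.subst s)
  | _, le E F, _, s => le (E.subst s) (F.subst s)
  | _, pts E E₀ E₁, _, s => pts (E.subst s) (E₀.subst s) (E₁.subst s)
  | _, emp, _, _ => emp
  | _, star P Q, _, s => star (P.subst s) (Q.subst s)
  | _, and P Q, _, s => and (P.subst s) (Q.subst s)
  | _, not P, _, s => not (P.subst s)
  | _, ex P, _, s => ex (P.subst (Exp.lift s))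

/-- The same assertion in a context with one more stack variable. -/
def wk {n : ℕ} (P : Assn n) : Assn (n + 1) := P.subst fun i => .var i.succ

/-- The one-cell heap at `E` with `A` in the field `f` and `B` in the other field. -/
def ptsAt {n : ℕ} (f : Fin 2) (E A B : Exp n) : Assn n :=
  if f = 0 then pts E A B else pts E B A

/-- `E ↦ -`. -/
def ptsAny {n : ℕ} (E : Exp n) : Assn n :=
  ex (ex (pts E.wk.wk (.var 1) (.var 0)))

/-- The one-cell heap at `E` with anything in the field `f` and `B` in the other field:
`E ↦ -,B` if `f = 0`, and `E ↦ B,-` if `f = 1`. -/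
def ptsAnyAt {n : ℕ} (f : Fin 2) (E B : Exp n) : Assn n :=
  ex (ptsAt f E.wk (.var 0) B.wk)

theorem intLE_smul (π : Perm) (v w : Val) : (π • v).IntLE (π • w) ↔ v.IntLE w := by
  cases v <;> cases w <;> rfl

theorem den_smul {n : ℕ} (P : Assn n) : ∀ (π : Perm) (ρ : StackEnv n) (h : Heap),
    h ∈ P.den ρ → π • h ∈ P.den (π • ρ) := by
  suffices H : ∀ (π : Perm) (ρ : StackEnv n) (h : Heap),
      h ∈ P.den ρ ↔ π • h ∈ P.den (π • ρ) from fun π ρ h => (H π ρ h).1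
  induction P with
  | eq E F =>
    intro π ρ h
    show E.eval ρ = F.eval ρ ↔ E.eval (π • ρ) = F.eval (π • ρ)
    rw [Exp.eval_smul, Exp.eval_smul]
    exact (MulAction.injective π).eq_iff.symm
  | le E F =>
    intro π ρ h
    show (E.eval ρ).IntLE (F.eval ρ) ↔ (E.eval (π • ρ)).IntLE (F.eval (π • ρ))
    rw [Exp.eval_smul, Exp.eval_smul, intLE_smul]
  | pts E E₀ E₁ =>
    have key : ∀ (π : Perm) ρ h, h ∈ (pts E E₀ E₁).den ρ → π • h ∈ (pts E E₀ E₁).den (π • ρ) := by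
      rintro π ρ h ⟨l, hE, rfl⟩
      refine ⟨π • l, ?_, ?_⟩
      · rw [Exp.eval_smul, hE]; rfl
      · rw [Heap.smul_single, Exp.eval_smul, Exp.eval_smul]; rfl
    intro π ρ h
    exact ⟨key π ρ h, fun hh => by simpa using key π⁻¹ _ _ hh⟩
  | emp =>
    intro π ρ h
    show h = Heap.empty ↔ π • h = Heap.empty
    rw [← Heap.smul_empty π]
    exact (MulAction.injective π).eq_iff.symm
  | star P Q hP hQ =>
    have key : ∀ (π : Perm) ρ h, h ∈ (star P Q).den ρ → π • h ∈ (star P Q).den (π • ρ) := by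
      rintro π ρ h ⟨n, hn, m, hm, hs⟩
      exact ⟨π • n, (hP π ρ n).1 hn, π • m, (hQ π ρ m).1 hm, hs.smul π⟩
    intro π ρ h
    exact ⟨key π ρ h, fun hh => by simpa using key π⁻¹ _ _ hh⟩
  | and P Q hP hQ =>
    intro π ρ h
    exact and_congr (hP π ρ h) (hQ π ρ h)
  | not P hP =>
    intro π ρ h
    exact not_congr (hP π ρ h)
  | ex P hP =>
    have key : ∀ (π : Perm) ρ h, h ∈ (ex P).den ρ → π • h ∈ (ex P).den (π • ρ) := by
      rintro π ρ h ⟨v, hv⟩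
      refine ⟨π • v, ?_⟩
      rw [← StackEnv.smul_ext]
      exact (hP π _ h).1 hv
    intro π ρ h
    exact ⟨key π ρ h, fun hh => by simpa using key π⁻¹ _ _ hh⟩

end Assn

/-! ### Worlds and semantic quadruples -/

/-- Worlds: finitely supported binary relations on heaps. -/
@[ext]
structure World : Type where
  rel : Heap → Heap → Prop
  finSupp : ∃ L : Finset Loc, ∀ π : Perm, (∀ l ∈ L, π • l = l) →
    ∀ h₀ h₁, rel h₀ h₁ ↔ rel (π • h₀) (π • h₁)

namespace World

/-- Separating conjunction of relations. -/
def star (r s : World) : World where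
  rel h₀ h₁ := ∃ n₀ m₀ n₁ m₁ : Heap,
    h₀.Split n₀ m₀ ∧ h₁.Split n₁ m₁ ∧ r.rel n₀ n₁ ∧ s.rel m₀ m₁
  finSupp := by
    obtain ⟨L, hL⟩ := r.finSupp
    obtain ⟨L', hL'⟩ := s.finSupp
    refine ⟨L ∪ L', ?_⟩
    have key : ∀ π : Perm, (∀ l ∈ L ∪ L', π • l = l) → ∀ h₀ h₁ : Heap,
        (∃ n₀ m₀ n₁ m₁ : Heap,
          h₀.Split n₀ m₀ ∧ h₁.Split n₁ m₁ ∧ r.rel n₀ n₁ ∧ s.rel m₀ m₁) →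
        (∃ n₀ m₀ n₁ m₁ : Heap, (π • h₀).Split n₀ m₀ ∧ (π • h₁).Split n₁ m₁ ∧
          r.rel n₀ n₁ ∧ s.rel m₀ m₁) := by
      rintro π hπ h₀ h₁ ⟨n₀, m₀, n₁, m₁, s₀, s₁, hr, hs⟩
      exact ⟨π • n₀, π • m₀, π • n₁, π • m₁, s₀.smul π, s₁.smul π,
        (hL π (fun l hl => hπ l (by simp [hl])) _ _).1 hr,
        (hL' π (fun l hl => hπ l (by simp [hl])) _ _).1 hs⟩
    intro π hπ h₀ h₁
    refine ⟨key π hπ h₀ h₁, fun h => ?_⟩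
    have := key π⁻¹ (fun l hl => by rw [inv_smul_eq_iff, hπ l hl]) _ _ h
    simpa only [inv_smul_smul] using this

/-- The partial identity relation `eq(⟦P⟧_ρ)`. -/
def eqAssn {n : ℕ} (P : Assn n) (ρ : StackEnv n) : World where
  rel h₀ h₁ := h₀ = h₁ ∧ h₀ ∈ P.den ρ
  finSupp := by
    obtain ⟨L, hL⟩ := FMCpo.exists_support ρ
    refine ⟨L, fun π hπ h₀ h₁ => ?_⟩
    have hρ : π • ρ = ρ := hL π fun l hl => hπ l hl
    have hρ' : π⁻¹ • ρ = ρ := by rw [inv_smul_eq_iff, hρ]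
    refine and_congr (MulAction.injective π).eq_iff.symm ⟨fun h => ?_, fun h => ?_⟩
    · have := P.den_smul π ρ h₀ h
      rwa [hρ] at this
    · have := P.den_smul π⁻¹ ρ _ h
      rwa [inv_smul_smul, hρ'] at this

end World

/-- The relation `eq(G)` on observations, where `G = {normal, ⊥}`. -/
def EqGood (o₀ o₁ : Obs) : Prop := o₀ = o₁ ∧ o₀ ≠ .err

/-- The relation `r → eq(G)` on continuations. -/
def ContRel (r : World) (k₀ k₁ : Cont) : Prop :=
  ∀ h₀ h₁, r.rel h₀ h₁ → EqGood (k₀ h₀) (k₁ h₁)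

/-- The semantic quadruple `{r} c₀, c₁ {s}`. -/
def Quad (r : World) (c₀ c₁ : Com) (s : World) : Prop :=
  ∀ (r' : World) (h₀ h₁ : Heap) (k₀ k₁ : Cont),
    (r.star r').rel h₀ h₁ → ContRel (s.star r') k₀ k₁ → EqGood (c₀ (h₀, k₀)) (c₁ (h₁, k₁))

/-! ### Specifications -/

/-- Well-typed specifications `Δ | Γ ⊢ φ : Specs`, where `Δ` has `n` stack variables. -/
inductive Spec : ℕ → List Ty → Type
  | triple {n : ℕ} {Γ : List Ty} (P : Assn n) (M : Term n Γ .com) (Q : Assn n) : Spec n Γ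
  | inv {n : ℕ} {Γ : List Ty} (φ : Spec n Γ) (P : Assn n) : Spec n Γ
  | eqVal {n : ℕ} {Γ : List Ty} (E F : Exp n) : Spec n Γ
  | eqTerm {n : ℕ} {Γ : List Ty} {τ : Ty} (M N : Term n Γ τ) : Spec n Γ
  | and {n : ℕ} {Γ : List Ty} (φ ψ : Spec n Γ) : Spec n Γ
  | or {n : ℕ} {Γ : List Ty} (φ ψ : Spec n Γ) : Spec n Γ
  | imp {n : ℕ} {Γ : List Ty} (φ ψ : Spec n Γ) : Spec n Γ
  | allId {n : ℕ} {Γ : List Ty} (τ : Ty) (φ : Spec n (τ :: Γ)) : Spec n Γ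
  | exId {n : ℕ} {Γ : List Ty} (τ : Ty) (φ : Spec n (τ :: Γ)) : Spec n Γ
  | allVal {n : ℕ} {Γ : List Ty} (φ : Spec (n + 1) Γ) : Spec n Γ
  | exVal {n : ℕ} {Γ : List Ty} (φ : Spec (n + 1) Γ) : Spec n Γ

namespace Spec

def iff {n : ℕ} {Γ : List Ty} (φ ψ : Spec n Γ) : Spec n Γ := and (imp φ ψ) (imp ψ φ)

/-- The satisfaction relation `(ρ, η₀, η₁, r) ⊨ φ`. -/
def Sat : {n : ℕ} → {Γ : List Ty} → Spec n Γ → StackEnv n → IdEnv Γ → IdEnv Γ → World → Prop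
  | _, _, triple P M Q, ρ, η₀, η₁, r =>
    Quad ((World.eqAssn P ρ).star r) (M.den (ρ, η₀)) (M.den (ρ, η₁)) ((World.eqAssn Q ρ).star r)
  | _, _, inv φ P, ρ, η₀, η₁, r => φ.Sat ρ η₀ η₁ (r.star (World.eqAssn P ρ))
  | _, _, eqVal E F, ρ, _, _, _ => E.eval ρ = F.eval ρ
  | _, _, eqTerm M N, ρ, η₀, η₁, _ =>
    M.den (ρ, η₀) = N.den (ρ, η₀) ∧ M.den (ρ, η₁) = N.den (ρ, η₁)
  | _, _, and φ ψ, ρ, η₀, η₁, r => φ.Sat ρ η₀ η₁ r ∧ ψ.Sat ρ η₀ η₁ r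
  | _, _, or φ ψ, ρ, η₀, η₁, r => φ.Sat ρ η₀ η₁ r ∨ ψ.Sat ρ η₀ η₁ r
  | _, _, imp φ ψ, ρ, η₀, η₁, r =>
    ∀ s : World, φ.Sat ρ η₀ η₁ (r.star s) → ψ.Sat ρ η₀ η₁ (r.star s)
  | _, _, allId τ φ, ρ, η₀, η₁, r => ∀ m₀ m₁ : τ.El, φ.Sat ρ (η₀.ext m₀) (η₁.ext m₁) r
  | _, _, exId τ φ, ρ, η₀, η₁, r => ∃ m₀ m₁ : τ.El, φ.Sat ρ (η₀.ext m₀) (η₁.ext m₁) r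
  | _, _, allVal φ, ρ, η₀, η₁, r => ∀ v : Val, φ.Sat (ρ.ext v) η₀ η₁ r
  | _, _, exVal φ, ρ, η₀, η₁, r => ∃ v : Val, φ.Sat (ρ.ext v) η₀ η₁ r

/-- Simultaneous capture-avoiding substitution for stack variables and identifiers. -/
def subst : {n : ℕ} → {Γ : List Ty} → Spec n Γ → {m : ℕ} → {Γ' : List Ty} →
    (Fin n → Exp m) → (∀ τ, Var Γ τ → Term m Γ' τ) → Spec m Γ'
  | _, _, triple P M Q, _, _, s, t => triple (P.subst s) (M.subst s t) (Q.subst s)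
  | _, _, inv φ P, _, _, s, t => inv (φ.subst s t) (P.subst s)
  | _, _, eqVal E F, _, _, s, _ => eqVal (E.subst s) (F.subst s)
  | _, _, eqTerm M N, _, _, s, t => eqTerm (M.subst s t) (N.subst s t)
  | _, _, and φ ψ, _, _, s, t => and (φ.subst s t) (ψ.subst s t)
  | _, _, or φ ψ, _, _, s, t => or (φ.subst s t) (ψ.subst s t)
  | _, _, imp φ ψ, _, _, s, t => imp (φ.subst s t) (ψ.subst s t)
  | _, _, allId τ φ, _, _, s, t => allId τ (φ.subst s (Term.lift t τ))
  | _, _, exId τ φ, _, _, s, t => exId τ (φ.subst s (Term.lift t τ))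
  | _, _, allVal φ, _, _, s, t => allVal (φ.subst (Exp.lift s) fun _ x => (t _ x).wkVal)
  | _, _, exVal φ, _, _, s, t => exVal (φ.subst (Exp.lift s) fun _ x => (t _ x).wkVal)

/-- The same specification in a context with one more stack variable. -/
def wkVal {n : ℕ} {Γ : List Ty} (φ : Spec n Γ) : Spec (n + 1) Γ :=
  φ.subst (fun i => .var i.succ) fun _ x => .var x

/-- The same specification in a context with one more identifier. -/
def wkId {n : ℕ} {Γ : List Ty} (τ : Ty) (φ : Spec n Γ) : Spec n (τ :: Γ) :=
  φ.subst .var fun _ x => .var (.succ x)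

/-- `φ[E/i]` for the stack variable `i = 0`. -/
def instVal {n : ℕ} {Γ : List Ty} (φ : Spec (n + 1) Γ) (E : Exp n) : Spec n Γ :=
  φ.subst E.inst fun _ x => .var x

/-- `φ[M/x]` for the most recent identifier `x`. -/
def instId {n : ℕ} {Γ : List Ty} {τ : Ty} (φ : Spec n (τ :: Γ)) (M : Term n Γ τ) : Spec n Γ :=
  φ.subst .var M.inst

end Spec

/-! ### Contexts for fixed-point induction -/

/-- `HoleTerm σ n Γ τ`: the contexts
`C ::= [] | λ i. C | C E | λ x : τ. C | C M | fix C | C ; M` of type `τ` over `Δ | Γ` whose hole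
takes terms of type `σ` over `Δ | Γ`. -/
inductive HoleTerm (σ : Ty) : ℕ → List Ty → Ty → Type
  | hole {n : ℕ} {Γ : List Ty} : HoleTerm σ n Γ σ
  | lamVal {n : ℕ} {Γ : List Ty} {τ : Ty} (C : HoleTerm σ (n + 1) Γ τ) : HoleTerm σ n Γ (.fnVal τ)
  | appVal {n : ℕ} {Γ : List Ty} {τ : Ty} (C : HoleTerm σ n Γ (.fnVal τ)) (E : Exp n) :
      HoleTerm σ n Γ τ
  | lam {n : ℕ} {Γ : List Ty} {τ τ' : Ty} (C : HoleTerm σ n (τ :: Γ) τ') :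
      HoleTerm σ n Γ (.fn τ τ')
  | app {n : ℕ} {Γ : List Ty} {τ τ' : Ty} (C : HoleTerm σ n Γ (.fn τ τ')) (M : Term n Γ τ) :
      HoleTerm σ n Γ τ'
  | fix {n : ℕ} {Γ : List Ty} {τ : Ty} (C : HoleTerm σ n Γ (.fn τ τ)) : HoleTerm σ n Γ τ
  | seq {n : ℕ} {Γ : List Ty} (C : HoleTerm σ n Γ .com) (M : Term n Γ .com) : HoleTerm σ n Γ .com

namespace HoleTerm

variable {σ : Ty}

/-- Capture-avoiding insertion `C(N)`. -/
def fill : {n : ℕ} → {Γ : List Ty} → {τ : Ty} → HoleTerm σ n Γ τ → Term n Γ σ → Term n Γ τ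
  | _, _, _, hole, N => N
  | _, _, _, lamVal C, N => .lamVal (C.fill N.wkVal)
  | _, _, _, appVal C E, N => .appVal (C.fill N) E
  | _, _, _, lam C, N => .lam (C.fill (N.wkId _))
  | _, _, _, app C M, N => .app (C.fill N) M
  | _, _, _, fix C, N => .fix (C.fill N)
  | _, _, _, seq C M, N => .seq (C.fill N) M

/-- Substitute expressions for stack variables and rename identifiers. -/
def ren : {n : ℕ} → {Γ : List Ty} → {τ : Ty} → HoleTerm σ n Γ τ → {m : ℕ} → {Γ' : List Ty} →
    (Fin n → Exp m) → (∀ τ, Var Γ τ → Var Γ' τ) → HoleTerm σ m Γ' τ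
  | _, _, _, hole, _, _, _, _ => hole
  | _, _, _, lamVal C, _, _, s, g => lamVal (C.ren (Exp.lift s) g)
  | _, _, _, appVal C E, _, _, s, g => appVal (C.ren s g) (E.subst s)
  | _, _, _, lam C, _, _, s, g => lam (C.ren s (Term.liftRen g _))
  | _, _, _, app C M, _, _, s, g => app (C.ren s g) (M.ren s g)
  | _, _, _, fix C, _, _, s, g => fix (C.ren s g)
  | _, _, _, seq C M, _, _, s, g => seq (C.ren s g) (M.ren s g)

end HoleTerm

/-- `HoleSpec σ n Γ`: the specifications with holes
`γ ::= {P} C {Q} | γ ∧ γ | ∀ x : τ. γ | ∀ i. γ` over `Δ | Γ`. -/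
inductive HoleSpec (σ : Ty) : ℕ → List Ty → Type
  | triple {n : ℕ} {Γ : List Ty} (P : Assn n) (C : HoleTerm σ n Γ .com) (Q : Assn n) :
      HoleSpec σ n Γ
  | and {n : ℕ} {Γ : List Ty} (γ δ : HoleSpec σ n Γ) : HoleSpec σ n Γ
  | allId {n : ℕ} {Γ : List Ty} (τ : Ty) (γ : HoleSpec σ n (τ :: Γ)) : HoleSpec σ n Γ
  | allVal {n : ℕ} {Γ : List Ty} (γ : HoleSpec σ (n + 1) Γ) : HoleSpec σ n Γ

namespace HoleSpec

variable {σ : Ty}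

/-- Capture-avoiding insertion `γ(N)`. -/
def fill : {n : ℕ} → {Γ : List Ty} → HoleSpec σ n Γ → Term n Γ σ → Spec n Γ
  | _, _, triple P C Q, N => .triple P (C.fill N) Q
  | _, _, and γ δ, N => .and (γ.fill N) (δ.fill N)
  | _, _, allId τ γ, N => .allId τ (γ.fill (N.wkId τ))
  | _, _, allVal γ, N => .allVal (γ.fill N.wkVal)

/-- Substitute expressions for stack variables and rename identifiers. -/
def ren : {n : ℕ} → {Γ : List Ty} → HoleSpec σ n Γ → {m : ℕ} → {Γ' : List Ty} →
    (Fin n → Exp m) → (∀ τ, Var Γ τ → Var Γ' τ) → HoleSpec σ m Γ'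
  | _, _, triple P C Q, _, _, s, g => triple (P.subst s) (C.ren s g) (Q.subst s)
  | _, _, and γ δ, _, _, s, g => and (γ.ren s g) (δ.ren s g)
  | _, _, allId τ γ, _, _, s, g => allId τ (γ.ren s (Term.liftRen g τ))
  | _, _, allVal γ, _, _, s, g => allVal (γ.ren (Exp.lift s) g)

/-- The same `γ` in a context with one more identifier. -/
def wkId {n : ℕ} {Γ : List Ty} (τ : Ty) (γ : HoleSpec σ n Γ) : HoleSpec σ n (τ :: Γ) :=
  γ.ren .var fun _ x => .succ x

end HoleSpec

/-! ### Proof rules -/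

/-- Judgments `Δ | Γ; Φ ⊢ φ` with a list `Φ` of assumptions. -/
structure Judgment : Type where
  n : ℕ
  Γ : List Ty
  hyps : List (Spec n Γ)
  concl : Spec n Γ

/-- A judgment is valid if its conclusion holds at all `(ρ, η₀, η₁, r)` that satisfy the
assumptions. -/
def Judgment.Valid (J : Judgment) : Prop :=
  ∀ (ρ : StackEnv J.n) (η₀ η₁ : IdEnv J.Γ) (r : World),
    (∀ ψ ∈ J.hyps, ψ.Sat ρ η₀ η₁ r) → J.concl.Sat ρ η₀ η₁ r

/-- The axioms for Hoare triples, for invariant extension and for fixed-point induction. -/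
inductive Axm : {n : ℕ} → {Γ : List Ty} → Spec n Γ → Prop
  -- Hoare triples
  | ex {n : ℕ} {Γ : List Ty} (P Q : Assn (n + 1)) (M : Term n Γ .com) :
      Axm (.imp (.allVal (.triple P M.wkVal Q)) (.triple (.ex P) M (.ex Q)))
  | disj {n : ℕ} {Γ : List Ty} (P P' Q Q' : Assn n) (M : Term n Γ .com) :
      Axm (.imp (.and (.triple P M Q) (.triple P' M Q')) (.triple (P.or P') M (Q.or Q')))
  | ite {n : ℕ} {Γ : List Ty} (P Q : Assn n) (E F : Exp n) (M N : Term n Γ .com) :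
      Axm (.imp
        (.and (.triple (.and P (.eq E F)) M Q) (.triple (.and P (.not (.eq E F))) N Q))
        (.triple P (.ite E F M N) Q))
  | seq {n : ℕ} {Γ : List Ty} (P P₀ Q : Assn n) (M N : Term n Γ .com) :
      Axm (.imp (.and (.triple P M P₀) (.triple P₀ N Q)) (.triple P (.seq M N) Q))
  | letNew {n : ℕ} {Γ : List Ty} (P Q : Assn n) (M : Term (n + 1) Γ .com) :
      Axm (.imp
        (.allVal (.triple (.star P.wk (.pts (.var 0) .zero .zero)) M Q.wk))
        (.triple P (.letNew M) Q))
  | letGet {n : ℕ} {Γ : List Ty} (f : Fin 2) (P : Assn (n + 1)) (E : Exp n) (E₁ : Exp (n + 1))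
      (Q : Assn n) (M : Term (n + 1) Γ .com) :
      Axm (.imp
        (.allVal (.triple (.star P (.ptsAt f E.wk (.var 0) E₁)) M Q.wk))
        (.triple (.ex (.star P (.ptsAt f E.wk (.var 0) E₁))) (.letGet E f M) Q))
  | free {n : ℕ} {Γ : List Ty} (E : Exp n) :
      Axm (.triple (.ptsAny E) (.free E : Term n Γ .com) .emp)
  | put {n : ℕ} {Γ : List Ty} (f : Fin 2) (E E₁ F : Exp n) :
      Axm (.triple (.ptsAnyAt f E E₁) (.put E f F : Term n Γ .com) (.ptsAt f E F E₁))
  | conseq {n : ℕ} {Γ : List Ty} (P P' Q Q' : Assn n) (M : Term n Γ .com)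
      (hP : ∀ ρ, P.den ρ ⊆ P'.den ρ) (hQ : ∀ ρ, Q'.den ρ ⊆ Q.den ρ) :
      Axm (.imp (.triple P' M Q') (.triple P M Q))
  -- invariant extension
  | frame {n : ℕ} {Γ : List Ty} (φ : Spec n Γ) (P : Assn n) : Axm (.imp φ (.inv φ P))
  | invTriple {n : ℕ} {Γ : List Ty} (P P' Q : Assn n) (M : Term n Γ .com) :
      Axm (.iff (.inv (.triple P M P') Q) (.triple (.star P Q) M (.star P' Q)))
  | invEqVal {n : ℕ} {Γ : List Ty} (E F : Exp n) (Q : Assn n) :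
      Axm (.iff (.inv (.eqVal E F) Q) (.eqVal E F : Spec n Γ))
  | invEqTerm {n : ℕ} {Γ : List Ty} {τ : Ty} (M N : Term n Γ τ) (Q : Assn n) :
      Axm (.iff (.inv (.eqTerm M N) Q) (.eqTerm M N))
  | invInv {n : ℕ} {Γ : List Ty} (φ : Spec n Γ) (P Q : Assn n) :
      Axm (.iff (.inv (.inv φ P) Q) (.inv φ (.star P Q)))
  | invImp {n : ℕ} {Γ : List Ty} (φ ψ : Spec n Γ) (P : Assn n) :
      Axm (.iff (.inv (.imp φ ψ) P) (.imp (.inv φ P) (.inv ψ P)))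
  | invAnd {n : ℕ} {Γ : List Ty} (φ ψ : Spec n Γ) (P : Assn n) :
      Axm (.iff (.inv (.and φ ψ) P) (.and (.inv φ P) (.inv ψ P)))
  | invOr {n : ℕ} {Γ : List Ty} (φ ψ : Spec n Γ) (P : Assn n) :
      Axm (.iff (.inv (.or φ ψ) P) (.or (.inv φ P) (.inv ψ P)))
  | invAllId {n : ℕ} {Γ : List Ty} (τ : Ty) (φ : Spec n (τ :: Γ)) (P : Assn n) :
      Axm (.iff (.inv (.allId τ φ) P) (.allId τ (.inv φ P)))
  | invExId {n : ℕ} {Γ : List Ty} (τ : Ty) (φ : Spec n (τ :: Γ)) (P : Assn n) :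
      Axm (.iff (.inv (.exId τ φ) P) (.exId τ (.inv φ P)))
  | invAllVal {n : ℕ} {Γ : List Ty} (φ : Spec (n + 1) Γ) (P : Assn n) :
      Axm (.iff (.inv (.allVal φ) P) (.allVal (.inv φ P.wk)))
  | invExVal {n : ℕ} {Γ : List Ty} (φ : Spec (n + 1) Γ) (P : Assn n) :
      Axm (.iff (.inv (.exVal φ) P) (.exVal (.inv φ P.wk)))
  -- fixed-point induction
  | fixInd {n : ℕ} {Γ : List Ty} {σ : Ty} (γ : HoleSpec σ n Γ) (M : Term n Γ (.fn σ σ)) :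
      Axm (.imp
        (.allId σ (.imp ((γ.wkId σ).fill (.var .zero))
          ((γ.wkId σ).fill (.app (M.wkId σ) (.var .zero)))))
        (γ.fill (.fix M)))

/-- The instances of the proof rules: `Rule Js J` says that some rule derives the judgment `J` from
the premises `Js`. -/
inductive Rule : List Judgment → Judgment → Prop
  | axm {n : ℕ} {Γ : List Ty} {Φ : List (Spec n Γ)} {φ : Spec n Γ} (h : Axm φ) :
      Rule [] ⟨n, Γ, Φ, φ⟩
  -- intuitionistic first-order logic
  | hyp {n : ℕ} {Γ : List Ty} {Φ : List (Spec n Γ)} {φ : Spec n Γ} (h : φ ∈ Φ) :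
      Rule [] ⟨n, Γ, Φ, φ⟩
  | andI {n : ℕ} {Γ : List Ty} {Φ : List (Spec n Γ)} {φ ψ : Spec n Γ} :
      Rule [⟨n, Γ, Φ, φ⟩, ⟨n, Γ, Φ, ψ⟩] ⟨n, Γ, Φ, .and φ ψ⟩
  | andE₁ {n : ℕ} {Γ : List Ty} {Φ : List (Spec n Γ)} {φ ψ : Spec n Γ} :
      Rule [⟨n, Γ, Φ, .and φ ψ⟩] ⟨n, Γ, Φ, φ⟩
  | andE₂ {n : ℕ} {Γ : List Ty} {Φ : List (Spec n Γ)} {φ ψ : Spec n Γ} :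
      Rule [⟨n, Γ, Φ, .and φ ψ⟩] ⟨n, Γ, Φ, ψ⟩
  | orI₁ {n : ℕ} {Γ : List Ty} {Φ : List (Spec n Γ)} {φ ψ : Spec n Γ} :
      Rule [⟨n, Γ, Φ, φ⟩] ⟨n, Γ, Φ, .or φ ψ⟩
  | orI₂ {n : ℕ} {Γ : List Ty} {Φ : List (Spec n Γ)} {φ ψ : Spec n Γ} :
      Rule [⟨n, Γ, Φ, ψ⟩] ⟨n, Γ, Φ, .or φ ψ⟩
  | orE {n : ℕ} {Γ : List Ty} {Φ : List (Spec n Γ)} {φ ψ χ : Spec n Γ} :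
      Rule [⟨n, Γ, Φ, .or φ ψ⟩, ⟨n, Γ, φ :: Φ, χ⟩, ⟨n, Γ, ψ :: Φ, χ⟩] ⟨n, Γ, Φ, χ⟩
  | impI {n : ℕ} {Γ : List Ty} {Φ : List (Spec n Γ)} {φ ψ : Spec n Γ} :
      Rule [⟨n, Γ, φ :: Φ, ψ⟩] ⟨n, Γ, Φ, .imp φ ψ⟩
  | impE {n : ℕ} {Γ : List Ty} {Φ : List (Spec n Γ)} {φ ψ : Spec n Γ} :
      Rule [⟨n, Γ, Φ, .imp φ ψ⟩, ⟨n, Γ, Φ, φ⟩] ⟨n, Γ, Φ, ψ⟩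
  /-- Falsity is not in the grammar; `0 = 1` plays its role. -/
  | falseE {n : ℕ} {Γ : List Ty} {Φ : List (Spec n Γ)} {φ : Spec n Γ} :
      Rule [⟨n, Γ, Φ, .eqVal .zero .one⟩] ⟨n, Γ, Φ, φ⟩
  | allIdI {n : ℕ} {Γ : List Ty} {Φ : List (Spec n Γ)} {τ : Ty} {φ : Spec n (τ :: Γ)} :
      Rule [⟨n, τ :: Γ, Φ.map (Spec.wkId τ), φ⟩] ⟨n, Γ, Φ, .allId τ φ⟩
  | allIdE {n : ℕ} {Γ : List Ty} {Φ : List (Spec n Γ)} {τ : Ty} {φ : Spec n (τ :: Γ)}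
      (M : Term n Γ τ) :
      Rule [⟨n, Γ, Φ, .allId τ φ⟩] ⟨n, Γ, Φ, φ.instId M⟩
  | exIdI {n : ℕ} {Γ : List Ty} {Φ : List (Spec n Γ)} {τ : Ty} {φ : Spec n (τ :: Γ)}
      (M : Term n Γ τ) :
      Rule [⟨n, Γ, Φ, φ.instId M⟩] ⟨n, Γ, Φ, .exId τ φ⟩
  | exIdE {n : ℕ} {Γ : List Ty} {Φ : List (Spec n Γ)} {τ : Ty} {φ : Spec n (τ :: Γ)}
      {χ : Spec n Γ} :
      Rule [⟨n, Γ, Φ, .exId τ φ⟩, ⟨n, τ :: Γ, φ :: Φ.map (Spec.wkId τ), χ.wkId τ⟩] ⟨n, Γ, Φ, χ⟩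
  | allValI {n : ℕ} {Γ : List Ty} {Φ : List (Spec n Γ)} {φ : Spec (n + 1) Γ} :
      Rule [⟨n + 1, Γ, Φ.map Spec.wkVal, φ⟩] ⟨n, Γ, Φ, .allVal φ⟩
  | allValE {n : ℕ} {Γ : List Ty} {Φ : List (Spec n Γ)} {φ : Spec (n + 1) Γ} (E : Exp n) :
      Rule [⟨n, Γ, Φ, .allVal φ⟩] ⟨n, Γ, Φ, φ.instVal E⟩
  | exValI {n : ℕ} {Γ : List Ty} {Φ : List (Spec n Γ)} {φ : Spec (n + 1) Γ} (E : Exp n) :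
      Rule [⟨n, Γ, Φ, φ.instVal E⟩] ⟨n, Γ, Φ, .exVal φ⟩
  | exValE {n : ℕ} {Γ : List Ty} {Φ : List (Spec n Γ)} {φ : Spec (n + 1) Γ} {χ : Spec n Γ} :
      Rule [⟨n, Γ, Φ, .exVal φ⟩, ⟨n + 1, Γ, φ :: Φ.map Spec.wkVal, χ.wkVal⟩] ⟨n, Γ, Φ, χ⟩
  -- equality
  | eqValI {n : ℕ} {Γ : List Ty} {Φ : List (Spec n Γ)} (E : Exp n) :
      Rule [] ⟨n, Γ, Φ, .eqVal E E⟩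
  | eqValE {n : ℕ} {Γ : List Ty} {Φ : List (Spec n Γ)} {E F : Exp n} (φ : Spec (n + 1) Γ) :
      Rule [⟨n, Γ, Φ, .eqVal E F⟩, ⟨n, Γ, Φ, φ.instVal E⟩] ⟨n, Γ, Φ, φ.instVal F⟩
  | eqTermI {n : ℕ} {Γ : List Ty} {Φ : List (Spec n Γ)} {τ : Ty} (M : Term n Γ τ) :
      Rule [] ⟨n, Γ, Φ, .eqTerm M M⟩
  | eqTermE {n : ℕ} {Γ : List Ty} {Φ : List (Spec n Γ)} {τ : Ty} {M N : Term n Γ τ}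
      (φ : Spec n (τ :: Γ)) :
      Rule [⟨n, Γ, Φ, .eqTerm M N⟩, ⟨n, Γ, Φ, φ.instId M⟩] ⟨n, Γ, Φ, φ.instId N⟩

end RelSep

end

namespace RelSep

/-! ### Heaps -/

namespace Heap

/-! The specifications form a Kripke model. Its worlds are relations on heaps, and these are a
commutative monoid under `*` with unit `eq(emp)`. Everything rests on this monoid and on three
further facts.

Monotonicity (`Spec.Sat.mono`). A quadruple already quantifies over all frames, so it survives
multiplying both its relations by a world. An implication already quantifies over all extensions.
Hence whatever holds at `r` holds at `r * s`. This gives `φ ⇒ φ ⊗ P` and implication introduction.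
Modus ponens is the instance of implication at the unit. The distribution laws for `⊗` are then
associativity and commutativity of `*`, or hold by definition.

Substitution (`Spec.sat_subst`). Satisfaction of a substituted specification is satisfaction in the
substituted environments. This carries the quantifier and equality rules. It needs the same
statement for expressions, assertions and terms, and for terms a separate renaming lemma first.

Locality. Two heaps related by `eq(P) * r * t` contain one common fragment `g` in `P`, next to
remainders related by `r * t`. Both runs share the stack, and the accessed cells lie in `g`, so both
take the same branch, read the same value and change the fragment in the same way, and the
remainders stay related. Allocation in addition picks one location that is fresh for both runs.
Sequencing is immediate in continuation-passing style: the triple for `N` says that the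
continuations passed to `M` are related.

Fixed-point induction is Scott induction on pairs. A context is interpreted as a continuous function
of the value in its hole; it is strict because the grammar only allows the hole in positions that
propagate `⊥`. Quadruples hold for `⊥` and are closed under least upper bounds of chains, since
`eq(G)` on observations is. So the two iterations, one for each environment, can be followed in
parallel at a fixed world. -/

theorem union_comm {h g : Heap} (hd : Disj h g) : h.union g = g.union h := by
  ext1; funext l
  show (h.cell l).or (g.cell l) = (g.cell l).or (h.cell l)
  rcases hd l with hl | hl <;> rw [hl] <;> simp

theorem union_assoc (h g k : Heap) : (h.union g).union k = h.union (g.union k) := by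
  ext1; funext l
  exact Option.or_assoc

theorem union_empty (h : Heap) : h.union empty = h := by
  ext1; funext l
  exact Option.or_none

theorem disj_empty (h : Heap) : Disj h empty := fun _ => Or.inr rfl

theorem Disj.symm {h g : Heap} (hd : Disj h g) : Disj g h := fun l => (hd l).symm

theorem disj_union_left {h g k : Heap} : Disj (h.union g) k ↔ Disj h k ∧ Disj g k := by
  simp only [Disj, union, Option.or_eq_none_iff, ← forall_and]
  exact forall_congr' fun l => by tauto

theorem disj_union_right {h g k : Heap} : Disj h (g.union k) ↔ Disj h g ∧ Disj h k := by
  simp only [Disj, union, Option.or_eq_none_iff, ← forall_and]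
  exact forall_congr' fun l => by tauto

theorem Split.symm {h n m : Heap} (hs : Split h n m) : Split h m n :=
  ⟨hs.1.symm, by rw [← union_comm hs.1, hs.2]⟩

/-- The part `b` moves from the left summand to the right one. This drives associativity of `*` on
worlds and exposes a single cell of a fragment inside the whole heap. -/
theorem Split.assoc {h n m a b : Heap} (hs : Split h n m) (hn : Split n a b) :
    Split h a (b.union m) ∧ Split (b.union m) b m := by
  obtain ⟨hd, rfl⟩ := hs
  obtain ⟨hd', rfl⟩ := hn
  rw [disj_union_left] at hd
  exact ⟨⟨disj_union_right.2 ⟨hd', hd.1⟩, (union_assoc _ _ _).symm⟩, hd.2, rfl⟩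

theorem single_cell (l : Loc) (v : Val × Val) : (single l v).cell l = some v := by
  simp [single, set]

theorem single_cell_of_ne {l x : Loc} (h : x ≠ l) (v : Val × Val) :
    (single l v).cell x = none := by
  simp [single, set, empty, h]

theorem disj_single {h : Heap} {l : Loc} {v : Val × Val} :
    Disj h (single l v) ↔ h.cell l = none := by
  constructor
  · intro hd
    rcases hd l with h1 | h1
    · exact h1
    · rw [single_cell] at h1; cases h1
  · intro hl x
    by_cases hx : x = l
    · exact Or.inl (hx ▸ hl)
    · exact Or.inr (single_cell_of_ne hx v)

/-- Locality of the heap operations, with the two lemmas that follow: lookup, disposal and update at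
`l` see and change only the one-cell fragment, because `m` is undefined at `l`. -/
theorem Split.cell_single {h m : Heap} {l : Loc} {v : Val × Val} (hs : Split h (single l v) m) :
    h.cell l = some v := by
  rw [← hs.2]
  show ((single l v).cell l).or (m.cell l) = some v
  rw [single_cell]; rfl

theorem Split.erase_single {h m : Heap} {l : Loc} {v : Val × Val}
    (hs : Split h (single l v) m) : h.erase l = m := by
  have hm := disj_single.1 hs.1.symm
  rw [← hs.2]
  ext1; funext x
  by_cases hx : x = l
  · subst hx; simp [erase, hm]
  · simp [erase, hx, union, single_cell_of_ne hx]

theorem Split.set_single {h m : Heap} {l : Loc} {v : Val × Val}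
    (hs : Split h (single l v) m) (w : Val × Val) : Split (h.set l w) (single l w) m := by
  have hm := disj_single.1 hs.1.symm
  refine ⟨(disj_single.2 hm).symm, ?_⟩
  rw [← hs.2]
  ext1; funext x
  by_cases hx : x = l
  · subst hx; simp [set, union, single_cell]
  · simp [set, hx, union, single_cell_of_ne hx]

end Heap

/-! ### Worlds -/

namespace World

theorem star_comm (r s : World) : r.star s = s.star r := by
  have key : ∀ (r s : World) h₀ h₁, (r.star s).rel h₀ h₁ → (s.star r).rel h₀ h₁ := by
    rintro r s h₀ h₁ ⟨n₀, m₀, n₁, m₁, s₀, s₁, hr, hs⟩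
    exact ⟨m₀, n₀, m₁, n₁, s₀.symm, s₁.symm, hs, hr⟩
  ext h₀ h₁
  exact ⟨key r s h₀ h₁, key s r h₀ h₁⟩

theorem star_assoc (r s t : World) : (r.star s).star t = r.star (s.star t) := by
  have key : ∀ (r s t : World) h₀ h₁,
      ((r.star s).star t).rel h₀ h₁ → (r.star (s.star t)).rel h₀ h₁ := by
    rintro r s t h₀ h₁ ⟨n₀, m₀, n₁, m₁, s₀, s₁, ⟨a₀, b₀, a₁, b₁, u₀, u₁, hr, hs⟩, ht⟩
    exact ⟨_, _, _, _, (s₀.assoc u₀).1, (s₁.assoc u₁).1, hr,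
      _, _, _, _, (s₀.assoc u₀).2, (s₁.assoc u₁).2, hs, ht⟩
  ext h₀ h₁
  refine ⟨key r s t h₀ h₁, fun h => ?_⟩
  -- The converse inclusion is the first one read backwards: commuting every product turns `r * (s *
  -- t)` into `(t * s) * r`.
  rw [star_comm r, star_comm s] at h
  rw [star_comm, star_comm r]
  exact key t s r h₀ h₁ h

theorem star_eqAssn_emp {n : ℕ} (r : World) (ρ : StackEnv n) : r.star (eqAssn .emp ρ) = r := by
  ext h₀ h₁
  constructor
  · rintro ⟨n₀, m₀, n₁, m₁, s₀, s₁, hr, rfl, hm⟩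
    cases (hm : m₀ = Heap.empty)
    rw [← s₀.2, ← s₁.2, Heap.union_empty, Heap.union_empty]
    exact hr
  · intro h
    exact ⟨h₀, .empty, h₁, .empty, ⟨Heap.disj_empty _, Heap.union_empty _⟩,
      ⟨Heap.disj_empty _, Heap.union_empty _⟩, h, rfl, rfl⟩

/-- Kripke implication speaks of extensions `r * s` only, so reaching `r` itself needs a unit. The
empty stack context supplies one that does not depend on any environment. -/
theorem exists_star_unit : ∃ u : World, ∀ r : World, r.star u = r :=
  ⟨eqAssn .emp (Fin.elim0 : StackEnv 0), fun r => star_eqAssn_emp r _⟩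

/-- Equal fragments on the two sides have equal unions, so a product of partial identities is again
a partial identity. -/
theorem eqAssn_star {n : ℕ} (P Q : Assn n) (ρ : StackEnv n) :
    eqAssn (.star P Q) ρ = (eqAssn P ρ).star (eqAssn Q ρ) := by
  ext h₀ h₁
  constructor
  · rintro ⟨rfl, n, hn, m, hm, hs⟩
    exact ⟨n, m, n, m, hs, hs, ⟨rfl, hn⟩, rfl, hm⟩
  · rintro ⟨n₀, m₀, n₁, m₁, s₀, s₁, ⟨rfl, hn⟩, rfl, hm⟩
    exact ⟨s₀.2.symm.trans s₁.2, _, hn, _, hm, s₀⟩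

theorem star_mono {r r' s : World} (h : ∀ h₀ h₁, r.rel h₀ h₁ → r'.rel h₀ h₁) {h₀ h₁ : Heap}
    (hr : (r.star s).rel h₀ h₁) : (r'.star s).rel h₀ h₁ := by
  obtain ⟨n₀, m₀, n₁, m₁, s₀, s₁, hr, hs⟩ := hr
  exact ⟨n₀, m₀, n₁, m₁, s₀, s₁, h _ _ hr, hs⟩

/-- The two assertions may live in different contexts, which lets the congruence derived from it
cover weakening and substitution. -/
theorem eqAssn_mono {n m : ℕ} {P : Assn n} {Q : Assn m} {ρ : StackEnv n} {ρ' : StackEnv m}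
    (h : P.den ρ ⊆ Q.den ρ') {h₀ h₁ : Heap} (hr : (eqAssn P ρ).rel h₀ h₁) :
    (eqAssn Q ρ').rel h₀ h₁ := ⟨hr.1, h hr.2⟩

theorem eqAssn_congr {n m : ℕ} {P : Assn n} {Q : Assn m} {ρ : StackEnv n} {ρ' : StackEnv m}
    (h : P.den ρ = Q.den ρ') : eqAssn P ρ = eqAssn Q ρ' := by
  ext h₀ h₁
  exact ⟨eqAssn_mono h.le, eqAssn_mono h.ge⟩

end World

/-! ### Quadruples -/

theorem ContRel.mono {r r' : World} {k₀ k₁ : Cont} (h : ∀ h₀ h₁, r.rel h₀ h₁ → r'.rel h₀ h₁)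
    (hk : ContRel r' k₀ k₁) : ContRel r k₀ k₁ := fun h₀ h₁ hr => hk h₀ h₁ (h h₀ h₁ hr)

/-- The frame property is built into the quadruple: for a frame `r'` of the conclusion, the
hypothesis is used with the frame `t * r'`. -/
theorem Quad.frame {r s : World} {c₀ c₁ : Com} (h : Quad r c₀ c₁ s) (t : World) :
    Quad (r.star t) c₀ c₁ (s.star t) := by
  intro r' h₀ h₁ k₀ k₁ hr hk
  rw [World.star_assoc] at hr hk
  exact h _ h₀ h₁ k₀ k₁ hr hk

/-- A quadruple for a framed assertion holds if, for every frame, the commands are related on the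
heaps that split into a common part in the precondition and frame-related rest. -/
theorem Quad.of_split {n : ℕ} {P : Assn n} {ρ : StackEnv n} {c₀ c₁ : Com} {r s : World}
    (h : ∀ (t : World) (g m₀ m₁ h₀ h₁ : Heap) (k₀ k₁ : Cont), g ∈ P.den ρ →
      (r.star t).rel m₀ m₁ → h₀.Split g m₀ → h₁.Split g m₁ →
      ContRel (s.star (r.star t)) k₀ k₁ → EqGood (c₀ (h₀, k₀)) (c₁ (h₁, k₁))) :
    Quad ((World.eqAssn P ρ).star r) c₀ c₁ (s.star r) := by
  intro t h₀ h₁ k₀ k₁ hr hk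
  rw [World.star_assoc] at hr hk
  obtain ⟨g, m₀, _, m₁, s₀, s₁, ⟨rfl, hg⟩, hm⟩ := hr
  exact h t g m₀ m₁ h₀ h₁ k₀ k₁ hg hm s₀ s₁ hk

/-- The use of a quadruple on heaps that split as in its precondition. -/
theorem Quad.apply_split {n : ℕ} {P : Assn n} {ρ : StackEnv n} {c₀ c₁ : Com} {r s t : World}
    (h : Quad ((World.eqAssn P ρ).star r) c₀ c₁ (s.star r)) {g m₀ m₁ h₀ h₁ : Heap} {k₀ k₁ : Cont}
    (hg : g ∈ P.den ρ) (hm : (r.star t).rel m₀ m₁) (s₀ : h₀.Split g m₀) (s₁ : h₁.Split g m₁)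
    (hk : ContRel (s.star (r.star t)) k₀ k₁) : EqGood (c₀ (h₀, k₀)) (c₁ (h₁, k₁)) := by
  refine h t h₀ h₁ k₀ k₁ ?_ ?_
  · rw [World.star_assoc]
    exact ⟨g, m₀, g, m₁, s₀, s₁, ⟨rfl, hg⟩, hm⟩
  · rwa [World.star_assoc]

/-! ### Substitution -/

namespace Exp

/-- The source environment is constrained by the values of `s` instead of being computed from them.
Weakening and instantiation then satisfy the hypothesis almost by definition, and binders only
require extending both environments by the same value. All later substitution lemmas have this form.
-/
theorem eval_subst {n m : ℕ} {s : Fin n → Exp m} {ρ : StackEnv n} {ρ' : StackEnv m}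
    (hρ : ∀ i, ρ i = (s i).eval ρ') (E : Exp n) : (E.subst s).eval ρ' = E.eval ρ := by
  induction E with
  | var i => exact (hρ i).symm
  | zero => rfl
  | one => rfl
  | negOne => rfl
  | add E F hE hF => simp only [subst, eval, hE, hF]
  | sub E F hE hF => simp only [subst, eval, hE, hF]

theorem eval_wk {n : ℕ} (E : Exp n) (ρ : StackEnv n) (v : Val) : E.wk.eval (ρ.ext v) = E.eval ρ :=
  eval_subst (fun _ => rfl) E

theorem ext_eval_lift {n m : ℕ} {s : Fin n → Exp m} {ρ : StackEnv n} {ρ' : StackEnv m}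
    (hρ : ∀ i, ρ i = (s i).eval ρ') (v : Val) (i : Fin (n + 1)) :
    ρ.ext v i = (lift s i).eval (ρ'.ext v) := by
  refine Fin.cases rfl (fun i => ?_) i
  show ρ i = (s i).wk.eval (ρ'.ext v)
  rw [eval_wk, hρ]

theorem ext_eval_inst {n : ℕ} (E : Exp n) (ρ : StackEnv n) (i : Fin (n + 1)) :
    ρ.ext (E.eval ρ) i = (E.inst i).eval ρ := by
  refine Fin.cases rfl (fun i => rfl) i

end Exp

namespace Assn

theorem den_subst {n : ℕ} (P : Assn n) : ∀ {m : ℕ} {s : Fin n → Exp m} {ρ : StackEnv n}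
    {ρ' : StackEnv m}, (∀ i, ρ i = (s i).eval ρ') → (P.subst s).den ρ' = P.den ρ := by
  induction P with
  | eq E F => intro m s ρ ρ' hρ; simp only [subst, den, Exp.eval_subst hρ]
  | le E F => intro m s ρ ρ' hρ; simp only [subst, den, Exp.eval_subst hρ]
  | pts E E₀ E₁ => intro m s ρ ρ' hρ; simp only [subst, den, Exp.eval_subst hρ]
  | emp => intro m s ρ ρ' hρ; rfl
  | star P Q hP hQ => intro m s ρ ρ' hρ; simp only [subst, den, hP hρ, hQ hρ]
  | and P Q hP hQ => intro m s ρ ρ' hρ; simp only [subst, den, hP hρ, hQ hρ]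
  | not P hP => intro m s ρ ρ' hρ; simp only [subst, den, hP hρ]
  | ex P hP =>
    intro m s ρ ρ' hρ
    simp only [subst, den, hP (Exp.ext_eval_lift hρ _)]

theorem den_wk {n : ℕ} (P : Assn n) (ρ : StackEnv n) (v : Val) : P.wk.den (ρ.ext v) = P.den ρ :=
  den_subst P fun _ => rfl

theorem den_or {n : ℕ} (P Q : Assn n) (ρ : StackEnv n) :
    (P.or Q).den ρ = P.den ρ ∪ Q.den ρ := by
  show ((P.den ρ)ᶜ ∩ (Q.den ρ)ᶜ)ᶜ = _
  rw [← Set.compl_union, compl_compl]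

end Assn

theorem World.eqAssn_subst {n m : ℕ} (P : Assn n) {s : Fin n → Exp m} {ρ : StackEnv n}
    {ρ' : StackEnv m} (hρ : ∀ i, ρ i = (s i).eval ρ') :
    World.eqAssn (P.subst s) ρ' = World.eqAssn P ρ :=
  World.eqAssn_congr (P.den_subst hρ)

theorem World.eqAssn_wk {n : ℕ} (P : Assn n) (ρ : StackEnv n) (v : Val) :
    World.eqAssn P.wk (ρ.ext v) = World.eqAssn P ρ :=
  World.eqAssn_congr (P.den_wk ρ v)

/-! ### Commands: evaluation and dependence on the environment -/

namespace Com

variable {n m : ℕ} {Γ Γ' : List Ty}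

theorem ext_run {c d : Com} (h : ∀ h k, c (h, k) = d (h, k)) : c = d :=
  FMFun.ext (funext fun p => h p.1 p.2)

/-- The set `L` is a finite support of all the arguments. Excluding only finitely many locations
leaves room to choose one that serves several runs and avoids given heaps. -/
theorem letNew_apply (M : FMHom (Env (n + 1) Γ) Com) (ρ : StackEnv n) (η : IdEnv Γ) (h : Heap)
    (k : Cont) : ∃ L : Finset Loc, ∀ l ∉ L, letNew M (ρ, η) (h, k) =
      M (ρ.ext (.loc l), η) (h.union (.single l (.int 0, .int 0)), k) := by
  obtain ⟨L, hL⟩ := FMCpo.exists_support (((ρ, η), (h, k)) : Args n Γ)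
  exact ⟨L, fun l hl => newAt_fresh M hL hl⟩

/-- The two sides have different arguments and so may select different fresh locations; a location
outside both supports can replace both choices. -/
theorem letNew_congr {M : FMHom (Env (n + 1) Γ) Com} {N : FMHom (Env (m + 1) Γ') Com}
    {ρ : StackEnv n} {η : IdEnv Γ} {ρ' : StackEnv m} {η' : IdEnv Γ'}
    (h : ∀ v, M (ρ.ext v, η) = N (ρ'.ext v, η')) : letNew M (ρ, η) = letNew N (ρ', η') := by
  refine ext_run fun g k => ?_
  obtain ⟨L, hL⟩ := letNew_apply M ρ η g k
  obtain ⟨L', hL'⟩ := letNew_apply N ρ' η' g k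
  obtain ⟨l, hl⟩ := Infinite.exists_notMem_finset (L ∪ L')
  rw [Finset.mem_union, not_or] at hl
  rw [hL l hl.1, hL' l hl.2, h]

theorem free_apply {E : Exp n} {ρ : StackEnv n} {η : IdEnv Γ} {h : Heap} {k : Cont} {l : Loc}
    {v : Val × Val} (hE : E.eval ρ = .loc l) (hl : h.cell l = some v) :
    free E (ρ, η) (h, k) = k (h.erase l) := by
  show (match E.eval ρ with
    | .loc l => match h.cell l with
      | some v => k (h.erase l)
      | none => .err
    | _ => .err : Obs) = _
  simp only [hE, hl]

theorem letGet_apply {E : Exp n} {f : Fin 2} {M : FMHom (Env (n + 1) Γ) Com} {ρ : StackEnv n}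
    {η : IdEnv Γ} {h : Heap} {k : Cont} {l : Loc} {v : Val × Val} (hE : E.eval ρ = .loc l)
    (hl : h.cell l = some v) :
    letGet E f M (ρ, η) (h, k) = M (ρ.ext (getField f v), η) (h, k) := by
  show (match E.eval ρ with
    | .loc l => match h.cell l with
      | some v => M (ρ.ext (getField f v), η) (h, k)
      | none => .err
    | _ => .err : Obs) = _
  simp only [hE, hl]

theorem put_apply {E : Exp n} {f : Fin 2} {F : Exp n} {ρ : StackEnv n} {η : IdEnv Γ} {h : Heap}
    {k : Cont} {l : Loc} {v : Val × Val} (hE : E.eval ρ = .loc l) (hl : h.cell l = some v) :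
    put E f F (ρ, η) (h, k) = k (h.set l (setField f v (F.eval ρ))) := by
  show (match E.eval ρ with
    | .loc l => match h.cell l with
      | some v => k (h.set l (setField f v (F.eval ρ)))
      | none => .err
    | _ => .err : Obs) = _
  simp only [hE, hl]

theorem free_congr {E : Exp n} {F : Exp m} {ρ : StackEnv n} {η : IdEnv Γ} {ρ' : StackEnv m}
    {η' : IdEnv Γ'} (h : E.eval ρ = F.eval ρ') : free E (ρ, η) = free F (ρ', η') := by
  refine ext_run fun g k => ?_
  show (match E.eval ρ with
    | .loc l => match g.cell l with
      | some v => k (g.erase l)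
      | none => .err
    | _ => .err : Obs) = (match F.eval ρ' with
    | .loc l => match g.cell l with
      | some v => k (g.erase l)
      | none => .err
    | _ => .err : Obs)
  rw [h]

theorem letGet_congr {E : Exp n} {F : Exp m} {f : Fin 2} {M : FMHom (Env (n + 1) Γ) Com}
    {N : FMHom (Env (m + 1) Γ') Com} {ρ : StackEnv n} {η : IdEnv Γ} {ρ' : StackEnv m}
    {η' : IdEnv Γ'} (h : E.eval ρ = F.eval ρ') (hM : ∀ v, M (ρ.ext v, η) = N (ρ'.ext v, η')) :
    letGet E f M (ρ, η) = letGet F f N (ρ', η') := by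
  refine ext_run fun g k => ?_
  show (match E.eval ρ with
    | .loc l => match g.cell l with
      | some v => M (ρ.ext (getField f v), η) (g, k)
      | none => .err
    | _ => .err : Obs) = (match F.eval ρ' with
    | .loc l => match g.cell l with
      | some v => N (ρ'.ext (getField f v), η') (g, k)
      | none => .err
    | _ => .err : Obs)
  simp only [h, hM]

theorem put_congr {E F : Exp n} {E' F' : Exp m} {f : Fin 2} {ρ : StackEnv n} {η : IdEnv Γ}
    {ρ' : StackEnv m} {η' : IdEnv Γ'} (hE : E.eval ρ = E'.eval ρ') (hF : F.eval ρ = F'.eval ρ') :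
    put E f F (ρ, η) = put E' f F' (ρ', η') := by
  refine ext_run fun g k => ?_
  show (match E.eval ρ with
    | .loc l => match g.cell l with
      | some v => k (g.set l (setField f v (F.eval ρ)))
      | none => .err
    | _ => .err : Obs) = (match E'.eval ρ' with
    | .loc l => match g.cell l with
      | some v => k (g.set l (setField f v (F'.eval ρ')))
      | none => .err
    | _ => .err : Obs)
  rw [hE, hF]

theorem ite_congr {E F : Exp n} {E' F' : Exp m} {M N : FMHom (Env n Γ) Com}
    {M' N' : FMHom (Env m Γ') Com} {ρ : StackEnv n} {η : IdEnv Γ} {ρ' : StackEnv m}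
    {η' : IdEnv Γ'} (hE : E.eval ρ = E'.eval ρ') (hF : F.eval ρ = F'.eval ρ')
    (hM : M (ρ, η) = M' (ρ', η')) (hN : N (ρ, η) = N' (ρ', η')) :
    ite E F M N (ρ, η) = ite E' F' M' N' (ρ', η') := by
  show (if E.eval ρ = F.eval ρ then M (ρ, η) else N (ρ, η)) =
    if E'.eval ρ' = F'.eval ρ' then M' (ρ', η') else N' (ρ', η')
  rw [hE, hF, hM, hN]

theorem seq_congr {M N : FMHom (Env n Γ) Com} {M' N' : FMHom (Env m Γ') Com} {ρ : StackEnv n}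
    {η : IdEnv Γ} {ρ' : StackEnv m} {η' : IdEnv Γ'} (hM : M (ρ, η) = M' (ρ', η'))
    (hN : N (ρ, η) = N' (ρ', η')) : seq M N (ρ, η) = seq M' N' (ρ', η') := by
  refine ext_run fun g k => ?_
  rw [(seq_apply M N _ g k).1, (seq_apply M' N' _ g k).1, hM]
  congr 2
  refine FMFun.ext (funext fun g' => ?_)
  rw [(seq_apply M N _ g k).2, (seq_apply M' N' _ g k).2, hN]

end Com

/-! ### Terms: renaming and substitution -/

namespace Term

/-- The exponential is named explicitly because `Ty.El` of an arrow type is one only after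
unfolding. In this form the equation can be used for rewriting. -/
theorem den_app {n : ℕ} {Γ : List Ty} {σ τ : Ty} (M : Term n Γ (.fn σ τ)) (N : Term n Γ σ)
    (x : Env n Γ) : (M.app N).den x = FMFun.toFun (A := σ.El) (B := τ.El) (M.den x) (N.den x) :=
  rfl

theorem den_appVal {n : ℕ} {Γ : List Ty} {τ : Ty} (M : Term n Γ (.fnVal τ)) (E : Exp n)
    (x : Env n Γ) : (M.appVal E).den x = FMFun.toFun (A := Val) (B := τ.El) (M.den x) (E.eval x.1) :=
  rfl

theorem den_fix {n : ℕ} {Γ : List Ty} {τ : Ty} (M : Term n Γ (.fn τ τ)) (x : Env n Γ) :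
    M.fix.den x = leastFix (M.den x : FMFun τ.El τ.El) := rfl

end Term

theorem Var.den_liftRen {Γ Γ' : List Ty} {g : ∀ τ, Var Γ τ → Var Γ' τ} {η : IdEnv Γ}
    {η' : IdEnv Γ'} (hη : ∀ τ (x : Var Γ τ), x.den η = (g τ x).den η') {σ : Ty} (a : σ.El)
    (τ : Ty) (x : Var (σ :: Γ) τ) : x.den (η.ext a) = (Term.liftRen g σ τ x).den (η'.ext a) := by
  cases x with
  | zero => rfl
  | succ x => exact hη _ x

namespace Term

/-- The interpretation of a renamed term. -/
theorem den_ren {n : ℕ} {Γ : List Ty} {τ : Ty} (M : Term n Γ τ) :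
    ∀ {m : ℕ} {Γ' : List Ty} {s : Fin n → Exp m} {g : ∀ τ, Var Γ τ → Var Γ' τ} {ρ : StackEnv n}
      {η : IdEnv Γ} {ρ' : StackEnv m} {η' : IdEnv Γ'}, (∀ i, ρ i = (s i).eval ρ') →
      (∀ τ (x : Var Γ τ), x.den η = (g τ x).den η') →
      (M.ren s g).den (ρ', η') = M.den (ρ, η) := by
  induction M with
  | var x => intro m Γ' s g ρ η ρ' η' hρ hη; exact (hη _ x).symm
  | lamVal M ih =>
    intro m Γ' s g ρ η ρ' η' hρ hη
    exact FMFun.ext (funext fun v => ih (Exp.ext_eval_lift hρ v) hη)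
  | appVal M E ih =>
    intro m Γ' s g ρ η ρ' η' hρ hη
    simp only [ren, den_appVal, ih hρ hη, Exp.eval_subst hρ]
  | lam M ih =>
    intro m Γ' s g ρ η ρ' η' hρ hη
    exact FMFun.ext (funext fun a => ih hρ (Var.den_liftRen hη a))
  | app M N ihM ihN =>
    intro m Γ' s g ρ η ρ' η' hρ hη
    simp only [ren, den_app, ihM hρ hη, ihN hρ hη]
  | fix M ih =>
    intro m Γ' s g ρ η ρ' η' hρ hη
    simp only [ren, den_fix, ih hρ hη]
  | ite E F M N ihM ihN =>
    intro m Γ' s g ρ η ρ' η' hρ hη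
    exact Com.ite_congr (Exp.eval_subst hρ E) (Exp.eval_subst hρ F) (ihM hρ hη) (ihN hρ hη)
  | seq M N ihM ihN =>
    intro m Γ' s g ρ η ρ' η' hρ hη
    exact Com.seq_congr (ihM hρ hη) (ihN hρ hη)
  | letNew M ih =>
    intro m Γ' s g ρ η ρ' η' hρ hη
    exact Com.letNew_congr fun v => ih (Exp.ext_eval_lift hρ v) hη
  | free E =>
    intro m Γ' s g ρ η ρ' η' hρ hη
    exact Com.free_congr (Exp.eval_subst hρ E)
  | letGet E f M ih =>
    intro m Γ' s g ρ η ρ' η' hρ hη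
    exact Com.letGet_congr (Exp.eval_subst hρ E) fun v => ih (Exp.ext_eval_lift hρ v) hη
  | put E f F =>
    intro m Γ' s g ρ η ρ' η' hρ hη
    exact Com.put_congr (Exp.eval_subst hρ E) (Exp.eval_subst hρ F)

/-- Weakening is a renaming. It has to be understood before substitution, which weakens the
substituted terms whenever it passes a binder. -/
theorem den_wkVal {n : ℕ} {Γ : List Ty} {τ : Ty} (M : Term n Γ τ) (ρ : StackEnv n) (η : IdEnv Γ)
    (v : Val) : M.wkVal.den (ρ.ext v, η) = M.den (ρ, η) :=
  den_ren M (fun _ => rfl) fun _ _ => rfl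

theorem den_wkId {n : ℕ} {Γ : List Ty} {σ τ : Ty} (M : Term n Γ τ) (ρ : StackEnv n) (η : IdEnv Γ)
    (a : σ.El) : (M.wkId σ).den (ρ, η.ext a) = M.den (ρ, η) :=
  den_ren M (fun _ => rfl) fun _ _ => rfl

theorem den_lift {m : ℕ} {Γ Γ' : List Ty} {t : ∀ τ, Var Γ τ → Term m Γ' τ} {η : IdEnv Γ}
    {ρ' : StackEnv m} {η' : IdEnv Γ'} (hη : ∀ τ (x : Var Γ τ), x.den η = (t τ x).den (ρ', η'))
    {σ : Ty} (a : σ.El) (τ : Ty) (x : Var (σ :: Γ) τ) :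
    x.den (η.ext a) = (lift t σ τ x).den (ρ', η'.ext a) := by
  cases x with
  | zero => rfl
  | succ x => exact (hη _ x).trans (den_wkId _ ρ' η' a).symm

theorem den_inst {n : ℕ} {Γ : List Ty} {σ : Ty} (M : Term n Γ σ) (ρ : StackEnv n) (η : IdEnv Γ)
    (τ : Ty) (x : Var (σ :: Γ) τ) : x.den (η.ext (M.den (ρ, η))) = (M.inst τ x).den (ρ, η) := by
  cases x <;> rfl

/-- The substitution lemma for terms. -/
theorem den_subst {n : ℕ} {Γ : List Ty} {τ : Ty} (M : Term n Γ τ) :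
    ∀ {m : ℕ} {Γ' : List Ty} {s : Fin n → Exp m} {t : ∀ τ, Var Γ τ → Term m Γ' τ}
      {ρ : StackEnv n} {η : IdEnv Γ} {ρ' : StackEnv m} {η' : IdEnv Γ'},
      (∀ i, ρ i = (s i).eval ρ') → (∀ τ (x : Var Γ τ), x.den η = (t τ x).den (ρ', η')) →
      (M.subst s t).den (ρ', η') = M.den (ρ, η) := by
  induction M with
  | var x => intro m Γ' s t ρ η ρ' η' hρ hη; exact (hη _ x).symm
  | lamVal M ih =>
    intro m Γ' s t ρ η ρ' η' hρ hη
    exact FMFun.ext (funext fun v => ih (Exp.ext_eval_lift hρ v) fun τ x =>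
      (hη τ x).trans (den_wkVal _ ρ' η' v).symm)
  | appVal M E ih =>
    intro m Γ' s t ρ η ρ' η' hρ hη
    simp only [subst, den_appVal, ih hρ hη, Exp.eval_subst hρ]
  | lam M ih =>
    intro m Γ' s t ρ η ρ' η' hρ hη
    exact FMFun.ext (funext fun a => ih hρ (den_lift hη a))
  | app M N ihM ihN =>
    intro m Γ' s t ρ η ρ' η' hρ hη
    simp only [subst, den_app, ihM hρ hη, ihN hρ hη]
  | fix M ih =>
    intro m Γ' s t ρ η ρ' η' hρ hη
    simp only [subst, den_fix, ih hρ hη]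
  | ite E F M N ihM ihN =>
    intro m Γ' s t ρ η ρ' η' hρ hη
    exact Com.ite_congr (Exp.eval_subst hρ E) (Exp.eval_subst hρ F) (ihM hρ hη) (ihN hρ hη)
  | seq M N ihM ihN =>
    intro m Γ' s t ρ η ρ' η' hρ hη
    exact Com.seq_congr (ihM hρ hη) (ihN hρ hη)
  | letNew M ih =>
    intro m Γ' s t ρ η ρ' η' hρ hη
    exact Com.letNew_congr fun v => ih (Exp.ext_eval_lift hρ v) fun τ x =>
      (hη τ x).trans (den_wkVal _ ρ' η' v).symm
  | free E =>
    intro m Γ' s t ρ η ρ' η' hρ hη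
    exact Com.free_congr (Exp.eval_subst hρ E)
  | letGet E f M ih =>
    intro m Γ' s t ρ η ρ' η' hρ hη
    exact Com.letGet_congr (Exp.eval_subst hρ E) fun v => ih (Exp.ext_eval_lift hρ v) fun τ x =>
      (hη τ x).trans (den_wkVal _ ρ' η' v).symm
  | put E f F =>
    intro m Γ' s t ρ η ρ' η' hρ hη
    exact Com.put_congr (Exp.eval_subst hρ E) (Exp.eval_subst hρ F)

end Term

/-! ### Specifications: substitution and Kripke monotonicity -/

namespace Spec

/-- The substitution lemma for specifications. -/
theorem sat_subst {n : ℕ} {Γ : List Ty} (φ : Spec n Γ) :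
    ∀ {m : ℕ} {Γ' : List Ty} {s : Fin n → Exp m} {t : ∀ τ, Var Γ τ → Term m Γ' τ}
      {ρ : StackEnv n} {η₀ η₁ : IdEnv Γ} {ρ' : StackEnv m} {η₀' η₁' : IdEnv Γ'} {r : World},
      (∀ i, ρ i = (s i).eval ρ') → (∀ τ (x : Var Γ τ), x.den η₀ = (t τ x).den (ρ', η₀')) →
      (∀ τ (x : Var Γ τ), x.den η₁ = (t τ x).den (ρ', η₁')) →
      ((φ.subst s t).Sat ρ' η₀' η₁' r ↔ φ.Sat ρ η₀ η₁ r) := by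
  induction φ with
  | triple P M Q =>
    intro m Γ' s t ρ η₀ η₁ ρ' η₀' η₁' r hρ h₀ h₁
    simp only [subst, Sat, World.eqAssn_subst _ hρ, M.den_subst hρ h₀, M.den_subst hρ h₁]
  | inv φ P ih =>
    intro m Γ' s t ρ η₀ η₁ ρ' η₀' η₁' r hρ h₀ h₁
    simp only [subst, Sat, World.eqAssn_subst _ hρ, ih hρ h₀ h₁]
  | eqVal E F =>
    intro m Γ' s t ρ η₀ η₁ ρ' η₀' η₁' r hρ h₀ h₁
    simp only [subst, Sat, Exp.eval_subst hρ]
  | eqTerm M N =>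
    intro m Γ' s t ρ η₀ η₁ ρ' η₀' η₁' r hρ h₀ h₁
    simp only [subst, Sat, Term.den_subst _ hρ h₀, Term.den_subst _ hρ h₁]
  | and φ ψ hφ hψ =>
    intro m Γ' s t ρ η₀ η₁ ρ' η₀' η₁' r hρ h₀ h₁
    simp only [subst, Sat, hφ hρ h₀ h₁, hψ hρ h₀ h₁]
  | or φ ψ hφ hψ =>
    intro m Γ' s t ρ η₀ η₁ ρ' η₀' η₁' r hρ h₀ h₁
    simp only [subst, Sat, hφ hρ h₀ h₁, hψ hρ h₀ h₁]
  | imp φ ψ hφ hψ =>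
    intro m Γ' s t ρ η₀ η₁ ρ' η₀' η₁' r hρ h₀ h₁
    simp only [subst, Sat, hφ hρ h₀ h₁, hψ hρ h₀ h₁]
  | allId τ φ ih =>
    intro m Γ' s t ρ η₀ η₁ ρ' η₀' η₁' r hρ h₀ h₁
    exact forall_congr' fun a => forall_congr' fun b =>
      ih hρ (Term.den_lift h₀ a) (Term.den_lift h₁ b)
  | exId τ φ ih =>
    intro m Γ' s t ρ η₀ η₁ ρ' η₀' η₁' r hρ h₀ h₁
    exact exists_congr fun a => exists_congr fun b =>
      ih hρ (Term.den_lift h₀ a) (Term.den_lift h₁ b)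
  | allVal φ ih =>
    intro m Γ' s t ρ η₀ η₁ ρ' η₀' η₁' r hρ h₀ h₁
    exact forall_congr' fun v => ih (Exp.ext_eval_lift hρ v)
      (fun τ x => (h₀ τ x).trans (Term.den_wkVal _ ρ' η₀' v).symm)
      (fun τ x => (h₁ τ x).trans (Term.den_wkVal _ ρ' η₁' v).symm)
  | exVal φ ih =>
    intro m Γ' s t ρ η₀ η₁ ρ' η₀' η₁' r hρ h₀ h₁
    exact exists_congr fun v => ih (Exp.ext_eval_lift hρ v)
      (fun τ x => (h₀ τ x).trans (Term.den_wkVal _ ρ' η₀' v).symm)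
      (fun τ x => (h₁ τ x).trans (Term.den_wkVal _ ρ' η₁' v).symm)

variable {n : ℕ} {Γ : List Ty} {ρ : StackEnv n} {η₀ η₁ : IdEnv Γ} {r : World}

theorem sat_wkVal (φ : Spec n Γ) (v : Val) :
    φ.wkVal.Sat (ρ.ext v) η₀ η₁ r ↔ φ.Sat ρ η₀ η₁ r :=
  sat_subst φ (fun _ => rfl) (fun _ _ => rfl) fun _ _ => rfl

theorem sat_wkId (φ : Spec n Γ) {τ : Ty} (a b : τ.El) :
    (φ.wkId τ).Sat ρ (η₀.ext a) (η₁.ext b) r ↔ φ.Sat ρ η₀ η₁ r :=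
  sat_subst φ (fun _ => rfl) (fun _ _ => rfl) fun _ _ => rfl

theorem sat_instVal (φ : Spec (n + 1) Γ) (E : Exp n) :
    (φ.instVal E).Sat ρ η₀ η₁ r ↔ φ.Sat (ρ.ext (E.eval ρ)) η₀ η₁ r :=
  sat_subst φ (E.ext_eval_inst ρ) (fun _ _ => rfl) fun _ _ => rfl

/-- A quantified identifier stands for two unrelated values; a term instantiates the pair by its
interpretations in the two environments. -/
theorem sat_instId {τ : Ty} (φ : Spec n (τ :: Γ)) (M : Term n Γ τ) :
    (φ.instId M).Sat ρ η₀ η₁ r ↔ φ.Sat ρ (η₀.ext (M.den (ρ, η₀))) (η₁.ext (M.den (ρ, η₁))) r :=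
  sat_subst φ (fun _ => rfl) (M.den_inst ρ η₀) (M.den_inst ρ η₁)

/-- Satisfaction is preserved by extending the world. -/
theorem Sat.mono {n : ℕ} {Γ : List Ty} {φ : Spec n Γ} {ρ : StackEnv n} {η₀ η₁ : IdEnv Γ}
    {r : World} (h : φ.Sat ρ η₀ η₁ r) (s : World) : φ.Sat ρ η₀ η₁ (r.star s) := by
  induction φ generalizing r with
  | triple P M Q =>
    have := Quad.frame h s
    rw [World.star_assoc, World.star_assoc] at this
    exact this
  | inv φ P ih =>
    have := ih (ρ := ρ) (η₀ := η₀) (η₁ := η₁) (r := r.star (World.eqAssn P ρ)) h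
    -- The induction hypothesis extends the world `r * eq(P)` by `s`; the extension is moved in
    -- front of `eq(P)`.
    rw [World.star_assoc, World.star_comm _ s, ← World.star_assoc] at this
    exact this
  | eqVal E F => exact h
  | eqTerm M N => exact h
  | and φ ψ hφ hψ => exact ⟨hφ h.1, hψ h.2⟩
  | or φ ψ hφ hψ => exact h.imp hφ hψ
  | imp φ ψ hφ hψ =>
    -- The induction hypotheses play no role: an extension of `r * s` by `t` is the extension of `r`
    -- by `s * t`.
    intro t
    rw [World.star_assoc]
    exact h _
  | allId τ φ ih => exact fun a b => ih (h a b)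
  | exId τ φ ih =>
    obtain ⟨a, b, hab⟩ := h
    exact ⟨a, b, ih hab⟩
  | allVal φ ih => exact fun v => ih (h v)
  | exVal φ ih =>
    obtain ⟨v, hv⟩ := h
    exact ⟨v, ih hv⟩

theorem Sat.imp_apply {φ ψ : Spec n Γ} (h : (imp φ ψ).Sat ρ η₀ η₁ r) (hφ : φ.Sat ρ η₀ η₁ r) :
    ψ.Sat ρ η₀ η₁ r := by
  obtain ⟨u, hu⟩ := World.exists_star_unit
  have := h u
  rw [hu] at this
  exact this hφ

/-- An implication whose conclusion follows at every world. -/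
theorem sat_imp {φ ψ : Spec n Γ} (h : ∀ r, φ.Sat ρ η₀ η₁ r → ψ.Sat ρ η₀ η₁ r) :
    (imp φ ψ).Sat ρ η₀ η₁ r := fun _ => h _

theorem sat_iff {φ ψ : Spec n Γ} (h : ∀ r, φ.Sat ρ η₀ η₁ r ↔ ψ.Sat ρ η₀ η₁ r) :
    (iff φ ψ).Sat ρ η₀ η₁ r := ⟨fun _ => (h _).1, fun _ => (h _).2⟩

end Spec

/-! ### Fixed-point induction -/

theorem leastFix_bot {A : Type} [PFMCpo A] : leastFix (⊥ : FMFun A A) = ⊥ :=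
  le_antisymm (leastFix_le le_rfl) bot_le

/-- Related chains of observations are equal, so their least upper bounds agree. The bound is not
`err` because `normal` is an upper bound: `G` is the lower set of `normal` in the flat order. -/
theorem EqGood.of_isLUB {o₀ o₁ : ℕ → Obs} (h : ∀ n, EqGood (o₀ n) (o₁ n)) {a₀ a₁ : Obs}
    (h₀ : IsLUB (Set.range o₀) a₀) (h₁ : IsLUB (Set.range o₁) a₁) : EqGood a₀ a₁ := by
  have he : o₀ = o₁ := funext fun n => (h n).1
  refine ⟨h₀.unique (he ▸ h₁), ?_⟩
  have hle : a₀ ≤ Obs.normal := h₀.2 (by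
    rintro _ ⟨n, rfl⟩
    have := (h n).2
    cases ho : o₀ n with
    | bot => exact Or.inl rfl
    | normal => exact Or.inr rfl
    | err => exact absurd ho this)
  rintro rfl
  rcases hle with hc | hc <;> cases hc

/-- Least upper bounds of finitely supported chains of commands are pointwise, so for each frame,
pair of heaps and pair of continuations this is admissibility of `eq(G)`. -/
theorem Quad.of_isLUB {r s : World} {c₀ c₁ : ℕ →o Com} (hc₀ : FSChain c₀) (hc₁ : FSChain c₁)
    {a₀ a₁ : Com} (h₀ : IsLUB (Set.range c₀) a₀) (h₁ : IsLUB (Set.range c₁) a₁)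
    (h : ∀ n, Quad r (c₀ n) (c₁ n) s) : Quad r a₀ a₁ s := fun r' g₀ g₁ k₀ k₁ hr hk =>
  EqGood.of_isLUB (fun n => h n r' g₀ g₁ k₀ k₁ hr hk) (FMFun.pointwise_of_isLUB hc₀ h₀ (g₀, k₀))
    (FMFun.pointwise_of_isLUB hc₁ h₁ (g₁, k₁))

/-- Divergence counts as a good observation: triples express partial correctness. -/
theorem Quad.bot (r s : World) : Quad r ⊥ ⊥ s := fun _ _ _ _ _ _ _ => ⟨rfl, fun h => by cases h⟩

/-! ### Contexts as strict continuous functions of the hole -/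

namespace HoleTerm

variable {σ : Ty}

/-- The interpretation of a context, as a morphism from environments and values of the hole. -/
noncomputable def den : {n : ℕ} → {Γ : List Ty} → {τ : Ty} → HoleTerm σ n Γ τ → FMHom (Env n Γ × σ.El) τ.El
  | _, _, _, .hole => FMHom.snd
  | n, Γ, .fnVal τ, .lamVal C => (FMHom.curry (C.den.comp (FMHom.pair
      ((StackEnv.extHom n Γ).comp (FMHom.pair (FMHom.fst.comp FMHom.fst) FMHom.snd))
      (FMHom.snd.comp FMHom.fst))) : FMHom (Env n Γ × σ.El) (FMFun Val τ.El))
  | n, Γ, τ, .appVal C E =>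
    (FMHom.eval : FMHom (FMFun Val τ.El × Val) τ.El).comp
      (FMHom.pair (C.den : FMHom (Env n Γ × σ.El) (FMFun Val τ.El)) ((E.den Γ).comp FMHom.fst))
  | n, Γ, .fn τ τ', .lam C => (FMHom.curry (C.den.comp (FMHom.pair
      ((IdEnv.extHom n Γ τ).comp (FMHom.pair (FMHom.fst.comp FMHom.fst) FMHom.snd))
      (FMHom.snd.comp FMHom.fst))) : FMHom (Env n Γ × σ.El) (FMFun τ.El τ'.El))
  | n, Γ, τ', .app (τ := τ) C M =>
    (FMHom.eval : FMHom (FMFun τ.El τ'.El × τ.El) τ'.El).comp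
      (FMHom.pair (C.den : FMHom (Env n Γ × σ.El) (FMFun τ.El τ'.El)) (M.den.comp FMHom.fst))
  | n, Γ, τ, .fix C =>
    (FMHom.fix : FMHom (FMFun τ.El τ.El) τ.El).comp
      (C.den : FMHom (Env n Γ × σ.El) (FMFun τ.El τ.El))
  | n, Γ, _, .seq C M => (FMHom.curry (FMHom.eval.comp (FMHom.pair
      ((C.den : FMHom (Env n Γ × σ.El) Com).comp FMHom.fst)
      (FMHom.pair (FMHom.fst.comp FMHom.snd)
        ((Com.seqCont M.den).comp (FMHom.pair (FMHom.fst.comp FMHom.fst) FMHom.snd))))) :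
      FMHom (Env n Γ × σ.El) Com)

theorem den_appVal {n : ℕ} {Γ : List Ty} {τ : Ty} (C : HoleTerm σ n Γ (.fnVal τ)) (E : Exp n)
    (x : Env n Γ) (a : σ.El) : (C.appVal E).den (x, a) =
      FMFun.toFun (A := Val) (B := τ.El) (C.den (x, a)) (E.eval x.1) := rfl

theorem den_app {n : ℕ} {Γ : List Ty} {τ τ' : Ty} (C : HoleTerm σ n Γ (.fn τ τ'))
    (M : Term n Γ τ) (x : Env n Γ) (a : σ.El) : (C.app M).den (x, a) =
      FMFun.toFun (A := τ.El) (B := τ'.El) (C.den (x, a)) (M.den x) := rfl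

theorem den_fix {n : ℕ} {Γ : List Ty} {τ : Ty} (C : HoleTerm σ n Γ (.fn τ τ)) (x : Env n Γ)
    (a : σ.El) : C.fix.den (x, a) = leastFix (A := τ.El) (C.den (x, a)) := rfl

theorem den_seq {n : ℕ} {Γ : List Ty} (C : HoleTerm σ n Γ .com) (M : Term n Γ .com)
    (x : Env n Γ) (a : σ.El) (h : Heap) (k : Cont) :
    FMFun.toFun (A := Heap × Cont) (B := Obs) ((C.seq M).den (x, a)) (h, k) =
      FMFun.toFun (A := Heap × Cont) (B := Obs) (C.den (x, a))
        (h, Com.seqCont M.den (x, (h, k))) := rfl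

/-- Capture-avoiding insertion weakens `N` under each binder, and weakening preserves the
interpretation. Thus one value of `N`, computed outside, can be handed to the hole at any depth. -/
theorem den_fill {n : ℕ} {Γ : List Ty} {τ : Ty} (C : HoleTerm σ n Γ τ) :
    ∀ (N : Term n Γ σ) (ρ : StackEnv n) (η : IdEnv Γ),
      (C.fill N).den (ρ, η) = C.den ((ρ, η), N.den (ρ, η)) := by
  induction C with
  | hole => intro N ρ η; rfl
  | lamVal C ih =>
    intro N ρ η
    refine FMFun.ext (funext fun v => (ih N.wkVal (ρ.ext v) η).trans ?_)
    rw [Term.den_wkVal]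
    rfl
  | appVal C E ih =>
    intro N ρ η
    simp only [fill, Term.den_appVal, den_appVal, ih]
  | lam C ih =>
    intro N ρ η
    refine FMFun.ext (funext fun b => (ih (N.wkId _) ρ (η.ext b)).trans ?_)
    rw [Term.den_wkId]
    rfl
  | app C M ih =>
    intro N ρ η
    simp only [fill, Term.den_app, den_app, ih]
  | fix C ih =>
    intro N ρ η
    simp only [fill, Term.den_fix, den_fix, ih]
  | seq C M ih =>
    intro N ρ η
    refine Com.ext_run fun h k => ?_
    refine Eq.trans ?_ (den_seq C M (ρ, η) _ h k).symm
    rw [← ih]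
    rfl

theorem den_ren {n : ℕ} {Γ : List Ty} {τ : Ty} (C : HoleTerm σ n Γ τ) :
    ∀ {m : ℕ} {Γ' : List Ty} {s : Fin n → Exp m} {g : ∀ τ, Var Γ τ → Var Γ' τ} {ρ : StackEnv n}
      {η : IdEnv Γ} {ρ' : StackEnv m} {η' : IdEnv Γ'} (a : σ.El), (∀ i, ρ i = (s i).eval ρ') →
      (∀ τ (x : Var Γ τ), x.den η = (g τ x).den η') →
      (C.ren s g).den ((ρ', η'), a) = C.den ((ρ, η), a) := by
  induction C with
  | hole => intro m Γ' s g ρ η ρ' η' a hρ hη; rfl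
  | lamVal C ih =>
    intro m Γ' s g ρ η ρ' η' a hρ hη
    exact FMFun.ext (funext fun v => ih a (Exp.ext_eval_lift hρ v) hη)
  | appVal C E ih =>
    intro m Γ' s g ρ η ρ' η' a hρ hη
    simp only [ren, den_appVal, ih a hρ hη, Exp.eval_subst hρ]
  | lam C ih =>
    intro m Γ' s g ρ η ρ' η' a hρ hη
    exact FMFun.ext (funext fun b => ih a hρ (Var.den_liftRen hη b))
  | app C M ih =>
    intro m Γ' s g ρ η ρ' η' a hρ hη
    simp only [ren, den_app, ih a hρ hη, M.den_ren hρ hη]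
  | fix C ih =>
    intro m Γ' s g ρ η ρ' η' a hρ hη
    simp only [ren, den_fix, ih a hρ hη]
  | seq C M ih =>
    intro m Γ' s g ρ η ρ' η' a hρ hη
    refine Com.ext_run fun h k => ?_
    refine (den_seq _ _ _ _ h k).trans (Eq.trans ?_ (den_seq C M (ρ, η) _ h k).symm)
    rw [ih a hρ hη]
    congr 2
    exact FMFun.ext (funext fun h' => congrArg (fun c : Com => c (h', k)) (M.den_ren hρ hη))

/-- Strictness comes from the grammar: the hole is applied, abstracted over, iterated, or run first
in a sequence, and each of these maps `⊥` to `⊥`. An argument position or the second half of a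
sequence would not do so in general. -/
theorem den_bot {n : ℕ} {Γ : List Ty} {τ : Ty} (C : HoleTerm σ n Γ τ) :
    ∀ (ρ : StackEnv n) (η : IdEnv Γ), C.den ((ρ, η), ⊥) = ⊥ := by
  induction C with
  | hole => intro ρ η; rfl
  | lamVal C ih => intro ρ η; exact FMFun.ext (funext fun v => ih (ρ.ext v) η)
  | appVal C E ih => intro ρ η; rw [den_appVal, ih]; rfl
  | lam C ih => intro ρ η; exact FMFun.ext (funext fun b => ih ρ (η.ext b))
  | app C M ih => intro ρ η; rw [den_app, ih]; rfl
  | fix C ih => intro ρ η; rw [den_fix, ih]; exact leastFix_bot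
  | seq C M ih =>
    intro ρ η
    refine Com.ext_run fun h k => (den_seq C M (ρ, η) _ h k).trans ?_
    rw [ih]; rfl

end HoleTerm

/-! ### Admissibility of specifications with holes -/

namespace HoleSpec

variable {σ : Ty}

/-- Satisfaction of a specification with holes, given the two values of the holes. -/
def Sat : {n : ℕ} → {Γ : List Ty} → HoleSpec σ n Γ → StackEnv n → IdEnv Γ → IdEnv Γ →
    σ.El → σ.El → World → Prop
  | _, _, triple P C Q, ρ, η₀, η₁, a₀, a₁, r =>
    Quad ((World.eqAssn P ρ).star r) (C.den ((ρ, η₀), a₀)) (C.den ((ρ, η₁), a₁))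
      ((World.eqAssn Q ρ).star r)
  | _, _, and γ δ, ρ, η₀, η₁, a₀, a₁, r => γ.Sat ρ η₀ η₁ a₀ a₁ r ∧ δ.Sat ρ η₀ η₁ a₀ a₁ r
  | _, _, allId τ γ, ρ, η₀, η₁, a₀, a₁, r =>
    ∀ m₀ m₁ : τ.El, γ.Sat ρ (η₀.ext m₀) (η₁.ext m₁) a₀ a₁ r
  | _, _, allVal γ, ρ, η₀, η₁, a₀, a₁, r => ∀ v : Val, γ.Sat (ρ.ext v) η₀ η₁ a₀ a₁ r

/-- Separates the values in the hole from the syntax, so that the induction can run through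
approximants that are not denoted by any given term. -/
theorem sat_fill {n : ℕ} {Γ : List Ty} (γ : HoleSpec σ n Γ) :
    ∀ (N : Term n Γ σ) (ρ : StackEnv n) (η₀ η₁ : IdEnv Γ) (r : World),
      (γ.fill N).Sat ρ η₀ η₁ r ↔ γ.Sat ρ η₀ η₁ (N.den (ρ, η₀)) (N.den (ρ, η₁)) r := by
  induction γ with
  | triple P C Q =>
    intro N ρ η₀ η₁ r
    simp only [fill, Spec.Sat, Sat, C.den_fill]
  | and γ δ hγ hδ =>
    intro N ρ η₀ η₁ r
    exact and_congr (hγ N ρ η₀ η₁ r) (hδ N ρ η₀ η₁ r)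
  | allId τ γ ih =>
    intro N ρ η₀ η₁ r
    simp only [fill, Spec.Sat, Sat, ih, Term.den_wkId]
  | allVal γ ih =>
    intro N ρ η₀ η₁ r
    simp only [fill, Spec.Sat, Sat, ih, Term.den_wkVal]

theorem sat_ren {n : ℕ} {Γ : List Ty} (γ : HoleSpec σ n Γ) :
    ∀ {m : ℕ} {Γ' : List Ty} {s : Fin n → Exp m} {g : ∀ τ, Var Γ τ → Var Γ' τ} {ρ : StackEnv n}
      {η₀ η₁ : IdEnv Γ} {ρ' : StackEnv m} {η₀' η₁' : IdEnv Γ'} {a₀ a₁ : σ.El} {r : World},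
      (∀ i, ρ i = (s i).eval ρ') → (∀ τ (x : Var Γ τ), x.den η₀ = (g τ x).den η₀') →
      (∀ τ (x : Var Γ τ), x.den η₁ = (g τ x).den η₁') →
      ((γ.ren s g).Sat ρ' η₀' η₁' a₀ a₁ r ↔ γ.Sat ρ η₀ η₁ a₀ a₁ r) := by
  induction γ with
  | triple P C Q =>
    intro m Γ' s g ρ η₀ η₁ ρ' η₀' η₁' a₀ a₁ r hρ h₀ h₁
    simp only [ren, Sat, World.eqAssn_subst _ hρ, C.den_ren _ hρ h₀, C.den_ren _ hρ h₁]
  | and γ δ hγ hδ =>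
    intro m Γ' s g ρ η₀ η₁ ρ' η₀' η₁' a₀ a₁ r hρ h₀ h₁
    exact and_congr (hγ hρ h₀ h₁) (hδ hρ h₀ h₁)
  | allId τ γ ih =>
    intro m Γ' s g ρ η₀ η₁ ρ' η₀' η₁' a₀ a₁ r hρ h₀ h₁
    exact forall_congr' fun m₀ => forall_congr' fun m₁ =>
      ih hρ (Var.den_liftRen h₀ m₀) (Var.den_liftRen h₁ m₁)
  | allVal γ ih =>
    intro m Γ' s g ρ η₀ η₁ ρ' η₀' η₁' a₀ a₁ r hρ h₀ h₁
    exact forall_congr' fun v => ih (Exp.ext_eval_lift hρ v) h₀ h₁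

theorem sat_wkId {n : ℕ} {Γ : List Ty} (γ : HoleSpec σ n Γ) {τ : Ty} {ρ : StackEnv n}
    {η₀ η₁ : IdEnv Γ} (m₀ m₁ : τ.El) {a₀ a₁ : σ.El} {r : World} :
    (γ.wkId τ).Sat ρ (η₀.ext m₀) (η₁.ext m₁) a₀ a₁ r ↔ γ.Sat ρ η₀ η₁ a₀ a₁ r :=
  sat_ren γ (fun _ => rfl) (fun _ _ => rfl) fun _ _ => rfl

theorem sat_bot {n : ℕ} {Γ : List Ty} (γ : HoleSpec σ n Γ) :
    ∀ (ρ : StackEnv n) (η₀ η₁ : IdEnv Γ) (r : World), γ.Sat ρ η₀ η₁ ⊥ ⊥ r := by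
  induction γ with
  | triple P C Q =>
    intro ρ η₀ η₁ r
    simp only [Sat, C.den_bot]
    exact Quad.bot _ _
  | and γ δ hγ hδ => exact fun ρ η₀ η₁ r => ⟨hγ ρ η₀ η₁ r, hδ ρ η₀ η₁ r⟩
  | allId τ γ ih => exact fun ρ η₀ η₁ r m₀ m₁ => ih _ _ _ _
  | allVal γ ih => exact fun ρ η₀ η₁ r v => ih _ _ _ _

/-- Specifications with holes are admissible. -/
theorem sat_of_isLUB {n : ℕ} {Γ : List Ty} (γ : HoleSpec σ n Γ) {c₀ c₁ : ℕ →o σ.El}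
    (hc₀ : FSChain c₀) (hc₁ : FSChain c₁) {a₀ a₁ : σ.El} (h₀ : IsLUB (Set.range c₀) a₀)
    (h₁ : IsLUB (Set.range c₁) a₁) : ∀ {ρ : StackEnv n} {η₀ η₁ : IdEnv Γ} {r : World},
      (∀ i, γ.Sat ρ η₀ η₁ (c₀ i) (c₁ i) r) → γ.Sat ρ η₀ η₁ a₀ a₁ r := by
  induction γ with
  | triple P C Q =>
    intro ρ η₀ η₁ r h
    -- Only the hole varies along the chain. Pairing with a fixed environment need not be
    -- equivariant, but it is finitely supported, and this suffices for composing continuous maps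
    -- and for transporting chains.
    have cont : ∀ η, FMContinuous fun a => C.den ((ρ, η), a) := fun η =>
      C.den.cont.comp (FMHom.cont_mk_left (ρ, η)) (FMHom.finSupp_mk_left (ρ, η))
    have fs : ∀ η, FinSuppFun fun a => C.den ((ρ, η), a) := fun η =>
      C.den.finSupp.comp (FMHom.finSupp_mk_left (ρ, η))
    exact Quad.of_isLUB (hc₀.map (fs η₀) (cont η₀).monotone) (hc₁.map (fs η₁) (cont η₁).monotone)
      (cont η₀ c₀ hc₀ a₀ h₀) (cont η₁ c₁ hc₁ a₁ h₁) h
  | and γ δ hγ hδ => exact fun h => ⟨hγ fun i => (h i).1, hδ fun i => (h i).2⟩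
  | allId τ γ ih => exact fun h m₀ m₁ => ih fun i => h i m₀ m₁
  | allVal γ ih => exact fun h v => ih fun i => h i v

/-- Scott induction for specifications with holes. -/
theorem sat_leastFix {n : ℕ} {Γ : List Ty} (γ : HoleSpec σ n Γ) {ρ : StackEnv n}
    {η₀ η₁ : IdEnv Γ} {r : World} {f₀ f₁ : FMFun σ.El σ.El}
    (h : ∀ a₀ a₁, γ.Sat ρ η₀ η₁ a₀ a₁ r → γ.Sat ρ η₀ η₁ (f₀ a₀) (f₁ a₁) r) :
    γ.Sat ρ η₀ η₁ (leastFix f₀) (leastFix f₁) r := by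
  refine γ.sat_of_isLUB (fixChain_fs f₀) (fixChain_fs f₁) (leastFix_isLUB f₀) (leastFix_isLUB f₁)
    fun i => ?_
  -- Both fixed points are approximated in lock step, comparing the iterates with the same index.
  show γ.Sat ρ η₀ η₁ (f₀.toFun^[i] ⊥) (f₁.toFun^[i] ⊥) r
  induction i with
  | zero => exact γ.sat_bot ρ η₀ η₁ r
  | succ i ih =>
    rw [Function.iterate_succ_apply', Function.iterate_succ_apply']
    exact h _ _ ih

end HoleSpec

/-! ### Soundness of the proof rules -/

/-- A larger postcondition relation demands more of the continuations, hence the quadruple is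
covariant in it. -/
theorem Quad.conseq {r r' s s' : World} {c₀ c₁ : Com} (h : Quad r' c₀ c₁ s')
    (hr : ∀ h₀ h₁, r.rel h₀ h₁ → r'.rel h₀ h₁) (hs : ∀ h₀ h₁, s'.rel h₀ h₁ → s.rel h₀ h₁) :
    Quad r c₀ c₁ s := fun t h₀ h₁ k₀ k₁ hh hk =>
  h t h₀ h₁ k₀ k₁ (World.star_mono hr hh) (hk.mono fun _ _ => World.star_mono hs)

theorem Assn.den_ptsAt {n : ℕ} (f : Fin 2) (E A B : Exp n) (ρ : StackEnv n) :
    (ptsAt f E A B).den ρ = {h | ∃ l, E.eval ρ = .loc l ∧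
      h = .single l (if f = 0 then (A.eval ρ, B.eval ρ) else (B.eval ρ, A.eval ρ))} := by
  unfold ptsAt
  split_ifs <;> rfl

/-! ### The axioms for triples, invariants and fixed points -/

namespace Spec

variable {n : ℕ} {Γ : List Ty} {ρ : StackEnv n} {η₀ η₁ : IdEnv Γ} {r : World}

/-- The precondition holds of one fragment common to both heaps, so a single witness `v` serves both
runs. The disjunction rule rests on the same observation. -/
theorem sat_triple_ex {P Q : Assn (n + 1)} {M : Term n Γ .com}
    (h : (allVal (triple P M.wkVal Q)).Sat ρ η₀ η₁ r) : (triple P.ex M Q.ex).Sat ρ η₀ η₁ r := by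
  refine Quad.of_split fun t g m₀ m₁ h₀ h₁ k₀ k₁ hg hm s₀ s₁ hk => ?_
  obtain ⟨v, hv⟩ := hg
  have hq : Quad _ _ _ _ := h v
  rw [M.den_wkVal, M.den_wkVal] at hq
  exact hq.apply_split hv hm s₀ s₁
    (hk.mono fun _ _ => World.star_mono fun _ _ hx => by exact ⟨hx.1, v, hx.2⟩)

theorem sat_triple_or {P P' Q Q' : Assn n} {M : Term n Γ .com}
    (h : (triple P M Q).Sat ρ η₀ η₁ r) (h' : (triple P' M Q').Sat ρ η₀ η₁ r) :
    (triple (P.or P') M (Q.or Q')).Sat ρ η₀ η₁ r := by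
  refine Quad.of_split fun t g m₀ m₁ h₀ h₁ k₀ k₁ hg hm s₀ s₁ hk => ?_
  rw [Assn.den_or] at hg
  rcases hg with hg | hg
  · exact Quad.apply_split h hg hm s₀ s₁ (hk.mono fun _ _ => World.star_mono fun _ _ =>
      World.eqAssn_mono fun _ hx => by rw [Assn.den_or]; exact Or.inl hx)
  · exact Quad.apply_split h' hg hm s₀ s₁ (hk.mono fun _ _ => World.star_mono fun _ _ =>
      World.eqAssn_mono fun _ hx => by rw [Assn.den_or]; exact Or.inr hx)

/-- The guard depends on the stack alone, which the two runs share, so they take the same branch. -/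
theorem sat_triple_ite {P Q : Assn n} {E F : Exp n} {M N : Term n Γ .com}
    (hM : (triple (P.and (.eq E F)) M Q).Sat ρ η₀ η₁ r)
    (hN : (triple (P.and (.not (.eq E F))) N Q).Sat ρ η₀ η₁ r) :
    (triple P (.ite E F M N) Q).Sat ρ η₀ η₁ r := by
  have key : ∀ η, (Term.ite E F M N).den (ρ, η) =
      if E.eval ρ = F.eval ρ then M.den (ρ, η) else N.den (ρ, η) := fun η => rfl
  simp only [Sat, key]
  by_cases hE : E.eval ρ = F.eval ρ
  · simp only [if_pos hE]
    exact hM.conseq (fun _ _ => World.star_mono fun _ _ hx => by exact ⟨hx.1, hx.2, hE⟩)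
      fun _ _ => id
  · simp only [if_neg hE]
    exact hN.conseq (fun _ _ => World.star_mono fun _ _ hx => by exact ⟨hx.1, hx.2, hE⟩)
      fun _ _ => id

theorem sat_triple_seq {P P₀ Q : Assn n} {M N : Term n Γ .com}
    (hM : (triple P M P₀).Sat ρ η₀ η₁ r) (hN : (triple P₀ N Q).Sat ρ η₀ η₁ r) :
    (triple P (.seq M N) Q).Sat ρ η₀ η₁ r := fun t h₀ h₁ k₀ k₁ hr hk =>
  hM t h₀ h₁ (Com.seqCont N.den ((ρ, η₀), (h₀, k₀))) (Com.seqCont N.den ((ρ, η₁), (h₁, k₁))) hr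
    -- The triple for `N`, with the same frame `t`, is exactly relatedness of the continuations
    -- given to `M`.
    fun g₀ g₁ hg => hN t g₀ g₁ k₀ k₁ hg hk

theorem sat_triple_letNew {P Q : Assn n} {M : Term (n + 1) Γ .com}
    (h : (allVal (triple (.star P.wk (.pts (.var 0) .zero .zero)) M Q.wk)).Sat ρ η₀ η₁ r) :
    (triple P (.letNew M) Q).Sat ρ η₀ η₁ r := by
  refine Quad.of_split fun t g m₀ m₁ h₀ h₁ k₀ k₁ hg hm s₀ s₁ hk => ?_
  obtain ⟨L₀, hL₀⟩ := Com.letNew_apply M.den ρ η₀ h₀ k₀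
  obtain ⟨L₁, hL₁⟩ := Com.letNew_apply M.den ρ η₁ h₁ k₁
  -- One location fresh for both runs; leaving out both domains as well gives disjointness of the
  -- new cell directly.
  obtain ⟨l, hl⟩ := Infinite.exists_notMem_finset
    (L₀ ∪ L₁ ∪ (h₀.finite.toFinset ∪ h₁.finite.toFinset))
  simp only [Finset.mem_union, Set.Finite.mem_toFinset, Set.mem_ofPred_eq, not_or, not_not] at hl
  obtain ⟨⟨hl₀, hl₁⟩, hc₀, hc₁⟩ := hl
  have split : ∀ {h m : Heap}, h.Split g m → h.cell l = none →
      Heap.Disj g (.single l (.int 0, .int 0)) ∧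
      (h.union (.single l (.int 0, .int 0))).Split
        (g.union (.single l (.int 0, .int 0))) m := by
    rintro h m hs hc
    have hd := Heap.disj_single (v := (.int 0, .int 0)).2 hc
    -- The heap is read as `m` next to `g`, so that reassociating attaches the new cell to `g` and
    -- leaves the remainder `m` untouched.
    have := Heap.Split.assoc (h := h.union (.single l (.int 0, .int 0))) ⟨hd, rfl⟩ hs.symm
    exact ⟨this.2.1, this.1.symm⟩
  have hq : Quad _ _ _ _ := h (.loc l)
  rw [World.eqAssn_wk] at hq
  show EqGood (Com.letNew M.den (ρ, η₀) (h₀, k₀)) (Com.letNew M.den (ρ, η₁) (h₁, k₁))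
  rw [hL₀ l hl₀, hL₁ l hl₁]
  refine hq.apply_split (g := g.union (.single l (.int 0, .int 0))) ?_ hm (split s₀ hc₀).2
    (split s₁ hc₁).2 hk
  refine ⟨g, ?_, _, ⟨l, rfl, rfl⟩, (split s₀ hc₀).1, rfl⟩
  rw [Assn.den_wk]
  exact hg

/-- The cell at `E` lies in the common fragment, so both runs read the same value, and this value is
the existential witness `v`. The body then starts on unchanged heaps that satisfy its precondition
at `v`. -/
theorem sat_triple_letGet {f : Fin 2} {P : Assn (n + 1)} {E : Exp n} {E₁ : Exp (n + 1)}
    {Q : Assn n} {M : Term (n + 1) Γ .com}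
    (h : (allVal (triple (.star P (.ptsAt f E.wk (.var 0) E₁)) M Q.wk)).Sat ρ η₀ η₁ r) :
    (triple (.ex (.star P (.ptsAt f E.wk (.var 0) E₁))) (.letGet E f M) Q).Sat ρ η₀ η₁ r := by
  refine Quad.of_split fun t g m₀ m₁ h₀ h₁ k₀ k₁ hg hm s₀ s₁ hk => ?_
  obtain ⟨v, hv⟩ := hg
  have hq : Quad _ _ _ _ := h v
  rw [World.eqAssn_wk] at hq
  -- A copy is taken apart to locate the cell; `hv` itself remains as the precondition of the body.
  obtain ⟨a, ha, b, hb, hs⟩ := id hv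
  rw [Assn.den_ptsAt] at hb
  obtain ⟨l, hE, rfl⟩ := hb
  rw [Exp.eval_wk] at hE
  have hf : Com.getField f (if f = 0 then ((Exp.var 0).eval (ρ.ext v), E₁.eval (ρ.ext v))
      else (E₁.eval (ρ.ext v), (Exp.var 0).eval (ρ.ext v))) = v := by
    unfold Com.getField
    split_ifs <;> rfl
  have run : ∀ {h m : Heap} (η : IdEnv Γ) (k : Cont), h.Split g m →
      Com.letGet E f M.den (ρ, η) (h, k) =
        FMFun.toFun (A := Heap × Cont) (B := Obs) (M.den (ρ.ext v, η)) (h, k) := fun η k hs' => by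
    -- The fragment is the cell next to `a`; reassociating makes the cell a summand of the whole
    -- heap.
    refine (Com.letGet_apply hE (hs'.assoc hs.symm).1.cell_single).trans ?_
    rw [hf]
  have hgood := hq.apply_split hv hm s₀ s₁ hk
  exact ⟨(run η₀ k₀ s₀).trans (hgood.1.trans (run η₁ k₁ s₁).symm),
    fun herr => hgood.2 ((run η₀ k₀ s₀).symm.trans herr)⟩

theorem sat_triple_free (E : Exp n) :
    (triple (.ptsAny E) (.free E : Term n Γ .com) .emp).Sat ρ η₀ η₁ r := by
  refine Quad.of_split fun t g m₀ m₁ h₀ h₁ k₀ k₁ hg hm s₀ s₁ hk => ?_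
  obtain ⟨v, w, l, hE, rfl⟩ := hg
  rw [Exp.eval_wk, Exp.eval_wk] at hE
  show EqGood (Com.free E (ρ, η₀) (h₀, k₀)) (Com.free E (ρ, η₁) (h₁, k₁))
  rw [Com.free_apply hE s₀.cell_single, Com.free_apply hE s₁.cell_single, s₀.erase_single,
    s₁.erase_single]
  -- After disposal only the related remainders are left, and `eq(emp)` is the unit.
  rw [World.star_comm, World.star_eqAssn_emp] at hk
  exact hk _ _ hm

theorem sat_triple_put (f : Fin 2) (E E₁ F : Exp n) :
    (triple (.ptsAnyAt f E E₁) (.put E f F : Term n Γ .com) (.ptsAt f E F E₁)).Sat ρ η₀ η₁ r := by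
  refine Quad.of_split fun t g m₀ m₁ h₀ h₁ k₀ k₁ hg hm s₀ s₁ hk => ?_
  obtain ⟨v, hg⟩ := hg
  rw [Assn.den_ptsAt, Exp.eval_wk, Exp.eval_wk] at hg
  obtain ⟨l, hE, rfl⟩ := hg
  have hf : Com.setField f (if f = 0 then ((Exp.var 0).eval (ρ.ext v), E₁.eval ρ)
      else (E₁.eval ρ, (Exp.var 0).eval (ρ.ext v))) (F.eval ρ) =
      if f = 0 then (F.eval ρ, E₁.eval ρ) else (E₁.eval ρ, F.eval ρ) := by
    unfold Com.setField
    split_ifs <;> rfl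
  show EqGood (Com.put E f F (ρ, η₀) (h₀, k₀)) (Com.put E f F (ρ, η₁) (h₁, k₁))
  rw [Com.put_apply hE s₀.cell_single, Com.put_apply hE s₁.cell_single, hf]
  -- Both updates turn the common cell into the same new cell and keep the remainders.
  refine hk _ _ ⟨_, _, _, _, s₀.set_single _, s₁.set_single _, ⟨rfl, ?_⟩, hm⟩
  rw [Assn.den_ptsAt]
  exact ⟨l, hE, rfl⟩

theorem sat_inv_triple {P P' Q : Assn n} {M : Term n Γ .com} :
    (inv (triple P M P') Q).Sat ρ η₀ η₁ r ↔
      (triple (.star P Q) M (.star P' Q)).Sat ρ η₀ η₁ r := by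
  simp only [Sat, World.eqAssn_star, World.star_assoc, World.star_comm r]

theorem sat_inv_inv {φ : Spec n Γ} {P Q : Assn n} :
    (inv (inv φ P) Q).Sat ρ η₀ η₁ r ↔ (inv φ (.star P Q)).Sat ρ η₀ η₁ r := by
  simp only [Sat, World.eqAssn_star, World.star_assoc,
    World.star_comm (World.eqAssn P ρ) (World.eqAssn Q ρ)]

/-- Adding the invariant before or after the extension `s` of the implication gives the same world,
by commutativity of `*`. -/
theorem sat_inv_imp {φ ψ : Spec n Γ} {P : Assn n} :
    (inv (imp φ ψ) P).Sat ρ η₀ η₁ r ↔ (imp (inv φ P) (inv ψ P)).Sat ρ η₀ η₁ r := by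
  simp only [Sat, World.star_assoc, World.star_comm (World.eqAssn P ρ)]

theorem sat_fixInd {σ : Ty} (γ : HoleSpec σ n Γ) (M : Term n Γ (.fn σ σ))
    (h : (allId σ (imp ((γ.wkId σ).fill (.var .zero))
      ((γ.wkId σ).fill (.app (M.wkId σ) (.var .zero))))).Sat ρ η₀ η₁ r) :
    (γ.fill (.fix M)).Sat ρ η₀ η₁ r := by
  rw [HoleSpec.sat_fill]
  refine γ.sat_leastFix (f₀ := M.den (ρ, η₀)) (f₁ := M.den (ρ, η₁)) fun a₀ a₁ ha => ?_
  -- The quantifier ranges over arbitrary pairs, so it applies to the pair of approximants; the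
  -- implication is used at the current world only.
  have step := (h a₀ a₁).imp_apply ((HoleSpec.sat_fill ..).2 ((γ.sat_wkId a₀ a₁).2 ha))
  rw [HoleSpec.sat_fill, HoleSpec.sat_wkId, Term.den_app, Term.den_app, Term.den_wkId,
    Term.den_wkId] at step
  exact step

end Spec

/-- Each implication or equivalence among the axioms is proved pointwise at every world, which makes
its outer Kripke quantification harmless. Distribution of `⊗` over connectives whose clauses leave
the world alone is definitional, up to weakening of the invariant under stack quantifiers. -/
theorem Axm.sat {n : ℕ} {Γ : List Ty} {φ : Spec n Γ} (h : Axm φ) (ρ : StackEnv n)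
    (η₀ η₁ : IdEnv Γ) (r : World) : φ.Sat ρ η₀ η₁ r := by
  cases h with
  | ex P Q M => exact Spec.sat_imp fun _ => Spec.sat_triple_ex
  | disj P P' Q Q' M => exact Spec.sat_imp fun _ h => Spec.sat_triple_or h.1 h.2
  | ite P Q E F M N => exact Spec.sat_imp fun _ h => Spec.sat_triple_ite h.1 h.2
  | seq P P₀ Q M N => exact Spec.sat_imp fun _ h => Spec.sat_triple_seq h.1 h.2
  | letNew P Q M => exact Spec.sat_imp fun _ => Spec.sat_triple_letNew
  | letGet f P E E₁ Q M => exact Spec.sat_imp fun _ => Spec.sat_triple_letGet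
  | free E => exact Spec.sat_triple_free E
  | put f E E₁ F => exact Spec.sat_triple_put f E E₁ F
  | conseq P P' Q Q' M hP hQ =>
    exact Spec.sat_imp fun _ h => Quad.conseq h
      (fun _ _ => World.star_mono fun _ _ => World.eqAssn_mono (hP ρ))
      fun _ _ => World.star_mono fun _ _ => World.eqAssn_mono (hQ ρ)
  | frame φ P => exact Spec.sat_imp fun _ h => h.mono _
  | invTriple P P' Q M => exact Spec.sat_iff fun _ => Spec.sat_inv_triple
  | invEqVal E F Q => exact Spec.sat_iff fun _ => Iff.rfl
  | invEqTerm M N Q => exact Spec.sat_iff fun _ => Iff.rfl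
  | invInv φ P Q => exact Spec.sat_iff fun _ => Spec.sat_inv_inv
  | invImp φ ψ P => exact Spec.sat_iff fun _ => Spec.sat_inv_imp
  | invAnd φ ψ P => exact Spec.sat_iff fun _ => Iff.rfl
  | invOr φ ψ P => exact Spec.sat_iff fun _ => Iff.rfl
  | invAllId τ φ P => exact Spec.sat_iff fun _ => Iff.rfl
  | invExId τ φ P => exact Spec.sat_iff fun _ => Iff.rfl
  | invAllVal φ P => exact Spec.sat_iff fun _ => by simp only [Spec.Sat, World.eqAssn_wk]
  | invExVal φ P => exact Spec.sat_iff fun _ => by simp only [Spec.Sat, World.eqAssn_wk]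
  | fixInd γ M => exact Spec.sat_imp fun _ => Spec.sat_fixInd γ M

/-! ### Natural deduction -/

theorem Spec.sat_map_wkId {n : ℕ} {Γ : List Ty} {Φ : List (Spec n Γ)} {ρ : StackEnv n}
    {η₀ η₁ : IdEnv Γ} {r : World} (h : ∀ ψ ∈ Φ, ψ.Sat ρ η₀ η₁ r) {τ : Ty} (a b : τ.El) :
    ∀ ψ ∈ Φ.map (Spec.wkId τ), ψ.Sat ρ (η₀.ext a) (η₁.ext b) r :=
  List.forall_mem_map.2 fun ψ hψ => (ψ.sat_wkId a b).2 (h ψ hψ)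

theorem Spec.sat_map_wkVal {n : ℕ} {Γ : List Ty} {Φ : List (Spec n Γ)} {ρ : StackEnv n}
    {η₀ η₁ : IdEnv Γ} {r : World} (h : ∀ ψ ∈ Φ, ψ.Sat ρ η₀ η₁ r) (v : Val) :
    ∀ ψ ∈ Φ.map Spec.wkVal, ψ.Sat (ρ.ext v) η₀ η₁ r :=
  List.forall_mem_map.2 fun ψ hψ => (ψ.sat_wkVal v).2 (h ψ hψ)

theorem Rule.sound {Js : List Judgment} {J : Judgment} (hR : Rule Js J)
    (hJs : ∀ J' ∈ Js, J'.Valid) : J.Valid := by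
  cases hR with
  | axm h => exact fun ρ η₀ η₁ r _ => h.sat ρ η₀ η₁ r
  | hyp h => exact fun ρ η₀ η₁ r hΦ => hΦ _ h
  | eqValI E => exact fun ρ η₀ η₁ r _ => rfl
  | eqTermI M => exact fun ρ η₀ η₁ r _ => ⟨rfl, rfl⟩
  | andI =>
    simp only [List.forall_mem_cons] at hJs
    exact fun ρ η₀ η₁ r hΦ => ⟨hJs.1 ρ η₀ η₁ r hΦ, hJs.2.1 ρ η₀ η₁ r hΦ⟩
  | andE₁ =>
    simp only [List.forall_mem_cons] at hJs
    exact fun ρ η₀ η₁ r hΦ => (hJs.1 ρ η₀ η₁ r hΦ).1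
  | andE₂ =>
    simp only [List.forall_mem_cons] at hJs
    exact fun ρ η₀ η₁ r hΦ => (hJs.1 ρ η₀ η₁ r hΦ).2
  | orI₁ =>
    simp only [List.forall_mem_cons] at hJs
    exact fun ρ η₀ η₁ r hΦ => Or.inl (hJs.1 ρ η₀ η₁ r hΦ)
  | orI₂ =>
    simp only [List.forall_mem_cons] at hJs
    exact fun ρ η₀ η₁ r hΦ => Or.inr (hJs.1 ρ η₀ η₁ r hΦ)
  | orE =>
    simp only [List.forall_mem_cons] at hJs
    obtain ⟨h, hφ, hψ, -⟩ := hJs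
    intro ρ η₀ η₁ r hΦ
    rcases h ρ η₀ η₁ r hΦ with h | h
    · exact hφ ρ η₀ η₁ r (List.forall_mem_cons.2 ⟨h, hΦ⟩)
    · exact hψ ρ η₀ η₁ r (List.forall_mem_cons.2 ⟨h, hΦ⟩)
  | impI =>
    simp only [List.forall_mem_cons] at hJs
    -- The premise is used at the extended world, to which monotonicity carries the assumptions.
    exact fun ρ η₀ η₁ r hΦ s hφ => hJs.1 ρ η₀ η₁ _
      (List.forall_mem_cons.2 ⟨hφ, fun ψ hψ => (hΦ ψ hψ).mono s⟩)
  | impE =>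
    simp only [List.forall_mem_cons] at hJs
    exact fun ρ η₀ η₁ r hΦ => Spec.Sat.imp_apply (hJs.1 ρ η₀ η₁ r hΦ) (hJs.2.1 ρ η₀ η₁ r hΦ)
  | falseE =>
    simp only [List.forall_mem_cons] at hJs
    intro ρ η₀ η₁ r hΦ
    have h : Val.int 0 = Val.int 1 := hJs.1 ρ η₀ η₁ r hΦ
    cases h
  | allIdI =>
    simp only [List.forall_mem_cons] at hJs
    exact fun ρ η₀ η₁ r hΦ a b => hJs.1 ρ (η₀.ext a) (η₁.ext b) r (Spec.sat_map_wkId hΦ a b)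
  | allIdE M =>
    simp only [List.forall_mem_cons] at hJs
    exact fun ρ η₀ η₁ r hΦ => (Spec.sat_instId _ M).2 (hJs.1 ρ η₀ η₁ r hΦ _ _)
  | exIdI M =>
    simp only [List.forall_mem_cons] at hJs
    exact fun ρ η₀ η₁ r hΦ => ⟨_, _, (Spec.sat_instId _ M).1 (hJs.1 ρ η₀ η₁ r hΦ)⟩
  | exIdE =>
    simp only [List.forall_mem_cons] at hJs
    intro ρ η₀ η₁ r hΦ
    obtain ⟨a, b, h⟩ := hJs.1 ρ η₀ η₁ r hΦ
    exact (Spec.sat_wkId _ a b).1 (hJs.2.1 ρ (η₀.ext a) (η₁.ext b) r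
      (List.forall_mem_cons.2 ⟨h, Spec.sat_map_wkId hΦ a b⟩))
  | allValI =>
    simp only [List.forall_mem_cons] at hJs
    exact fun ρ η₀ η₁ r hΦ v => hJs.1 (ρ.ext v) η₀ η₁ r (Spec.sat_map_wkVal hΦ v)
  | allValE E =>
    simp only [List.forall_mem_cons] at hJs
    exact fun ρ η₀ η₁ r hΦ => (Spec.sat_instVal _ E).2 (hJs.1 ρ η₀ η₁ r hΦ _)
  | exValI E =>
    simp only [List.forall_mem_cons] at hJs
    exact fun ρ η₀ η₁ r hΦ => ⟨_, (Spec.sat_instVal _ E).1 (hJs.1 ρ η₀ η₁ r hΦ)⟩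
  | exValE =>
    simp only [List.forall_mem_cons] at hJs
    intro ρ η₀ η₁ r hΦ
    obtain ⟨v, h⟩ := hJs.1 ρ η₀ η₁ r hΦ
    exact (Spec.sat_wkVal _ v).1 (hJs.2.1 (ρ.ext v) η₀ η₁ r
      (List.forall_mem_cons.2 ⟨h, Spec.sat_map_wkVal hΦ v⟩))
  | eqValE φ =>
    simp only [List.forall_mem_cons] at hJs
    intro ρ η₀ η₁ r hΦ
    have hφ := (φ.sat_instVal _).1 (hJs.2.1 ρ η₀ η₁ r hΦ)
    have he : Exp.eval ρ _ = Exp.eval ρ _ := hJs.1 ρ η₀ η₁ r hΦ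
    rw [he] at hφ
    exact (φ.sat_instVal _).2 hφ
  | eqTermE φ =>
    simp only [List.forall_mem_cons] at hJs
    intro ρ η₀ η₁ r hΦ
    have hφ := (φ.sat_instId _).1 (hJs.2.1 ρ η₀ η₁ r hΦ)
    have he : _ = _ ∧ _ = _ := hJs.1 ρ η₀ η₁ r hΦ
    -- Equality of terms is asserted in both environments because instantiation places a value of
    -- the term in each.
    rw [he.1, he.2] at hφ
    exact (φ.sat_instId _).2 hφ

end RelSep

theorem mainTheorem1 (Js : List RelSep.Judgment) (J : RelSep.Judgment)
    (hR : RelSep.Rule Js J) (hJs : ∀ J' ∈ Js, J'.Valid) : J.Valid :=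
  hR.sound hJs
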